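/- **Theorem 2.** There is a finite set $P$ of points in the plane, not in convex position, and a Delaunay triangulation $T$ of $P$, whose dilation is greater than $1.5846$. Here a Delaunay triangulation of $P$ is a triangulation of the convex hull of $P$ with vertex set $P$ in which no circumcircle of a triangle has a point of $P$ in its interior; the dilation of a pair of distinct points $p,p'\in P$ is the length of a shortest path from $p$ to $p'$ along edges of $T$ divided by the Euclidean distance $\|pp'\|$, and the dilation of $T$ is the maximum of the dilations of all such pairs. Moreover $P$ and $T$ can be chosen as follows. Let $C_+$ and $C_-$ be the unit circles centred at $c_+=(0.29,0)$ and $c_-=(-0.29,0)$ (so their centres are at distance $d=0.58$), and let $C$ be the circle of radius $r=1.1507$ about the origin $o$, the midpoint of $c_+$ and $c_-$. 1. $P$ contains a set $S$ of four points ("shield points"), and all points of $P\setminus S$ lie on the boundary of the union of the three disks bounded by $C_+$, $C_-$ and $C$. 2. For each of the four points $q$ in which one of the unit circles, with centre $c\in\{c_+,c_-\}$, meets $C$, there is a shield point $s\in S$ on the ray from $c$ through $q$, beyond $q$, such that no point of $P$ lies in the interior of the triangle $s\,c\,o$. 3. Every triangle of $T$ either has a shield point as a vertex or has its three vertices on one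 of the circles $C_+$, $C_-$, $C$. 4. There are points $p\in P\cap C_+$ and $p'\in P\cap C_-$ with $\bigl|\|pp'\|-2.4\bigr|\le 0.001$ whose dilation in $T$ is greater than $1.5846$ and less than $1.5847$. -/

import Mathlib

open scoped ENNReal

/-- The Euclidean plane. -/
abbrev Plane : Type := EuclideanSpace ℝ (Fin 2)

/-- A triangulation of (the convex hull of) the finite point set `P`: a simplicial complex whose
vertex set is `P` and whose underlying space is the convex hull of `P`. -/
structure IsTriangulation (P : Finset Plane) (K : Geometry.SimplicialComplex ℝ Plane) : Prop where
  vertices_eq : K.vertices = (P : Set Plane)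
  space_eq : K.space = convexHull ℝ (P : Set Plane)

/-- A Delaunay triangulation of `P`: a triangulation in which the circumcircle (centre `c`,
radius `ρ`) of every triangle has no point of `P` in its interior. Cocircular points may be
triangulated arbitrarily. -/
structure IsDelaunay (P : Finset Plane) (K : Geometry.SimplicialComplex ℝ Plane) : Prop
    extends IsTriangulation P K where
  empty_circumcircle : ∀ t ∈ K.faces, t.card = 3 → ∀ (c : Plane) (ρ : ℝ),
    (∀ x ∈ t, dist x c = ρ) → ∀ x ∈ P, ρ ≤ dist x c

/-- The graph of vertices and edges of a complex. (Faces are closed under passing to nonempty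
subsets, so two distinct vertices of a common face span an edge of the complex.) -/
def edgeGraph (K : Geometry.SimplicialComplex ℝ Plane) : SimpleGraph Plane where
  Adj u v := u ≠ v ∧ ∃ f ∈ K.faces, u ∈ f ∧ v ∈ f
  symm := ⟨fun _ _ h => ⟨h.1.symm, h.2.imp fun _ hf => ⟨hf.1, hf.2.2, hf.2.1⟩⟩⟩
  loopless := ⟨fun _ h => h.1 rfl⟩

/-- The Euclidean length of a walk: the sum of the lengths of its edges. -/
noncomputable def walkLength {G : SimpleGraph Plane} {u v : Plane} (w : G.Walk u v) : ℝ≥0∞ :=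
  (w.darts.map fun e => edist e.fst e.snd).sum

/-- The length of a shortest path in the Euclidean graph `G` (`∞` if there is no path). -/
noncomputable def pathDist (G : SimpleGraph Plane) (u v : Plane) : ℝ≥0∞ :=
  ⨅ w : G.Walk u v, walkLength w

/-- The dilation of a pair of points: graph distance over Euclidean distance. -/
noncomputable def pairDilation (G : SimpleGraph Plane) (u v : Plane) : ℝ≥0∞ :=
  pathDist G u v / edist u v

/-- The dilation of the Euclidean graph `G` on the point set `P`: the maximum of the dilations of
pairs of distinct points. -/
noncomputable def dilation (P : Finset Plane) (G : SimpleGraph Plane) : ℝ≥0∞ :=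
  ⨆ u ∈ P, ⨆ v ∈ P, ⨆ _ : u ≠ v, pairDilation G u v

/-- Centre of the right unit circle, when the centres are at distance `d`. -/
noncomputable def rightCentre (d : ℝ) : Plane := !₂[d / 2, 0]

/-- Centre of the left unit circle. -/
noncomputable def leftCentre (d : ℝ) : Plane := !₂[-(d / 2), 0]

/-- The boundary of the union of the two unit disks, with centres at distance `d`, and the disk of
radius `r` about the midpoint of their centres: it consists of the points of the three circles
that are in none of the three open disks. -/
def outline (d r : ℝ) : Set Plane :=
  (Metric.sphere (rightCentre d) 1 ∪ Metric.sphere (leftCentre d) 1 ∪ Metric.sphere 0 r) \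
    (Metric.ball (rightCentre d) 1 ∪ Metric.ball (leftCentre d) 1 ∪ Metric.ball 0 r)

/-- `P` consists of points on the outer arcs of the three circles and of a set `S` of four shield
points. For each of the four points `q` where a unit circle (centre `c`) meets the third circle,
there is a shield point `s` on the ray from `c` through `q`, beyond `q`, and `P` has a gap
in the angle at `s` between the directions to `c` and to the centre `0` of the third circle. -/
structure IsShieldedConfiguration (d r : ℝ) (P S : Finset Plane) : Prop where
  shields_subset : S ⊆ P
  card_shields : S.card = 4
  mem_outline : ∀ x ∈ P, x ∉ S → x ∈ outline d r
  shield : ∀ c : Plane, c = rightCentre d ∨ c = leftCentre d →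
    ∀ q ∈ Metric.sphere c 1 ∩ Metric.sphere (0 : Plane) r,
      ∃ s ∈ S, (∃ τ : ℝ, 1 < τ ∧ s = AffineMap.lineMap c q τ) ∧
        ∀ x ∈ P, x ∉ interior (convexHull ℝ {s, c, (0 : Plane)})

/-- Every triangle that is not inscribed in one of the three circles belongs to the fan of some
shield point. -/
def CompletedByFans (d r : ℝ) (S : Finset Plane) (K : Geometry.SimplicialComplex ℝ Plane) : Prop :=
  ∀ t ∈ K.faces, t.card = 3 →
    (∃ s ∈ S, s ∈ t) ∨ (t : Set Plane) ⊆ Metric.sphere (rightCentre d) 1 ∨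
      (t : Set Plane) ⊆ Metric.sphere (leftCentre d) 1 ∨ (t : Set Plane) ⊆ Metric.sphere 0 r

/-! The configuration is explicit. Each outer unit arc carries 783 equal chords and each middle arc
140, and four shield points are added. The site set is invariant under `x ↦ -x` and under `mirror`;
the triangulation is invariant only under `x ↦ -x`. The pair is `p = capPt 703` and `-p`. By central
symmetry both ways round the outline polygon from `p` to `-p` have length `halfLen`, so everything
rests on showing that no edge gives a shortcut.

The index 703 balances one competitor. Let `θ` be the polar angle of `p` on the right circle. Going
up to the corner `q` at angle `ψ` and down the vertical chord costs about `ψ - θ + 2 sin ψ`, and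
following the arc down costs `ψ + θ`. The chord does not win when `θ ≤ sin ψ`. Here `θ = (623/783)
ψ`, and `623/783` is a close approximation of `sin ψ / ψ` from below.

Lower bound on paths: `pot` is the outline distance from `p`, suitably extended to the shields. It
is 1-Lipschitz along every edge (`potLe_of_adj`), so its increments telescope along any walk
(`ofReal_le_walkLength`) and the graph distance is exactly `halfLen` (`pathDist_eq_halfLen`). The
triangulation is chosen for this. Near `p` the diagonals of the right cap zigzag between points
almost equally far from `p`. The remaining diagonals fan out from corners and are long compared with
the change of `pot`.

Delaunay property: all sites lie outside or on each of the three circles (`pwRight_nonneg`,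
`pwMid_nonneg`), so the polygons inscribed in these circles may be triangulated at will. The outline
is reflex at its four corners, and triangles bridging such a pocket would cut the corner. The shield
beyond the corner fills the pocket by a fan over the chords that it sees. The circumcircle of a fan
triangle belongs to the pencil spanned by one of the three circles and the chord line, and
`fanEmpty` shows that all other sites are strictly outside it.

Triangulation property: `DelaunayCells` collects local conditions, and `DelaunayCells.isDelaunay`
turns them into a Delaunay complex. If every edge is shared or lies on the hull, a connectedness
argument shows that the triangles fill the hull (`interior_subset_region`). Triangles with different
empty circles are separated by the radical axis, and triangles in the same circle by a chord. The
dilation bounds then come from enclosures of `ψ` and `χ` by Taylor polynomials. -/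

/-! ### Orientation and convex hulls in the plane -/

/-- Twice the signed area of the triangle `u v x`. -/
def crs (u v x : Plane) : ℝ := (v 0 - u 0) * (x 1 - u 1) - (v 1 - u 1) * (x 0 - u 0)

lemma crs_rotate (u v w : Plane) : crs v w u = crs u v w := by simp only [crs]; ring

lemma crs_swap (u v w : Plane) : crs v u w = -crs u v w := by simp only [crs]; ring

lemma crs_neg (u v w : Plane) : crs (-u) (-v) (-w) = crs u v w := by
  simp only [crs, PiLp.neg_apply]; ring

lemma plane_ext {x y : Plane} (h0 : x 0 = y 0) (h1 : x 1 = y 1) : x = y := by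
  ext i; fin_cases i <;> assumption

lemma continuous_crs (u v : Plane) : Continuous (crs u v) := by
  unfold crs; fun_prop

lemma convex_affine_nonneg (a b c : ℝ) : Convex ℝ {x : Plane | 0 ≤ a * x 0 + b * x 1 + c} := by
  intro x hx y hy s t hs ht hst
  simp only [Set.mem_ofPred_eq, PiLp.add_apply, PiLp.smul_apply, smul_eq_mul] at *
  have : a * (s * x 0 + t * y 0) + b * (s * x 1 + t * y 1) + c
      = s * (a * x 0 + b * x 1 + c) + t * (a * y 0 + b * y 1 + c) := by
    linear_combination (-c) * hst
  rw [this]; positivity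

lemma affine_nonneg_of_mem_convexHull {A : Set Plane} {a b c : ℝ}
    (hA : ∀ x ∈ A, 0 ≤ a * x 0 + b * x 1 + c) {x : Plane} (hx : x ∈ convexHull ℝ A) :
    0 ≤ a * x 0 + b * x 1 + c :=
  convexHull_min (s := A) hA (convex_affine_nonneg a b c) hx

lemma crs_eq_affine (u v x : Plane) :
    crs u v x = (-(v 1 - u 1)) * x 0 + (v 0 - u 0) * x 1
      + ((v 1 - u 1) * u 0 - (v 0 - u 0) * u 1) := by
  simp only [crs]; ring

lemma crs_nonneg_of_mem_convexHull {A : Set Plane} {u v : Plane}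
    (hA : ∀ x ∈ A, 0 ≤ crs u v x) {x : Plane} (hx : x ∈ convexHull ℝ A) : 0 ≤ crs u v x := by
  rw [crs_eq_affine]
  exact affine_nonneg_of_mem_convexHull (fun y hy => by rw [← crs_eq_affine]; exact hA y hy) hx

/-- A point of the interior of a set on which a nonconstant affine function is nonnegative
is not a zero of that function. -/
lemma affine_pos_of_mem_interior {A : Set Plane} {a b c : ℝ} (hab : a ≠ 0 ∨ b ≠ 0)
    (hA : ∀ x ∈ A, 0 ≤ a * x 0 + b * x 1 + c) {x : Plane} (hx : x ∈ interior A) :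
    0 < a * x 0 + b * x 1 + c := by
  have hN : 0 < a ^ 2 + b ^ 2 := by
    rcases hab with h | h <;> positivity
  -- Moving from `x` against the gradient stays in the interior for a short time and strictly
  -- decreases the affine function, so it cannot have been zero at `x`.
  let γ : ℝ → Plane := fun t => x + t • !₂[-a, -b]
  have hγ : Continuous γ := by fun_prop
  have h0 : γ 0 = x := by simp [γ]
  have hmem : γ ⁻¹' interior A ∈ nhds (0 : ℝ) :=
    hγ.continuousAt.preimage_mem_nhds (by rw [h0]; exact isOpen_interior.mem_nhds hx)
  obtain ⟨ε, hε, hball⟩ := Metric.mem_nhds_iff.1 hmem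
  have hh : γ (ε / 2) ∈ interior A := hball (by
    rw [Metric.mem_ball, Real.dist_eq, sub_zero, abs_of_pos (by positivity)]; linarith)
  have := hA _ (interior_subset hh)
  simp only [γ, PiLp.add_apply, PiLp.smul_apply, smul_eq_mul, Matrix.cons_val_zero,
    Matrix.cons_val_one] at this
  nlinarith

lemma crs_pos_of_mem_interior {A : Set Plane} {u v : Plane} (huv : u ≠ v)
    (hA : ∀ x ∈ A, 0 ≤ crs u v x) {x : Plane} (hx : x ∈ interior A) : 0 < crs u v x := by
  rw [crs_eq_affine]
  refine affine_pos_of_mem_interior ?_ (fun y hy => by rw [← crs_eq_affine]; exact hA y hy) hx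
  by_contra! h
  exact huv (plane_ext (by linarith) (by linarith))

/-- The three subtriangle areas divided by the total area are the barycentric coordinates of `x`. -/
lemma mem_triangle_of_crs_nonneg {u v w x : Plane} (h : 0 < crs u v w) (h1 : 0 ≤ crs v w x)
    (h2 : 0 ≤ crs w u x) (h3 : 0 ≤ crs u v x) : x ∈ convexHull ℝ {u, v, w} := by
  have hsum : crs v w x + crs w u x + crs u v x = crs u v w := by simp only [crs]; ring
  have key : x = (crs v w x / crs u v w) • u + (crs w u x / crs u v w) • v
      + (crs u v x / crs u v w) • w := by
    apply plane_ext <;>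
    · simp only [PiLp.add_apply, PiLp.smul_apply, smul_eq_mul]
      field_simp
      simp only [crs]; ring
  rw [key]
  have hconv := convex_convexHull ℝ ({u, v, w} : Set Plane)
  refine hconv.sum_mem (t := (Finset.univ : Finset (Fin 3)))
    (w := ![crs v w x / crs u v w, crs w u x / crs u v w, crs u v x / crs u v w])
    (z := ![u, v, w]) ?_ ?_ ?_ |> (fun h => by simpa [Fin.sum_univ_three] using h)
  · intro i _; fin_cases i <;> simp <;> positivity
  · simp only [Fin.sum_univ_three, Matrix.cons_val_zero, Matrix.cons_val_one, Matrix.cons_val]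
    rw [← hsum]; rw [← hsum] at h; field_simp
  · intro i _; apply subset_convexHull; fin_cases i <;> simp

lemma crs_nonneg_of_mem_triangle {u v w x : Plane} (h : 0 < crs u v w)
    (hx : x ∈ convexHull ℝ {u, v, w}) : 0 ≤ crs u v x := by
  refine crs_nonneg_of_mem_convexHull ?_ hx
  rintro y (rfl | rfl | rfl)
  · simp only [crs]; ring_nf; rfl
  · simp only [crs]; ring_nf; rfl
  · exact h.le

lemma triangle_rotate (u v w : Plane) : ({v, w, u} : Set Plane) = {u, v, w} := by
  ext x; simp only [Set.mem_insert_iff, Set.mem_singleton_iff]; tauto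

lemma ne_of_crs_pos {u v w : Plane} (h : 0 < crs u v w) : u ≠ v := by
  rintro rfl; simp [crs] at h

lemma affineIndependent_of_crs_pos {u v w : Plane} (h : 0 < crs u v w) :
    AffineIndependent ℝ ((↑) : ({u, v, w} : Finset Plane) → Plane) := by
  have h1 : AffineIndependent ℝ ![u, v, w] := by
    rw [affineIndependent_iff_not_collinear_set]
    intro hc
    rw [collinear_iff_of_mem (p₀ := u) (by simp)] at hc
    obtain ⟨d, hd⟩ := hc
    obtain ⟨a, ha⟩ := hd v (by simp)
    obtain ⟨b, hb⟩ := hd w (by simp)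
    rw [ha, hb] at h
    simp only [crs, vadd_eq_add, PiLp.add_apply, PiLp.smul_apply, smul_eq_mul] at h
    apply lt_irrefl (0 : ℝ)
    calc 0 < _ := h
      _ = 0 := by ring
  have h2 := h1.range
  have h3 : Set.range ![u, v, w] = (({u, v, w} : Finset Plane) : Set Plane) := by
    ext x; simp [eq_comm]; tauto
  rw [h3] at h2
  exact h2

/-! ### Separation of finite convex hulls by a line -/

/-- The part of a finite convex hull on the zero line of a nonnegative affine function. -/
lemma mem_convexHull_zero_of_affine {A : Finset Plane} {a b c : ℝ}
    (hA : ∀ x ∈ A, 0 ≤ a * x 0 + b * x 1 + c) {x : Plane} (hx : x ∈ convexHull ℝ (A : Set Plane))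
    (h0 : a * x 0 + b * x 1 + c = 0) :
    x ∈ convexHull ℝ {y : Plane | y ∈ A ∧ a * y 0 + b * y 1 + c = 0} := by
  classical
  obtain ⟨w, hw0, hw1, hwx⟩ := Finset.mem_convexHull'.1 hx
  have hx0 : ∑ y ∈ A, w y * y 0 = x 0 := by rw [← hwx]; simp
  have hx1 : ∑ y ∈ A, w y * y 1 = x 1 := by rw [← hwx]; simp
  have hsum : ∑ y ∈ A, w y * (a * y 0 + b * y 1 + c) = 0 := by
    rw [← h0, ← hx0, ← hx1]
    calc _ = ∑ y ∈ A, (a * (w y * y 0) + b * (w y * y 1) + c * w y) :=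
          Finset.sum_congr rfl fun y _ => by ring
      _ = _ := by
          rw [Finset.sum_add_distrib, Finset.sum_add_distrib, ← Finset.mul_sum, ← Finset.mul_sum,
            ← Finset.mul_sum, hw1, mul_one]
  -- A sum of nonnegative terms vanishes, so every point off the line has weight zero.
  have hz := (Finset.sum_eq_zero_iff_of_nonneg
    (fun y hy => mul_nonneg (hw0 y hy) (hA y hy))).1 hsum
  have hset : {y : Plane | y ∈ A ∧ a * y 0 + b * y 1 + c = 0}
      = (A.filter fun y => a * y 0 + b * y 1 + c = 0 : Finset Plane) := by ext; simp
  rw [hset, Finset.mem_convexHull']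
  refine ⟨w, fun y hy => hw0 y (Finset.mem_filter.1 hy).1, ?_, ?_⟩
  · rw [← hw1]
    refine Finset.sum_subset (Finset.filter_subset _ _) fun y hy hny => ?_
    rcases mul_eq_zero.1 (hz y hy) with h | h
    · exact h
    · exact absurd (Finset.mem_filter.2 ⟨hy, h⟩) hny
  · rw [← hwx]
    refine Finset.sum_subset (Finset.filter_subset _ _) fun y hy hny => ?_
    rcases mul_eq_zero.1 (hz y hy) with h | h
    · simp [h]
    · exact absurd (Finset.mem_filter.2 ⟨hy, h⟩) hny

/-- Two finite sets separated by a line. -/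
lemma convexHull_inter_of_separated {A B : Finset Plane} {a b c : ℝ}
    (hA : ∀ x ∈ A, 0 ≤ a * x 0 + b * x 1 + c) (hB : ∀ x ∈ B, a * x 0 + b * x 1 + c ≤ 0)
    {x : Plane} (hxA : x ∈ convexHull ℝ (A : Set Plane)) (hxB : x ∈ convexHull ℝ (B : Set Plane)) :
    x ∈ convexHull ℝ {y : Plane | y ∈ A ∧ a * y 0 + b * y 1 + c = 0} ∧
      x ∈ convexHull ℝ {y : Plane | y ∈ B ∧ a * y 0 + b * y 1 + c = 0} := by
  have h1 := affine_nonneg_of_mem_convexHull hA hxA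
  have hB' : ∀ x ∈ B, 0 ≤ (-a) * x 0 + (-b) * x 1 + (-c) := fun x hx => by linarith [hB x hx]
  have h2 := affine_nonneg_of_mem_convexHull hB' hxB
  refine ⟨mem_convexHull_zero_of_affine hA hxA (by linarith), ?_⟩
  have := mem_convexHull_zero_of_affine hB' hxB (by linarith)
  refine convexHull_mono ?_ this
  rintro y ⟨hy, h0⟩
  exact ⟨hy, by linarith⟩

/-- At most two distinct points are affinely independent, and hulls of subsets of an affinely
independent set meet in the hull of the common points. -/
lemma convexHull_inter_subset_of_subset_pair {A B : Set Plane} {e₁ e₂ x : Plane}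
    (hA : A ⊆ {e₁, e₂}) (hB : B ⊆ {e₁, e₂}) (hxA : x ∈ convexHull ℝ A)
    (hxB : x ∈ convexHull ℝ B) : x ∈ convexHull ℝ (A ∩ B) := by
  classical
  have hfA := (Set.toFinite ({e₁, e₂} : Set Plane)).subset hA
  have hfB := (Set.toFinite ({e₁, e₂} : Set Plane)).subset hB
  have hind : AffineIndependent ℝ ((↑) : ({e₁, e₂} : Finset Plane) → Plane) := by
    have := (affineIndependent_of_ne ℝ (p₁ := e₁) (p₂ := e₂))
    by_cases h : e₁ = e₂
    · subst h
      have : Subsingleton (({e₁, e₁} : Finset Plane) : Type _) := by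
        rw [Finset.pair_eq_singleton]; infer_instance
      exact affineIndependent_of_subsingleton ℝ _
    · have h2 := (this h).range
      have h3 : Set.range ![e₁, e₂] = (({e₁, e₂} : Finset Plane) : Set Plane) := by
        ext x; simp [eq_comm]; tauto
      rw [h3] at h2
      exact h2
  have := hind.convexHull_inter (t₁ := hfA.toFinset) (t₂ := hfB.toFinset)
    (by intro y hy; simpa using hA (hfA.mem_toFinset.1 hy))
    (by intro y hy; simpa using hB (hfB.mem_toFinset.1 hy))
  simp only [Set.Finite.coe_toFinset] at this
  rw [this]; exact ⟨hxA, hxB⟩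

/-- Two triangles separated by a line that contains at most two of the vertices. -/
lemma convexHull_inter_subset_of_line {A B : Finset Plane} {e₁ e₂ : Plane} (a b c : ℝ)
    (hA : ∀ x ∈ A, 0 ≤ a * x 0 + b * x 1 + c) (hB : ∀ x ∈ B, a * x 0 + b * x 1 + c ≤ 0)
    (hA0 : ∀ x ∈ A, a * x 0 + b * x 1 + c = 0 → x = e₁ ∨ x = e₂)
    (hB0 : ∀ x ∈ B, a * x 0 + b * x 1 + c = 0 → x = e₁ ∨ x = e₂) :
    convexHull ℝ (A : Set Plane) ∩ convexHull ℝ (B : Set Plane) ⊆ convexHull ℝ (A ∩ B : Set Plane)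
    := by
  rintro x ⟨hxA, hxB⟩
  obtain ⟨h1, h2⟩ := convexHull_inter_of_separated hA hB hxA hxB
  refine convexHull_mono ?_ (convexHull_inter_subset_of_subset_pair (e₁ := e₁) (e₂ := e₂)
    ?_ ?_ h1 h2)
  · rintro y ⟨hy, hy'⟩; exact ⟨hy.1, hy'.1⟩
  · rintro y ⟨hy, h0⟩; exact hA0 y hy h0
  · rintro y ⟨hy, h0⟩; exact hB0 y hy h0

/-! ### Circles -/

/-- The power of the point `x` with respect to the circle with centre `z` and squared
radius `q`. -/
def pw (z : Plane) (q : ℝ) (x : Plane) : ℝ := (x 0 - z 0) ^ 2 + (x 1 - z 1) ^ 2 - q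

lemma dist_sq_plane (x y : Plane) : dist x y ^ 2 = (x 0 - y 0) ^ 2 + (x 1 - y 1) ^ 2 := by
  rw [EuclideanSpace.dist_eq, Real.sq_sqrt (by positivity)]
  simp [Fin.sum_univ_two, Real.dist_eq, sq_abs]

/-- Two finite sets on two circles, each outside the other circle; the second circle contains no
point of the first set outside the second set. -/
lemma convexHull_inter_subset_of_empty_circles {A B : Finset Plane} {z z' : Plane} {q q' : ℝ}
    (hA : ∀ x ∈ A, pw z q x = 0) (hB : ∀ x ∈ B, pw z' q' x = 0) (hAB : ∀ x ∈ A, 0 ≤ pw z' q' x)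
    (hBA : ∀ x ∈ B, 0 ≤ pw z q x) (hne : ∀ x ∈ A, pw z' q' x = 0 → x ∈ B) :
    convexHull ℝ (A : Set Plane) ∩ convexHull ℝ (B : Set Plane) ⊆ convexHull ℝ (A ∩ B : Set Plane)
    := by
  -- The difference of two powers is affine and its zero line is the radical axis. Emptiness of both
  -- circles puts `A` and `B` on opposite sides of it.
  have key : ∀ x : Plane, 2 * (z 0 - z' 0) * x 0 + 2 * (z 1 - z' 1) * x 1
      + (z' 0 ^ 2 + z' 1 ^ 2 - q' - z 0 ^ 2 - z 1 ^ 2 + q) = pw z' q' x - pw z q x := by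
    intro x; simp only [pw]; ring
  rintro x ⟨hxA, hxB⟩
  obtain ⟨h1, -⟩ := convexHull_inter_of_separated
    (a := 2 * (z 0 - z' 0)) (b := 2 * (z 1 - z' 1))
    (c := z' 0 ^ 2 + z' 1 ^ 2 - q' - z 0 ^ 2 - z 1 ^ 2 + q)
    (fun x hx => by rw [key, hA x hx]; linarith [hAB x hx])
    (fun x hx => by rw [key, hB x hx]; linarith [hBA x hx]) hxA hxB
  refine convexHull_mono ?_ h1
  rintro y ⟨hy, h0⟩
  rw [key, hA y hy, sub_zero] at h0
  exact ⟨hy, hne y hy h0⟩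

/-- Two circles through the vertices of a triangle have the same power function. -/
lemma pw_eq_of_triangle {u v w z z' : Plane} {q q' : ℝ} (h : 0 < crs u v w)
    (hu : pw z q u = 0) (hv : pw z q v = 0) (hw : pw z q w = 0)
    (hu' : pw z' q' u = 0) (hv' : pw z' q' v = 0) (hw' : pw z' q' w = 0) (x : Plane) :
    pw z q x = pw z' q' x := by
  -- The quadratic terms cancel in the difference, which is therefore affine and given by
  -- barycentric interpolation from the three vertices.
  have e : ∀ x : Plane, crs u v w * (pw z q x - pw z' q' x)
      = crs v w x * (pw z q u - pw z' q' u) + crs w u x * (pw z q v - pw z' q' v)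
        + crs u v x * (pw z q w - pw z' q' w) := by
    intro x; simp only [pw, crs]; ring
  have := e x
  rw [hu, hv, hw, hu', hv', hw'] at this
  simp only [sub_zero, mul_zero, add_zero, mul_eq_zero] at this
  rcases this with h' | h'
  · exact absurd h' h.ne'
  · linarith

/-! ### From oriented triangles to a Delaunay complex -/

/-- `Cell u v w` says that `u v w` is a counterclockwise triangle of a family with vertices in `P`:
the triangles meet in common faces, have empty circumcircles, and each of their edges is either
shared with a triangle on its other side or lies on the boundary of the convex hull of `P`. -/
structure DelaunayCells (P : Finset Plane) (Cell : Plane → Plane → Plane → Prop) : Prop where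
  nonempty : P.Nonempty
  rotate : ∀ {u v w}, Cell u v w → Cell v w u
  crs_pos : ∀ {u v w}, Cell u v w → 0 < crs u v w
  mem : ∀ {u v w}, Cell u v w → u ∈ P
  exists_cell : ∀ x ∈ P, ∃ v w, Cell x v w
  neighbour : ∀ {u v w}, Cell u v w → (∃ w', Cell v u w') ∨ ∀ x ∈ P, 0 ≤ crs u v x
  inter : ∀ {u v w u' v' w'}, Cell u v w → Cell u' v' w' →
    convexHull ℝ {u, v, w} ∩ convexHull ℝ {u', v', w'} ⊆
      convexHull ℝ (({u, v, w} : Set Plane) ∩ {u', v', w'})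
  circle : ∀ {u v w}, Cell u v w → ∃ z q, pw z q u = 0 ∧ pw z q v = 0 ∧ pw z q w = 0 ∧
    ∀ x ∈ P, 0 ≤ pw z q x

namespace DelaunayCells

variable {P : Finset Plane} {Cell : Plane → Plane → Plane → Prop}

/-- The union of the triangles. -/
def region (Cell : Plane → Plane → Plane → Prop) : Set Plane :=
  {x | ∃ u v w, Cell u v w ∧ x ∈ convexHull ℝ {u, v, w}}

lemma region_subset (hC : DelaunayCells P Cell) : region Cell ⊆ convexHull ℝ (P : Set Plane) := by
  rintro x ⟨u, v, w, h, hx⟩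
  refine convexHull_mono ?_ hx
  rintro y (rfl | rfl | rfl)
  · exact hC.mem h
  · exact hC.mem (hC.rotate h)
  · exact hC.mem (hC.rotate (hC.rotate h))

lemma subset_region (hC : DelaunayCells P Cell) : (P : Set Plane) ⊆ region Cell := by
  intro x hx
  obtain ⟨v, w, h⟩ := hC.exists_cell x hx
  exact ⟨x, v, w, h, subset_convexHull ℝ _ (by simp)⟩

lemma isClosed_region (hC : DelaunayCells P Cell) : IsClosed (region Cell) := by
  have : region Cell = ⋃ t ∈ {t : Plane × Plane × Plane | Cell t.1 t.2.1 t.2.2},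
      convexHull ℝ {t.1, t.2.1, t.2.2} := by
    ext x
    simp [region]
  rw [this]
  refine Set.Finite.isClosed_biUnion ?_ fun t _ => ?_
  · refine ((P ×ˢ P ×ˢ P).finite_toSet).subset ?_
    rintro ⟨u, v, w⟩ h
    simp only [Finset.coe_product, Set.mem_prod, Finset.mem_coe]
    exact ⟨hC.mem h, hC.mem (hC.rotate h), hC.mem (hC.rotate (hC.rotate h))⟩
  · exact ((Set.toFinite _).isCompact_convexHull ℝ).isClosed

lemma open_triangle_subset_interior (hC : DelaunayCells P Cell) {u v w x : Plane}
    (h : Cell u v w) (h1 : 0 < crs v w x) (h2 : 0 < crs w u x) (h3 : 0 < crs u v x) :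
    x ∈ interior (region Cell) := by
  rw [mem_interior]
  refine ⟨{y | 0 < crs v w y} ∩ {y | 0 < crs w u y} ∩ {y | 0 < crs u v y}, ?_, ?_, ?_⟩
  · rintro y ⟨⟨hy1, hy2⟩, hy3⟩
    exact ⟨u, v, w, h, mem_triangle_of_crs_nonneg (hC.crs_pos h) (le_of_lt hy1) (le_of_lt hy2)
      (le_of_lt hy3)⟩
  · exact ((isOpen_lt continuous_const (continuous_crs v w)).inter
      (isOpen_lt continuous_const (continuous_crs w u))).inter
      (isOpen_lt continuous_const (continuous_crs u v))
  · exact ⟨⟨h1, h2⟩, h3⟩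

/-- A point in the interior of an edge. -/
lemma mem_interior_of_edge (hC : DelaunayCells P Cell) {u v w x : Plane}
    (h : Cell u v w) (hx : x ∈ interior (convexHull ℝ (P : Set Plane)))
    (h1 : 0 < crs v w x) (h2 : 0 < crs w u x) (h3 : crs u v x = 0) :
    x ∈ interior (region Cell) := by
  have huvw := hC.crs_pos h
  have huv : u ≠ v := ne_of_crs_pos huvw
  rcases hC.neighbour h with ⟨w', h'⟩ | hull
  · have hw' := hC.crs_pos h'
    -- Since `x` is on the line `u v`, its position between `u` and `v` is the same seen from either
    -- triangle; so positivity passes from the triangle with apex `w` to the one with apex `w'`.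
    have e1 : crs u v w * crs u w' x = crs w u x * crs v u w' := by
      have : crs u v w * crs u w' x - crs w u x * crs v u w' = crs u v x * crs u w' w := by
        simp only [crs]; ring
      rw [h3, zero_mul] at this; linarith
    have e2 : crs u v w * crs w' v x = crs v w x * crs v u w' := by
      have : crs u v w * crs w' v x - crs v w x * crs v u w' = crs u v x * crs w' v w := by
        simp only [crs]; ring
      rw [h3, zero_mul] at this; linarith
    have p1 : 0 < crs u w' x := pos_of_mul_pos_right (by rw [e1]; positivity) huvw.le
    have p2 : 0 < crs w' v x := pos_of_mul_pos_right (by rw [e2]; positivity) huvw.le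
    rw [mem_interior]
    -- This open neighbourhood of `x` is bounded by the lines of the four outer sides; the line `u
    -- v` cuts it into pieces lying in the two triangles.
    refine ⟨({y | 0 < crs v w y} ∩ {y | 0 < crs w u y}) ∩
      ({y | 0 < crs u w' y} ∩ {y | 0 < crs w' v y}), ?_, ?_, ?_⟩
    · rintro y ⟨⟨hy1, hy2⟩, hy3, hy4⟩
      rcases le_total 0 (crs u v y) with hy | hy
      · exact ⟨u, v, w, h, mem_triangle_of_crs_nonneg huvw (le_of_lt hy1) (le_of_lt hy2) hy⟩
      · refine ⟨v, u, w', h', mem_triangle_of_crs_nonneg hw' (le_of_lt hy3) (le_of_lt hy4) ?_⟩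
        rw [crs_swap]; linarith
    · exact ((isOpen_lt continuous_const (continuous_crs v w)).inter
        (isOpen_lt continuous_const (continuous_crs w u))).inter
        ((isOpen_lt continuous_const (continuous_crs u w')).inter
        (isOpen_lt continuous_const (continuous_crs w' v)))
    · exact ⟨⟨h1, h2⟩, p1, p2⟩
  · exact absurd h3 (crs_pos_of_mem_interior huv
      (fun y hy => crs_nonneg_of_mem_convexHull (fun z hz => hull z hz) hy) hx).ne'

lemma eq_of_crs_eq_zero {u v w x : Plane} (h : 0 < crs u v w) (h1 : crs v w x = 0)
    (h3 : crs u v x = 0) : x = v := by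
  apply plane_ext
  · have : crs u v w * (x 0 - v 0) = crs v w x * (u 0 - v 0) + crs u v x * (w 0 - v 0) := by
      simp only [crs]; ring
    rw [h1, h3, zero_mul, zero_mul, add_zero, mul_eq_zero] at this
    rcases this with h' | h' <;> linarith
  · have : crs u v w * (x 1 - v 1) = crs v w x * (u 1 - v 1) + crs u v x * (w 1 - v 1) := by
      simp only [crs]; ring
    rw [h1, h3, zero_mul, zero_mul, add_zero, mul_eq_zero] at this
    rcases this with h' | h' <;> linarith

/-- Inside the hull the region can have boundary points only at sites: any other point of a cell is
interior to the cell or to an edge, and such an edge has a cell on its other side. -/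
lemma mem_interior_region (hC : DelaunayCells P Cell) {x : Plane}
    (hx : x ∈ interior (convexHull ℝ (P : Set Plane))) (hxP : x ∉ P) (hxr : x ∈ region Cell) :
    x ∈ interior (region Cell) := by
  obtain ⟨u, v, w, h, hxt⟩ := hxr
  have hp := hC.crs_pos h
  have c3 := crs_nonneg_of_mem_triangle hp hxt
  have c1 : 0 ≤ crs v w x := crs_nonneg_of_mem_triangle (w := u) (by rwa [crs_rotate])
    (by rwa [triangle_rotate])
  have c2 : 0 ≤ crs w u x := crs_nonneg_of_mem_triangle (w := v)
    (by rwa [crs_rotate, crs_rotate]) (by rwa [triangle_rotate, triangle_rotate])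
  have hv := hC.mem (hC.rotate h)
  have hw := hC.mem (hC.rotate (hC.rotate h))
  have hu := hC.mem h
  have n1 : ¬ (crs v w x = 0 ∧ crs u v x = 0) := fun ⟨a, b⟩ =>
    hxP (by rw [eq_of_crs_eq_zero hp a b]; exact hv)
  have n2 : ¬ (crs w u x = 0 ∧ crs v w x = 0) := fun ⟨a, b⟩ =>
    hxP (by rw [eq_of_crs_eq_zero (u := v) (by rwa [crs_rotate]) a b]; exact hw)
  have n3 : ¬ (crs u v x = 0 ∧ crs w u x = 0) := fun ⟨a, b⟩ =>
    hxP (by rw [eq_of_crs_eq_zero (u := w) (by rwa [crs_rotate, crs_rotate]) a b]; exact hu)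
  rcases c1.eq_or_lt with d1 | d1
  · rcases c2.eq_or_lt with d2 | d2
    · exact absurd ⟨d2.symm, d1.symm⟩ n2
    rcases c3.eq_or_lt with d3 | d3
    · exact absurd ⟨d1.symm, d3.symm⟩ n1
    exact hC.mem_interior_of_edge (hC.rotate h) hx d2 d3 d1.symm
  · rcases c2.eq_or_lt with d2 | d2
    · rcases c3.eq_or_lt with d3 | d3
      · exact absurd ⟨d3.symm, d2.symm⟩ n3
      exact hC.mem_interior_of_edge (hC.rotate (hC.rotate h)) hx d3 d1 d2.symm
    · rcases c3.eq_or_lt with d3 | d3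
      · exact hC.mem_interior_of_edge h hx d1 d2 d3.symm
      · exact hC.open_triangle_subset_interior h d1 d2 d3

/-! ### The triangles fill the convex hull -/

lemma exists_mem_interior_region (hC : DelaunayCells P Cell) :
    (interior (region Cell)).Nonempty := by
  obtain ⟨x, hx⟩ := hC.nonempty
  obtain ⟨v, w, h⟩ := hC.exists_cell x hx
  have hp := hC.crs_pos h
  refine ⟨(1 / 3 : ℝ) • (x + v + w), hC.open_triangle_subset_interior h ?_ ?_ ?_⟩ <;>
  · simp only [crs, PiLp.smul_apply, PiLp.add_apply, smul_eq_mul] at *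
    linarith

/-- If `x` were missed, join it to an interior point `y` of the region by a segment through no site.
Such a `y` exists because the lines from `x` through the finitely many sites are null sets. Along
the segment the region is both open, by `mem_interior_region`, and closed, which contradicts
connectedness. -/
lemma interior_subset_region (hC : DelaunayCells P Cell) :
    interior (convexHull ℝ (P : Set Plane)) ⊆ region Cell := by
  intro x hx
  by_contra hxr
  let line : Plane → AffineSubspace ℝ Plane := fun p => AffineSubspace.mk' x (ℝ ∙ (p - x))
  have hline : ∀ p, line p ≠ ⊤ := by
    intro p htop
    have hd : (line p).direction = ⊤ := by rw [htop]; exact AffineSubspace.direction_top _ _ _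
    rw [AffineSubspace.direction_mk'] at hd
    have h1 : Module.finrank ℝ (ℝ ∙ (p - x)) ≤ 1 := by
      simpa using finrank_span_le_card (R := ℝ) ({p - x} : Set Plane)
    rw [hd, finrank_top] at h1
    simp at h1
  have hnull : MeasureTheory.volume (⋃ p ∈ P, (line p : Set Plane)) = 0 := by
    exact (MeasureTheory.measure_biUnion_null_iff P.countable_toSet).2
      fun p _ => MeasureTheory.Measure.addHaar_affineSubspace _ _ (hline p)
  have hpos : 0 < MeasureTheory.volume (interior (region Cell)) :=
    isOpen_interior.measure_pos _ hC.exists_mem_interior_region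
  obtain ⟨y, hy, hyl⟩ : ∃ y ∈ interior (region Cell), y ∉ ⋃ p ∈ P, (line p : Set Plane) := by
    by_contra! hcon
    exact absurd (MeasureTheory.measure_mono_null hcon hnull) hpos.ne'
  have hyH : y ∈ interior (convexHull ℝ (P : Set Plane)) := interior_mono hC.region_subset hy
  have hseg : segment ℝ x y ⊆ interior (convexHull ℝ (P : Set Plane)) :=
    (convex_convexHull ℝ _).interior.segment_subset hx hyH
  have havoid : ∀ z ∈ segment ℝ x y, z ∉ P := by
    intro z hz hzP
    apply hyl
    rw [segment_eq_image'] at hz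
    obtain ⟨t, -, rfl⟩ := hz
    rcases eq_or_ne t 0 with rfl | ht
    · exact absurd (hC.subset_region (by simpa using hzP)) hxr
    refine Set.mem_biUnion hzP ?_
    simp only [line, SetLike.mem_coe, AffineSubspace.mem_mk', vsub_eq_sub, add_sub_cancel_left,
      Submodule.mem_span_singleton]
    exact ⟨t⁻¹, by rw [smul_smul, inv_mul_cancel₀ ht, one_smul]⟩
  have hsub := IsPreconnected.subset_left_of_subset_union (s := segment ℝ x y) isOpen_interior
    hC.isClosed_region.isOpen_compl
    (Set.disjoint_left.2 fun z hz hz' => hz' (interior_subset hz))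
    (fun z hz => by
      by_cases hzr : z ∈ region Cell
      · exact Or.inl (hC.mem_interior_region (hseg hz) (havoid z hz) hzr)
      · exact Or.inr hzr)
    ⟨y, right_mem_segment ℝ x y, hy⟩ (convex_segment x y).isPreconnected
  exact hxr (interior_subset (hsub (left_mem_segment ℝ x y)))

/-- A convex set with nonempty interior lies in the closure of that interior, and the region is
closed. -/
lemma region_eq (hC : DelaunayCells P Cell) : region Cell = convexHull ℝ (P : Set Plane) := by
  refine hC.region_subset.antisymm ?_
  have h1 : (interior (convexHull ℝ (P : Set Plane))).Nonempty :=
    hC.exists_mem_interior_region.mono (interior_mono hC.region_subset)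
  have h2 := (convex_convexHull ℝ (P : Set Plane)).closure_interior_eq_closure_of_nonempty_interior
    h1
  calc convexHull ℝ (P : Set Plane) ⊆ closure (convexHull ℝ (P : Set Plane)) := subset_closure
    _ = closure (interior (convexHull ℝ (P : Set Plane))) := h2.symm
    _ ⊆ region Cell := closure_minimal hC.interior_subset_region hC.isClosed_region

/-- The complex formed by the triangles and their faces. -/
noncomputable def complex (hC : DelaunayCells P Cell) : Geometry.SimplicialComplex ℝ Plane where
  faces := {t | t.Nonempty ∧ ∃ u v w, Cell u v w ∧ t ⊆ {u, v, w}}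
  isRelLowerSet_faces := by
    rintro t ⟨hne, u, v, w, h, ht⟩
    exact ⟨hne, fun s hs hsne => ⟨hsne, u, v, w, h, hs.trans ht⟩⟩
  indep := by
    rintro t ⟨-, u, v, w, h, ht⟩
    exact (affineIndependent_of_crs_pos (hC.crs_pos h)).mono (by exact_mod_cast ht)
  inter_subset_convexHull := by
    classical
    rintro s t ⟨-, u, v, w, h, hs⟩ ⟨-, u', v', w', h', ht⟩ x ⟨hxs, hxt⟩
    have i := affineIndependent_of_crs_pos (hC.crs_pos h)
    have i' := affineIndependent_of_crs_pos (hC.crs_pos h')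
    have hx : x ∈ convexHull ℝ ((({u, v, w} : Finset Plane) ∩ {u', v', w'} : Finset Plane) :
        Set Plane) := by
      have := hC.inter h h' ⟨convexHull_mono (fun y hy => by simpa using hs hy) hxs,
        convexHull_mono (fun y hy => by simpa using ht hy) hxt⟩
      simpa using this
    -- The cells meet in the hull of their common vertices. Intersecting with the face `s` inside
    -- the first cell, and then with `t` inside the second, uses affine independence of each cell
    -- once.
    have h1 := i.convexHull_inter hs (t₂ := {u, v, w} ∩ {u', v', w'}) Finset.inter_subset_left
    have hx1 : x ∈ convexHull ℝ ((s ∩ {u', v', w'} : Finset Plane) : Set Plane) := by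
      have : x ∈ convexHull ℝ (s ∩ (({u, v, w} ∩ {u', v', w'} : Finset Plane) : Set Plane)) := by
        rw [h1]; exact ⟨hxs, hx⟩
      refine convexHull_mono ?_ this
      rintro y ⟨hy, hy'⟩
      rw [Finset.mem_coe, Finset.mem_inter] at hy' ⊢
      exact ⟨hy, hy'.2⟩
    have h2 := i'.convexHull_inter (t₁ := s ∩ {u', v', w'}) Finset.inter_subset_right ht
    have : x ∈ convexHull ℝ (((s ∩ {u', v', w'} : Finset Plane) : Set Plane) ∩ t) := by
      rw [h2]; exact ⟨hx1, hxt⟩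
    refine convexHull_mono ?_ this
    rintro y ⟨hy, hy'⟩
    exact ⟨(Finset.mem_inter.1 hy).1, hy'⟩

lemma mem_faces (hC : DelaunayCells P Cell) {t : Finset Plane} :
    t ∈ hC.complex.faces ↔ t.Nonempty ∧ ∃ u v w, Cell u v w ∧ t ⊆ {u, v, w} := Iff.rfl

lemma exists_eq_of_card (hC : DelaunayCells P Cell) {t : Finset Plane}
    (ht : t ∈ hC.complex.faces) (h3 : t.card = 3) : ∃ u v w, Cell u v w ∧ t = {u, v, w} := by
  obtain ⟨-, u, v, w, h, hsub⟩ := ht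
  exact ⟨u, v, w, h, Finset.eq_of_subset_of_card_le hsub (by rw [h3]; exact Finset.card_le_three)⟩

lemma isDelaunay (hC : DelaunayCells P Cell) : IsDelaunay P hC.complex where
  vertices_eq := by
    ext x
    rw [Geometry.SimplicialComplex.mem_vertices, mem_faces]
    constructor
    · rintro ⟨-, u, v, w, h, hx⟩
      have : x ∈ ({u, v, w} : Finset Plane) := hx (by simp)
      simp only [Finset.mem_insert, Finset.mem_singleton] at this
      rcases this with rfl | rfl | rfl
      · exact hC.mem h
      · exact hC.mem (hC.rotate h)
      · exact hC.mem (hC.rotate (hC.rotate h))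
    · intro hx
      obtain ⟨v, w, h⟩ := hC.exists_cell x hx
      exact ⟨by simp, x, v, w, h, by simp⟩
  space_eq := by
    rw [← hC.region_eq]
    ext x
    rw [Geometry.SimplicialComplex.mem_space_iff]
    constructor
    · rintro ⟨t, ⟨-, u, v, w, h, ht⟩, hx⟩
      exact ⟨u, v, w, h, convexHull_mono (fun y hy => by simpa using ht hy) hx⟩
    · rintro ⟨u, v, w, h, hx⟩
      exact ⟨{u, v, w}, ⟨by simp, u, v, w, h, subset_rfl⟩, by simpa using hx⟩
  empty_circumcircle := by
    intro t ht h3 c ρ hc x hx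
    obtain ⟨u, v, w, h, rfl⟩ := hC.exists_eq_of_card ht h3
    obtain ⟨z, q, hu, hv, hw, hP⟩ := hC.circle h
    have hpw : ∀ y ∈ ({u, v, w} : Finset Plane), pw c (ρ ^ 2) y = 0 := fun y hy => by
      rw [pw, ← dist_sq_plane, hc y hy, sub_self]
    have hρ : 0 ≤ ρ := by rw [← hc u (by simp)]; exact dist_nonneg
    -- The circumcircle is unique, so an arbitrary `c`, `ρ` through the vertices inherits emptiness
    -- from the certified circle.
    have := pw_eq_of_triangle (hC.crs_pos h) hu hv hw (hpw u (by simp)) (hpw v (by simp))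
      (hpw w (by simp)) x
    have h4 := hP x hx
    rw [this, pw, ← dist_sq_plane] at h4
    exact abs_le_of_sq_le_sq' (by linarith) dist_nonneg |>.2

end DelaunayCells

/-! ### Taylor bounds for sine and cosine -/

/-- One rung of a ladder: each Taylor remainder below is the derivative of the next, and the ladder
starts from the cubic lower bound for sine. -/
lemma nonneg_of_hasDerivAt_nonneg {f f' : ℝ → ℝ} (hf : ∀ x, HasDerivAt f (f' x) x) (h0 : f 0 = 0)
    (h : ∀ x, 0 ≤ x → 0 ≤ f' x) {x : ℝ} (hx : 0 ≤ x) : 0 ≤ f x := by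
  have hm : MonotoneOn f (Set.Ici 0) := by
    refine monotoneOn_of_deriv_nonneg (convex_Ici 0)
      (fun y _ => (hf y).continuousAt.continuousWithinAt)
      (fun y _ => (hf y).differentiableAt.differentiableWithinAt) ?_
    intro y hy
    rw [interior_Ici] at hy
    rw [(hf y).deriv]
    exact h y (le_of_lt hy)
  rw [← h0]
  exact hm Set.self_mem_Ici hx hx

lemma cos_le_taylor_four {x : ℝ} (hx : 0 ≤ x) : Real.cos x ≤ 1 - x ^ 2 / 2 + x ^ 4 / 24 := by
  have := nonneg_of_hasDerivAt_nonneg (f := fun x => 1 - x ^ 2 / 2 + x ^ 4 / 24 - Real.cos x)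
    (f' := fun x => Real.sin x - (x - x ^ 3 / 6)) (fun x => by
      have h := (((hasDerivAt_const x (1 : ℝ)).sub ((hasDerivAt_pow 2 x).div_const 2)).add
        ((hasDerivAt_pow 4 x).div_const 24)).sub (Real.hasDerivAt_cos x)
      convert! h using 1; push_cast; ring) (by simp)
    (fun x hx => by
      rcases hx.eq_or_lt with rfl | h
      · simp
      · linarith [Real.sin_gt_sub_cube h]) hx
  linarith

lemma sin_le_taylor_five {x : ℝ} (hx : 0 ≤ x) :
    Real.sin x ≤ x - x ^ 3 / 6 + x ^ 5 / 120 := by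
  have := nonneg_of_hasDerivAt_nonneg (f := fun x => x - x ^ 3 / 6 + x ^ 5 / 120 - Real.sin x)
    (f' := fun x => 1 - x ^ 2 / 2 + x ^ 4 / 24 - Real.cos x) (fun x => by
      have h := (((hasDerivAt_id x).sub ((hasDerivAt_pow 3 x).div_const 6)).add
        ((hasDerivAt_pow 5 x).div_const 120)).sub (Real.hasDerivAt_sin x)
      convert! h using 1; push_cast; ring) (by simp)
    (fun x hx => by linarith [cos_le_taylor_four hx]) hx
  linarith

lemma taylor_six_le_cos {x : ℝ} (hx : 0 ≤ x) :
    1 - x ^ 2 / 2 + x ^ 4 / 24 - x ^ 6 / 720 ≤ Real.cos x := by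
  have := nonneg_of_hasDerivAt_nonneg
    (f := fun x => Real.cos x - (1 - x ^ 2 / 2 + x ^ 4 / 24 - x ^ 6 / 720))
    (f' := fun x => x - x ^ 3 / 6 + x ^ 5 / 120 - Real.sin x) (fun x => by
      have h := (Real.hasDerivAt_cos x).sub
        ((((hasDerivAt_const x (1 : ℝ)).sub ((hasDerivAt_pow 2 x).div_const 2)).add
        ((hasDerivAt_pow 4 x).div_const 24)).sub ((hasDerivAt_pow 6 x).div_const 720))
      convert! h using 1; push_cast; ring) (by simp)
    (fun x hx => by linarith [sin_le_taylor_five hx]) hx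
  linarith

lemma taylor_seven_le_sin {x : ℝ} (hx : 0 ≤ x) :
    x - x ^ 3 / 6 + x ^ 5 / 120 - x ^ 7 / 5040 ≤ Real.sin x := by
  have := nonneg_of_hasDerivAt_nonneg
    (f := fun x => Real.sin x - (x - x ^ 3 / 6 + x ^ 5 / 120 - x ^ 7 / 5040))
    (f' := fun x => Real.cos x - (1 - x ^ 2 / 2 + x ^ 4 / 24 - x ^ 6 / 720)) (fun x => by
      have h := (Real.hasDerivAt_sin x).sub
        ((((hasDerivAt_id x).sub ((hasDerivAt_pow 3 x).div_const 6)).add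
        ((hasDerivAt_pow 5 x).div_const 120)).sub ((hasDerivAt_pow 7 x).div_const 5040))
      convert! h using 1; push_cast; ring) (by simp)
    (fun x hx => by linarith [taylor_six_le_cos hx]) hx
  linarith

lemma cos_le_taylor_eight {x : ℝ} (hx : 0 ≤ x) :
    Real.cos x ≤ 1 - x ^ 2 / 2 + x ^ 4 / 24 - x ^ 6 / 720 + x ^ 8 / 40320 := by
  have := nonneg_of_hasDerivAt_nonneg
    (f := fun x => 1 - x ^ 2 / 2 + x ^ 4 / 24 - x ^ 6 / 720 + x ^ 8 / 40320 - Real.cos x)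
    (f' := fun x => Real.sin x - (x - x ^ 3 / 6 + x ^ 5 / 120 - x ^ 7 / 5040)) (fun x => by
      have h := (((((hasDerivAt_const x (1 : ℝ)).sub ((hasDerivAt_pow 2 x).div_const 2)).add
        ((hasDerivAt_pow 4 x).div_const 24)).sub ((hasDerivAt_pow 6 x).div_const 720)).add
        ((hasDerivAt_pow 8 x).div_const 40320)).sub (Real.hasDerivAt_cos x)
      convert! h using 1; push_cast; ring) (by simp)
    (fun x hx => by linarith [taylor_seven_le_sin hx]) hx
  linarith

lemma sin_le_taylor_nine {x : ℝ} (hx : 0 ≤ x) :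
    Real.sin x ≤ x - x ^ 3 / 6 + x ^ 5 / 120 - x ^ 7 / 5040 + x ^ 9 / 362880 := by
  have := nonneg_of_hasDerivAt_nonneg
    (f := fun x => x - x ^ 3 / 6 + x ^ 5 / 120 - x ^ 7 / 5040 + x ^ 9 / 362880 - Real.sin x)
    (f' := fun x => 1 - x ^ 2 / 2 + x ^ 4 / 24 - x ^ 6 / 720 + x ^ 8 / 40320 - Real.cos x)
    (fun x => by
      have h := (((((hasDerivAt_id x).sub ((hasDerivAt_pow 3 x).div_const 6)).add
        ((hasDerivAt_pow 5 x).div_const 120)).sub ((hasDerivAt_pow 7 x).div_const 5040)).add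
        ((hasDerivAt_pow 9 x).div_const 362880)).sub (Real.hasDerivAt_sin x)
      convert! h using 1; push_cast; ring) (by simp)
    (fun x hx => by linarith [cos_le_taylor_eight hx]) hx
  linarith

/-! ### The constants of the configuration -/

/-- The radius of the middle circle. -/
noncomputable def rad : ℝ := 11507 / 10000

/-- The polar angle, about the centre of the right unit circle, of its upper intersection with the
middle circle. -/
noncomputable def psi : ℝ := Real.arccos (24001049 / 58000000)

/-- The polar angle, about the origin, of the same intersection point. -/
noncomputable def chi : ℝ := Real.arccos (40821049 / 58000000 / rad)

lemma psi_mem : psi ∈ Set.Icc 0 Real.pi := ⟨Real.arccos_nonneg _, Real.arccos_le_pi _⟩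
lemma chi_mem : chi ∈ Set.Icc 0 Real.pi := ⟨Real.arccos_nonneg _, Real.arccos_le_pi _⟩

lemma cos_psi : Real.cos psi = 24001049 / 58000000 :=
  Real.cos_arccos (by norm_num) (by norm_num)

/-- Subtracting the equations of the right and middle circles gives the abscissa `(r² - 1 + 0.29²) /
0.58` of their intersections. The value of `cos ψ` is this abscissa minus `0.29`. -/
lemma rad_mul_cos_chi : rad * Real.cos chi = 40821049 / 58000000 := by
  rw [chi, Real.cos_arccos (by norm_num [rad]) (by norm_num [rad])]
  norm_num [rad]

lemma rad_cos_chi : rad * Real.cos chi = 0.29 + Real.cos psi := by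
  rw [rad_mul_cos_chi, cos_psi]; norm_num

lemma rad_pos : 0 < rad := by norm_num [rad]

lemma rad_sin_chi : rad * Real.sin chi = Real.sin psi := by
  have h1 : 0 ≤ Real.sin psi := Real.sin_nonneg_of_mem_Icc psi_mem
  have h2 : 0 ≤ Real.sin chi := Real.sin_nonneg_of_mem_Icc chi_mem
  have h3 := Real.sin_sq_add_cos_sq psi
  have h4 := Real.sin_sq_add_cos_sq chi
  have h5 := rad_mul_cos_chi
  have h6 : rad ^ 2 * Real.sin chi ^ 2 + (rad * Real.cos chi) ^ 2 = rad ^ 2 := by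
    rw [mul_pow, ← mul_add, h4, mul_one]
  rw [h5] at h6
  rw [cos_psi] at h3
  have h7 : (rad * Real.sin chi) ^ 2 = Real.sin psi ^ 2 := by
    rw [mul_pow]
    have : rad ^ 2 = (11507 / 10000) ^ 2 := rfl
    rw [this] at h6 ⊢
    linarith
  rw [sq_eq_sq₀ (mul_nonneg rad_pos.le h2) h1] at h7
  exact h7

/-- The comparison is made for the sine of the complement `π/2 - ψ ≈ 0.4266`, where short Taylor
polynomials are already accurate enough. The same device serves the other bounds for `ψ` and `χ`. -/
lemma psi_gt : 1.1441597 < psi := by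
  have hp := Real.pi_gt_d20
  have hs : Real.sin (Real.pi / 2 - psi) < Real.sin 0.42663659 := by
    rw [Real.sin_pi_div_two_sub, cos_psi]
    refine lt_of_lt_of_le ?_ (taylor_seven_le_sin (by norm_num))
    norm_num
  have h := (Real.strictMonoOn_sin.lt_iff_lt ⟨by linarith [psi_mem.2], by linarith [psi_mem.1]⟩
    ⟨by linarith, by linarith⟩).1 hs
  linarith

lemma psi_lt : psi < 1.1441599 := by
  have hp := Real.pi_gt_d20
  have hp' := Real.pi_lt_d20
  have hs : Real.sin 0.4266365 < Real.sin (Real.pi / 2 - psi) := by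
    rw [Real.sin_pi_div_two_sub, cos_psi]
    refine lt_of_le_of_lt (sin_le_taylor_nine (by norm_num)) ?_
    norm_num
  have h := (Real.strictMonoOn_sin.lt_iff_lt ⟨by linarith, by linarith⟩
    ⟨by linarith [psi_mem.2], by linarith [psi_mem.1]⟩).1 hs
  linarith

lemma chi_gt : 0.9126675 < chi := by
  have hp := Real.pi_gt_d20
  have hs : Real.sin (Real.pi / 2 - chi) < Real.sin 0.65812881 := by
    rw [Real.sin_pi_div_two_sub, chi, Real.cos_arccos (by norm_num [rad]) (by norm_num [rad])]
    refine lt_of_lt_of_le ?_ (taylor_seven_le_sin (by norm_num))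
    norm_num [rad]
  have h := (Real.strictMonoOn_sin.lt_iff_lt ⟨by linarith [chi_mem.2], by linarith [chi_mem.1]⟩
    ⟨by linarith, by linarith⟩).1 hs
  linarith

lemma chi_lt : chi < 0.9126678 := by
  have hp := Real.pi_gt_d20
  have hp' := Real.pi_lt_d20
  have hs : Real.sin 0.65812855 < Real.sin (Real.pi / 2 - chi) := by
    rw [Real.sin_pi_div_two_sub, chi, Real.cos_arccos (by norm_num [rad]) (by norm_num [rad])]
    refine lt_of_le_of_lt (sin_le_taylor_nine (by norm_num)) ?_
    norm_num [rad]
  have h := (Real.strictMonoOn_sin.lt_iff_lt ⟨by linarith, by linarith⟩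
    ⟨by linarith [chi_mem.2], by linarith [chi_mem.1]⟩).1 hs
  linarith

lemma sin_psi_gt : 0.9103627 < Real.sin psi := by
  have h1 : 0 ≤ Real.sin psi := Real.sin_nonneg_of_mem_Icc psi_mem
  have h3 := Real.sin_sq_add_cos_sq psi
  rw [cos_psi] at h3
  nlinarith

/-- The angular step on the unit circles. -/
noncomputable def del : ℝ := 2 * psi / 783

/-- The angular step on the middle circle. -/
noncomputable def eps : ℝ := (Real.pi - 2 * chi) / 140

lemma del_gt : 0.00292 < del := by rw [del]; linarith [psi_gt]
lemma del_lt : del < 0.00293 := by rw [del]; linarith [psi_lt]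
lemma eps_gt : 0.0094 < eps := by rw [eps]; linarith [chi_lt, Real.pi_gt_d20]
lemma eps_lt : eps < 0.00941 := by rw [eps]; linarith [chi_gt, Real.pi_lt_d20]

/-! ### The point set -/

/-- The point with polar angle `θ` on the right unit circle. -/
noncomputable def unitPt (θ : ℝ) : Plane := !₂[0.29 + Real.cos θ, Real.sin θ]

/-- The point with polar angle `ω` on the middle circle. -/
noncomputable def midPt (ω : ℝ) : Plane := !₂[rad * Real.cos ω, rad * Real.sin ω]

/-- The upper right shield point. -/
noncomputable def shieldPt : Plane := !₂[0.29 + 1.03 * Real.cos psi, 1.03 * Real.sin psi]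

/-- Reflection in the horizontal axis. -/
noncomputable def mirror (x : Plane) : Plane := !₂[x 0, -x 1]

@[simp] lemma unitPt_zero (θ : ℝ) : unitPt θ 0 = 0.29 + Real.cos θ := rfl
@[simp] lemma unitPt_one (θ : ℝ) : unitPt θ 1 = Real.sin θ := rfl
@[simp] lemma midPt_zero (ω : ℝ) : midPt ω 0 = rad * Real.cos ω := rfl
@[simp] lemma midPt_one (ω : ℝ) : midPt ω 1 = rad * Real.sin ω := rfl
@[simp] lemma shieldPt_zero : shieldPt 0 = 0.29 + 1.03 * Real.cos psi := rfl
@[simp] lemma shieldPt_one : shieldPt 1 = 1.03 * Real.sin psi := rfl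
@[simp] lemma mirror_zero (x : Plane) : mirror x 0 = x 0 := rfl
@[simp] lemma mirror_one (x : Plane) : mirror x 1 = -x 1 := rfl

@[simp] lemma mirror_mirror (x : Plane) : mirror (mirror x) = x := plane_ext (by simp) (by simp)
lemma mirror_neg (x : Plane) : mirror (-x) = -mirror x := plane_ext (by simp) (by simp)
-- A reflection reverses orientation; exchanging the first two points restores it. This is why
-- chords and triangles are reversed whenever they are mirrored.
lemma crs_mirror (u v x : Plane) : crs (mirror v) (mirror u) (mirror x) = crs u v x := by
  simp only [crs, mirror_zero, mirror_one]; ring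
lemma pw_neg (z : Plane) (q : ℝ) (x : Plane) : pw (-z) q (-x) = pw z q x := by
  simp only [pw, PiLp.neg_apply]; ring
lemma pw_mirror (z : Plane) (q : ℝ) (x : Plane) : pw (mirror z) q (mirror x) = pw z q x := by
  simp only [pw, mirror_zero, mirror_one]; ring

lemma midPt_chi : midPt chi = unitPt psi :=
  plane_ext (by simp [rad_cos_chi]) (by simp [rad_sin_chi])

lemma midPt_neg_chi : midPt (-chi) = unitPt (-psi) :=
  plane_ext (by simp [rad_cos_chi]) (by simp [rad_sin_chi])

lemma midPt_sub_pi (ω : ℝ) : midPt (ω - Real.pi) = -midPt ω :=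
  plane_ext (by simp [Real.cos_sub_pi]) (by simp [Real.sin_sub_pi])

lemma midPt_pi_sub_chi : midPt (Real.pi - chi) = -unitPt (-psi) := by
  rw [← midPt_neg_chi, ← neg_eq_iff_eq_neg, ← midPt_sub_pi]
  congr 1; ring

lemma mirror_unitPt (θ : ℝ) : mirror (unitPt θ) = unitPt (-θ) := plane_ext (by simp) (by simp)

lemma mirror_midPt (ω : ℝ) : mirror (midPt ω) = -midPt (Real.pi - ω) :=
  plane_ext (by simp) (by simp)

/-- The angle of the `i`-th point of the right unit circle. -/
noncomputable def capAngle (i : ℕ) : ℝ := -psi + i * del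

/-- The angle of the `j`-th point on the upper arc of the middle circle. -/
noncomputable def arcAngle (j : ℕ) : ℝ := chi + j * eps

/-- The points on the right unit circle, for `i ≤ 783`. -/
noncomputable def capPt (i : ℕ) : Plane := unitPt (capAngle i)

/-- The points on the upper arc of the middle circle, for `j ≤ 140`. -/
noncomputable def arcPt (j : ℕ) : Plane := midPt (arcAngle j)

lemma capAngle_zero : capAngle 0 = -psi := by simp [capAngle]
lemma capAngle_last : capAngle 783 = psi := by rw [capAngle, del]; push_cast; ring
lemma arcAngle_zero : arcAngle 0 = chi := by simp [arcAngle]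
lemma arcAngle_last : arcAngle 140 = Real.pi - chi := by rw [arcAngle, eps]; push_cast; ring
lemma capAngle_succ (i : ℕ) : capAngle (i + 1) = capAngle i + del := by
  simp only [capAngle]; push_cast; ring
lemma arcAngle_succ (j : ℕ) : arcAngle (j + 1) = arcAngle j + eps := by
  simp only [arcAngle]; push_cast; ring
lemma capAngle_sub_capAngle (i j : ℕ) : capAngle i - capAngle j = (i - j : ℝ) * del := by
  simp only [capAngle]; ring

lemma del_pos : 0 < del := lt_trans (by norm_num) del_gt
lemma eps_pos : 0 < eps := lt_trans (by norm_num) eps_gt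

lemma capAngle_strictMono : StrictMono capAngle := fun i j h => by
  have : (i : ℝ) < j := by exact_mod_cast h
  have := mul_lt_mul_of_pos_right this del_pos
  simp only [capAngle]; linarith

lemma arcAngle_strictMono : StrictMono arcAngle := fun i j h => by
  have : (i : ℝ) < j := by exact_mod_cast h
  have := mul_lt_mul_of_pos_right this eps_pos
  simp only [arcAngle]; linarith

lemma capAngle_ge (i : ℕ) : -psi ≤ capAngle i := by
  rw [← capAngle_zero]; exact capAngle_strictMono.monotone (Nat.zero_le i)
lemma capAngle_le {i : ℕ} (h : i ≤ 783) : capAngle i ≤ psi := by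
  rw [← capAngle_last]; exact capAngle_strictMono.monotone h
lemma arcAngle_ge (j : ℕ) : chi ≤ arcAngle j := by
  rw [← arcAngle_zero]; exact arcAngle_strictMono.monotone (Nat.zero_le j)
lemma arcAngle_le {j : ℕ} (h : j ≤ 140) : arcAngle j ≤ Real.pi - chi := by
  rw [← arcAngle_last]; exact arcAngle_strictMono.monotone h

lemma capPt_last : capPt 783 = arcPt 0 := by
  rw [capPt, arcPt, capAngle_last, arcAngle_zero, midPt_chi]
lemma arcPt_last : arcPt 140 = -capPt 0 := by
  rw [capPt, arcPt, capAngle_zero, arcAngle_last, midPt_pi_sub_chi]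
lemma capPt_zero : capPt 0 = midPt (-chi) := by
  rw [capPt, capAngle_zero, midPt_neg_chi]

lemma mirror_capPt {i : ℕ} (h : i ≤ 783) : mirror (capPt i) = capPt (783 - i) := by
  rw [capPt, capPt, mirror_unitPt]
  congr 1
  rw [capAngle, capAngle, Nat.cast_sub h, del]
  push_cast; ring

lemma mirror_arcPt {j : ℕ} (h : j ≤ 140) : mirror (arcPt j) = -arcPt (140 - j) := by
  rw [arcPt, arcPt, mirror_midPt]
  congr 2
  rw [arcAngle, arcAngle, Nat.cast_sub h, eps]
  push_cast; ring

/-- The points on the right and upper arcs. -/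
def OnArc (x : Plane) : Prop := (∃ i ≤ 783, x = capPt i) ∨ ∃ j ≤ 140, x = arcPt j

/-- The points on the outline. -/
def OnOutline (x : Plane) : Prop := OnArc x ∨ OnArc (-x)

/-- The four shield points. -/
def IsShield (x : Plane) : Prop :=
  x = shieldPt ∨ x = mirror shieldPt ∨ x = -shieldPt ∨ x = -mirror shieldPt

/-- The points of the configuration. -/
def IsSite (x : Plane) : Prop := OnOutline x ∨ IsShield x

lemma OnOutline.neg {x : Plane} (h : OnOutline x) : OnOutline (-x) := by
  rcases h with h | h
  · right; rwa [neg_neg]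
  · left; exact h

lemma onOutline_capPt {i : ℕ} (h : i ≤ 783) : OnOutline (capPt i) := Or.inl (Or.inl ⟨i, h, rfl⟩)
lemma onOutline_arcPt {j : ℕ} (h : j ≤ 140) : OnOutline (arcPt j) := Or.inl (Or.inr ⟨j, h, rfl⟩)

lemma OnArc.map_mirror {x : Plane} (h : OnArc x) : OnOutline (mirror x) := by
  rcases h with ⟨i, hi, rfl⟩ | ⟨j, hj, rfl⟩
  · rw [mirror_capPt hi]; exact onOutline_capPt (Nat.sub_le _ _)
  · rw [mirror_arcPt hj]; exact (onOutline_arcPt (Nat.sub_le _ _)).neg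

lemma OnOutline.map_mirror {x : Plane} (h : OnOutline x) : OnOutline (mirror x) := by
  rcases h with h | h
  · exact h.map_mirror
  · have := h.map_mirror.neg
    rwa [mirror_neg, neg_neg] at this

lemma IsShield.neg {x : Plane} (h : IsShield x) : IsShield (-x) := by
  rcases h with rfl | rfl | rfl | rfl <;> simp [IsShield]

lemma IsShield.map_mirror {x : Plane} (h : IsShield x) : IsShield (mirror x) := by
  rcases h with rfl | rfl | rfl | rfl <;> simp [IsShield, mirror_neg]

lemma IsSite.neg {x : Plane} (h : IsSite x) : IsSite (-x) := h.imp OnOutline.neg IsShield.neg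
lemma IsSite.map_mirror {x : Plane} (h : IsSite x) : IsSite (mirror x) :=
  h.imp OnOutline.map_mirror IsShield.map_mirror

/-- A property of all sites. -/
lemma IsSite.cases {Q : Plane → Prop} (h1 : ∀ i ≤ 783, Q (capPt i)) (h2 : ∀ j ≤ 140, Q (arcPt j))
    (h3 : ∀ i ≤ 783, Q (-capPt i)) (h4 : ∀ j ≤ 140, Q (-arcPt j)) (h5 : Q shieldPt)
    (h6 : Q (mirror shieldPt)) (h7 : Q (-shieldPt)) (h8 : Q (-mirror shieldPt)) {x : Plane}
    (h : IsSite x) : Q x := by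
  rcases h with ((⟨i, hi, rfl⟩ | ⟨j, hj, rfl⟩) | (⟨i, hi, hx⟩ | ⟨j, hj, hx⟩)) |
    (rfl | rfl | rfl | rfl)
  · exact h1 i hi
  · exact h2 j hj
  · rw [← neg_neg x, hx]; exact h3 i hi
  · rw [← neg_neg x, hx]; exact h4 j hj
  · exact h5
  · exact h6
  · exact h7
  · exact h8

/-! ### Boundary chords -/

/-- The chords of the right and upper arcs, counterclockwise. -/
def IsArcChord (u v : Plane) : Prop :=
  (∃ i < 783, u = capPt i ∧ v = capPt (i + 1)) ∨ ∃ j < 140, u = arcPt j ∧ v = arcPt (j + 1)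

/-- The chords of the outline, counterclockwise. -/
def IsChord (u v : Plane) : Prop := IsArcChord u v ∨ IsArcChord (-u) (-v)

lemma IsChord.neg {u v : Plane} (h : IsChord u v) : IsChord (-u) (-v) := by
  rcases h with h | h
  · right; simpa using h
  · left; exact h

lemma isChord_capPt {i : ℕ} (h : i < 783) : IsChord (capPt i) (capPt (i + 1)) :=
  Or.inl (Or.inl ⟨i, h, rfl, rfl⟩)
lemma isChord_arcPt {j : ℕ} (h : j < 140) : IsChord (arcPt j) (arcPt (j + 1)) :=
  Or.inl (Or.inr ⟨j, h, rfl, rfl⟩)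

lemma IsArcChord.map_mirror {u v : Plane} (h : IsArcChord u v) : IsChord (mirror v) (mirror u) := by
  rcases h with ⟨i, hi, rfl, rfl⟩ | ⟨j, hj, rfl, rfl⟩
  · rw [mirror_capPt hi, mirror_capPt hi.le, show 783 - i = 783 - (i + 1) + 1 by omega]
    exact isChord_capPt (by omega)
  · rw [mirror_arcPt hj, mirror_arcPt hj.le, show 140 - j = 140 - (j + 1) + 1 by omega]
    exact (isChord_arcPt (by omega)).neg

lemma IsChord.map_mirror {u v : Plane} (h : IsChord u v) : IsChord (mirror v) (mirror u) := by
  rcases h with h | h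
  · exact h.map_mirror
  · have := h.map_mirror.neg
    rwa [mirror_neg, neg_neg, mirror_neg, neg_neg] at this

/-- A property of chords. -/
lemma IsChord.cases {Q : Plane → Plane → Prop} (h1 : ∀ i < 783, Q (capPt i) (capPt (i + 1)))
    (h2 : ∀ j < 140, Q (arcPt j) (arcPt (j + 1))) (h3 : ∀ u v, Q u v → Q (-u) (-v))
    {u v : Plane} (h : IsChord u v) : Q u v := by
  have key : ∀ u v, IsArcChord u v → Q u v := by
    rintro u v (⟨i, hi, rfl, rfl⟩ | ⟨j, hj, rfl, rfl⟩)
    · exact h1 i hi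
    · exact h2 j hj
  rcases h with h | h
  · exact key u v h
  · have := h3 _ _ (key _ _ h)
    rwa [neg_neg, neg_neg] at this

/-- By symmetry it is enough to treat one shield point. -/
lemma IsShield.cases {Q : Plane → Plane → Plane → Prop}
    (hneg : ∀ u v s, Q u v s → Q (-u) (-v) (-s))
    (hmir : ∀ u v s, Q u v s → Q (mirror v) (mirror u) (mirror s))
    (h : ∀ u v, IsChord u v → Q u v shieldPt) {u v s : Plane} (hs : IsShield s)
    (huv : IsChord u v) : Q u v s := by
  have h2 : ∀ u v, IsChord u v → Q u v (mirror shieldPt) := fun u v huv => by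
    have := hmir _ _ _ (h _ _ huv.map_mirror)
    simpa using this
  rcases hs with rfl | rfl | rfl | rfl
  · exact h u v huv
  · exact h2 u v huv
  · have := hneg _ _ _ (h _ _ huv.neg); simpa using this
  · have := hneg _ _ _ (h2 _ _ huv.neg); simpa using this

/-- The signed distance from the chord of the right unit circle with mid angle `u`. -/
noncomputable def capSide (u : ℝ) (x : Plane) : ℝ :=
  Real.cos u * (x 0 - 0.29) + Real.sin u * x 1 - Real.cos (del / 2)

/-- The signed distance from the chord of the middle circle with mid angle `v`. -/
noncomputable def arcSide (v : ℝ) (x : Plane) : ℝ :=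
  Real.cos v * x 0 + Real.sin v * x 1 - rad * Real.cos (eps / 2)

/-- The chord with mid-angle `u` and half-angle `d` lies on the line normal to direction `u` at
distance `cos d` from the centre. The minus sign makes the left side of the chord the side where the
bracket is negative. -/
lemma crs_unitPt (u d : ℝ) (x : Plane) : crs (unitPt (u - d)) (unitPt (u + d)) x
    = -(2 * Real.sin d) * (Real.cos u * (x 0 - 0.29) + Real.sin u * x 1 - Real.cos d) := by
  simp only [crs, unitPt_zero, unitPt_one, Real.cos_add, Real.cos_sub, Real.sin_add, Real.sin_sub]
  linear_combination (2 * Real.sin d * Real.cos d) * Real.sin_sq_add_cos_sq u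

lemma crs_midPt (v d : ℝ) (x : Plane) : crs (midPt (v - d)) (midPt (v + d)) x
    = -(2 * rad * Real.sin d) * (Real.cos v * x 0 + Real.sin v * x 1 - rad * Real.cos d) := by
  simp only [crs, midPt_zero, midPt_one, Real.cos_add, Real.cos_sub, Real.sin_add, Real.sin_sub]
  linear_combination (2 * rad ^ 2 * Real.sin d * Real.cos d) * Real.sin_sq_add_cos_sq v

lemma crs_capPt (i : ℕ) (x : Plane) : crs (capPt i) (capPt (i + 1)) x
    = -(2 * Real.sin (del / 2)) * capSide (capAngle i + del / 2) x := by
  rw [capSide, ← crs_unitPt, capPt, capPt, capAngle_succ]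
  congr 2 <;> ring

lemma crs_arcPt (j : ℕ) (x : Plane) : crs (arcPt j) (arcPt (j + 1)) x
    = -(2 * rad * Real.sin (eps / 2)) * arcSide (arcAngle j + eps / 2) x := by
  rw [arcSide, ← crs_midPt, arcPt, arcPt, arcAngle_succ]
  congr 2 <;> ring

lemma sin_half_del_pos : 0 < Real.sin (del / 2) :=
  Real.sin_pos_of_pos_of_lt_pi (by linarith [del_gt]) (by linarith [del_lt, Real.pi_gt_three])

lemma sin_half_eps_pos : 0 < Real.sin (eps / 2) :=
  Real.sin_pos_of_pos_of_lt_pi (by linarith [eps_gt]) (by linarith [eps_lt, Real.pi_gt_three])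

lemma crs_capPt_neg_iff (i : ℕ) (x : Plane) : crs (capPt i) (capPt (i + 1)) x < 0 ↔
    0 < capSide (capAngle i + del / 2) x := by
  have := sin_half_del_pos
  rw [crs_capPt, neg_mul, neg_lt_zero, mul_pos_iff_of_pos_left (by positivity)]

lemma crs_capPt_nonneg_iff (i : ℕ) (x : Plane) : 0 ≤ crs (capPt i) (capPt (i + 1)) x ↔
    capSide (capAngle i + del / 2) x ≤ 0 := by
  rw [← not_lt, crs_capPt_neg_iff, not_lt]

lemma crs_arcPt_neg_iff (j : ℕ) (x : Plane) : crs (arcPt j) (arcPt (j + 1)) x < 0 ↔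
    0 < arcSide (arcAngle j + eps / 2) x := by
  have := sin_half_eps_pos
  have := rad_pos
  rw [crs_arcPt, neg_mul, neg_lt_zero, mul_pos_iff_of_pos_left (by positivity)]

lemma crs_arcPt_nonneg_iff (j : ℕ) (x : Plane) : 0 ≤ crs (arcPt j) (arcPt (j + 1)) x ↔
    arcSide (arcAngle j + eps / 2) x ≤ 0 := by
  rw [← not_lt, crs_arcPt_neg_iff, not_lt]

/-! ### Values of the side functions -/

section
variable (u v θ ω : ℝ)

lemma capSide_unitPt : capSide u (unitPt θ) = Real.cos (θ - u) - Real.cos (del / 2) := by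
  simp only [capSide, unitPt_zero, unitPt_one, Real.cos_sub]; ring

lemma capSide_neg_unitPt : capSide u (-unitPt θ)
    = -0.58 * Real.cos u - Real.cos (θ - u) - Real.cos (del / 2) := by
  simp only [capSide, PiLp.neg_apply, unitPt_zero, unitPt_one, Real.cos_sub]; ring

lemma capSide_midPt : capSide u (midPt ω)
    = rad * Real.cos (ω - u) - 0.29 * Real.cos u - Real.cos (del / 2) := by
  simp only [capSide, midPt_zero, midPt_one, Real.cos_sub]; ring

lemma capSide_neg_midPt : capSide u (-midPt ω)
    = -rad * Real.cos (ω - u) - 0.29 * Real.cos u - Real.cos (del / 2) := by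
  simp only [capSide, PiLp.neg_apply, midPt_zero, midPt_one, Real.cos_sub]; ring

lemma capSide_shieldPt : capSide u shieldPt
    = 1.03 * Real.cos (psi - u) - Real.cos (del / 2) := by
  simp only [capSide, shieldPt_zero, shieldPt_one, Real.cos_sub]; ring

lemma capSide_mirror_shieldPt : capSide u (mirror shieldPt)
    = 1.03 * Real.cos (psi + u) - Real.cos (del / 2) := by
  simp only [capSide, mirror_zero, mirror_one, shieldPt_zero, shieldPt_one, Real.cos_add]; ring

lemma capSide_neg_shieldPt : capSide u (-shieldPt)
    = -0.58 * Real.cos u - 1.03 * Real.cos (psi - u) - Real.cos (del / 2) := by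
  simp only [capSide, PiLp.neg_apply, shieldPt_zero, shieldPt_one, Real.cos_sub]; ring

lemma capSide_neg_mirror_shieldPt : capSide u (-mirror shieldPt)
    = -0.58 * Real.cos u - 1.03 * Real.cos (psi + u) - Real.cos (del / 2) := by
  simp only [capSide, PiLp.neg_apply, mirror_zero, mirror_one, shieldPt_zero, shieldPt_one,
    Real.cos_add]; ring

lemma arcSide_unitPt : arcSide v (unitPt θ)
    = 0.29 * Real.cos v + Real.cos (θ - v) - rad * Real.cos (eps / 2) := by
  simp only [arcSide, unitPt_zero, unitPt_one, Real.cos_sub]; ring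

lemma arcSide_neg_unitPt : arcSide v (-unitPt θ)
    = -0.29 * Real.cos v - Real.cos (θ - v) - rad * Real.cos (eps / 2) := by
  simp only [arcSide, PiLp.neg_apply, unitPt_zero, unitPt_one, Real.cos_sub]; ring

lemma arcSide_midPt : arcSide v (midPt ω)
    = rad * (Real.cos (ω - v) - Real.cos (eps / 2)) := by
  simp only [arcSide, midPt_zero, midPt_one, Real.cos_sub]; ring

lemma arcSide_neg_midPt : arcSide v (-midPt ω)
    = rad * (-Real.cos (ω - v) - Real.cos (eps / 2)) := by
  simp only [arcSide, PiLp.neg_apply, midPt_zero, midPt_one, Real.cos_sub]; ring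

lemma arcSide_shieldPt : arcSide v shieldPt
    = 0.29 * Real.cos v + 1.03 * Real.cos (psi - v) - rad * Real.cos (eps / 2) := by
  simp only [arcSide, shieldPt_zero, shieldPt_one, Real.cos_sub]; ring

lemma arcSide_mirror_shieldPt : arcSide v (mirror shieldPt)
    = 0.29 * Real.cos v + 1.03 * Real.cos (psi + v) - rad * Real.cos (eps / 2) := by
  simp only [arcSide, mirror_zero, mirror_one, shieldPt_zero, shieldPt_one, Real.cos_add]; ring

lemma arcSide_neg_shieldPt : arcSide v (-shieldPt)
    = -0.29 * Real.cos v - 1.03 * Real.cos (psi - v) - rad * Real.cos (eps / 2) := by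
  simp only [arcSide, PiLp.neg_apply, shieldPt_zero, shieldPt_one, Real.cos_sub]; ring

lemma arcSide_neg_mirror_shieldPt : arcSide v (-mirror shieldPt)
    = -0.29 * Real.cos v - 1.03 * Real.cos (psi + v) - rad * Real.cos (eps / 2) := by
  simp only [arcSide, PiLp.neg_apply, mirror_zero, mirror_one, shieldPt_zero, shieldPt_one,
    Real.cos_add]; ring

end

/-! ### Bounds for the side functions -/

lemma cos_le_cos_of_abs_le {x a : ℝ} (h : |x| ≤ a) (ha : a ≤ Real.pi) :
    Real.cos a ≤ Real.cos x := by
  rw [← Real.cos_abs x]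
  exact Real.cos_le_cos_of_nonneg_of_le_pi (abs_nonneg x) ha h

lemma cos_pos_of_abs_lt {x : ℝ} (h : |x| < Real.pi / 2) : 0 < Real.cos x :=
  Real.cos_pos_of_mem_Ioo (abs_lt.1 h)

lemma cos_half_del_gt : 0.999998 < Real.cos (del / 2) := by
  have := Real.one_sub_sq_div_two_le_cos (x := del / 2)
  nlinarith [del_lt, del_pos]

lemma rad_cos_half_eps_gt : 1.15067 < rad * Real.cos (eps / 2) := by
  have := Real.one_sub_sq_div_two_le_cos (x := eps / 2)
  have h2 : 0.999988 < Real.cos (eps / 2) := by nlinarith [eps_lt, eps_pos]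
  rw [rad]; linarith

lemma rad_cos_half_eps_le : rad * Real.cos (eps / 2) ≤ 1.1507 := by
  have := Real.cos_le_one (eps / 2)
  rw [rad]; linarith

/-- The extreme case is `cos (2ψ) = 2 cos² ψ - 1 ≈ -0.658`. -/
lemma neg_lt_cos_of_abs_le_two_psi {x : ℝ} (h : |x| ≤ 2 * psi) : -0.66 < Real.cos x := by
  refine lt_of_lt_of_le ?_ (cos_le_cos_of_abs_le h (by linarith [psi_lt, Real.pi_gt_three]))
  rw [Real.cos_two_mul, cos_psi]; norm_num

lemma cos_psi_le_cos {u : ℝ} (h : |u| ≤ psi) : 24001049 / 58000000 ≤ Real.cos u := by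
  rw [← cos_psi]; exact cos_le_cos_of_abs_le h (by linarith [psi_lt, Real.pi_gt_three])

section cap
variable {u θ ω : ℝ}

lemma capSide_neg_unitPt_neg (hu : |u| ≤ psi) (hθ : |θ| ≤ psi) : capSide u (-unitPt θ) < 0 := by
  rw [capSide_neg_unitPt]
  have h1 := cos_psi_le_cos hu
  have h2 : -0.66 < Real.cos (θ - u) :=
    neg_lt_cos_of_abs_le_two_psi ((abs_sub θ u).trans (by linarith))
  linarith [cos_half_del_gt]

/-- For `|u| ≤ 1` the whole middle disk is behind the chord line, because `rad - 0.29 cos 1 ≈ 0.994`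
is below `cos (del / 2)`. Hull arguments for cap chords are confined to this range. -/
lemma capSide_midPt_nonpos (hu : |u| ≤ 1) : capSide u (midPt ω) ≤ 0 ∧
    capSide u (-midPt ω) ≤ 0 := by
  rw [capSide_midPt, capSide_neg_midPt]
  have h1 : Real.cos 1 ≤ Real.cos u := cos_le_cos_of_abs_le hu (by linarith [Real.pi_gt_three])
  have h2 := taylor_six_le_cos (x := 1) (by norm_num)
  have h3 := Real.cos_le_one (ω - u)
  have h4 := Real.neg_one_le_cos (ω - u)
  have h5 := cos_half_del_gt
  rw [rad]
  constructor <;> linarith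

lemma capSide_neg_midPt_neg (hu : 0.87 ≤ u) (hu' : u ≤ psi) (hω : chi ≤ ω)
    (hω' : ω ≤ Real.pi - chi) : capSide u (-midPt ω) < 0 := by
  rw [capSide_neg_midPt]
  have h1 := cos_psi_le_cos (u := u) (abs_le.2 ⟨by linarith, hu'⟩)
  have h2 : 0 < Real.cos (ω - u) := cos_pos_of_abs_lt (abs_lt.2
    ⟨by linarith [chi_gt, psi_lt, Real.pi_gt_three],
      by linarith [chi_gt, Real.pi_lt_d2]⟩)
  have := mul_pos rad_pos h2
  linarith [cos_half_del_gt]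

/-- The shield is at distance `1.03` from the centre, so visibility ends near `cos (ψ - u) = 1 /
1.03`, that is, `u ≈ 0.902`. The thresholds `0.93` here and `0.87` in the next lemma enclose this
value. -/
lemma capSide_shieldPt_pos (hu : 0.93 ≤ u) (hu' : u ≤ psi) : 0 < capSide u shieldPt := by
  rw [capSide_shieldPt]
  have h1 := Real.one_sub_sq_div_two_le_cos (x := psi - u)
  have h2 : psi - u ≤ 0.2142 := by linarith [psi_lt]
  have h3 := Real.cos_le_one (del / 2)
  nlinarith

lemma capSide_shieldPt_neg (hu : -psi ≤ u) (hu' : u ≤ 0.87) : capSide u shieldPt < 0 := by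
  rw [capSide_shieldPt]
  have h1 : Real.cos (psi - u) ≤ Real.cos 0.274 := Real.cos_le_cos_of_nonneg_of_le_pi (by norm_num)
    (by linarith [psi_lt, Real.pi_gt_three]) (by linarith [psi_gt])
  have h2 := cos_le_taylor_four (x := 0.274) (by norm_num)
  norm_num at h1 h2
  linarith [cos_half_del_gt]

lemma capSide_mirror_shieldPt_neg (hu : 0.8 ≤ u) (hu' : u ≤ psi) :
    capSide u (mirror shieldPt) < 0 := by
  rw [capSide_mirror_shieldPt]
  have h1 : Real.cos (psi + u) ≤ 0 := Real.cos_nonpos_of_pi_div_two_le_of_le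
    (by linarith [psi_gt, Real.pi_lt_d2]) (by linarith [psi_lt, Real.pi_gt_three])
  linarith [cos_half_del_gt]

lemma capSide_neg_shieldPt_neg (hu : |u| ≤ psi) :
    capSide u (-shieldPt) < 0 ∧ capSide u (-mirror shieldPt) < 0 := by
  rw [capSide_neg_shieldPt, capSide_neg_mirror_shieldPt]
  have h1 := cos_psi_le_cos hu
  have hp : |psi| = psi := abs_of_pos (by linarith [psi_gt])
  have h2 : -0.66 < Real.cos (psi - u) :=
    neg_lt_cos_of_abs_le_two_psi ((abs_sub psi u).trans (by linarith))
  have h3 : -0.66 < Real.cos (psi + u) :=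
    neg_lt_cos_of_abs_le_two_psi ((abs_add_le psi u).trans (by linarith))
  have h5 := cos_half_del_gt
  constructor <;> linarith

end cap

section arc
variable {v θ ω : ℝ}

lemma arcSide_neg_midPt_neg (h : |ω - v| ≤ Real.pi - 2 * chi) : arcSide v (-midPt ω) < 0 := by
  rw [arcSide_neg_midPt]
  have h2 : 0 < Real.cos (ω - v) := cos_pos_of_abs_lt
    (lt_of_le_of_lt h (by linarith [chi_gt, Real.pi_lt_d2]))
  have := mul_pos rad_pos h2
  have := rad_cos_half_eps_gt
  linarith

/-- Both unit disks are behind the chord line, since `0.29 · 0.51 + 1 < 1.15067`. -/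
lemma arcSide_unitPt_neg (hv : |Real.cos v| ≤ 0.51) : arcSide v (unitPt θ) < 0 ∧
    arcSide v (-unitPt θ) < 0 := by
  rw [arcSide_unitPt, arcSide_neg_unitPt]
  have h3 := Real.cos_le_one (θ - v)
  have h4 := Real.neg_one_le_cos (θ - v)
  have h5 := rad_cos_half_eps_gt
  have h6 := abs_le.1 hv
  constructor <;> linarith

lemma arcSide_neg_unitPt_neg (hv : 0 ≤ Real.cos v) : arcSide v (-unitPt θ) < 0 := by
  rw [arcSide_neg_unitPt]
  have h4 := Real.neg_one_le_cos (θ - v)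
  have h5 := rad_cos_half_eps_gt
  linarith

/-- On the middle circle visibility from the shield ends near `v ≈ 1.14`; the thresholds `1.08` here
and `1.3` in the next lemma enclose this value. -/
lemma arcSide_shieldPt_pos (hv : chi ≤ v) (hv' : v ≤ 1.08) : 0 < arcSide v shieldPt := by
  rw [arcSide_shieldPt]
  have h0 := rad_cos_half_eps_le
  have hp := Real.pi_gt_three
  have hc := chi_gt
  have h1 := Real.one_sub_sq_div_two_le_cos (x := psi - v)
  have h2 := psi_lt
  have h3 := psi_gt
  -- Over the whole range the smallest `cos v` together with the largest `psi - v` would be too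
  -- crude, so the range is cut at `1`.
  rcases le_total v 1 with h | h
  · have h4 : Real.cos 1 ≤ Real.cos v := Real.cos_le_cos_of_nonneg_of_le_pi (by linarith)
      (by linarith) h
    have h5 := taylor_six_le_cos (x := 1) (by norm_num)
    nlinarith
  · have h4 : Real.cos 1.08 ≤ Real.cos v := Real.cos_le_cos_of_nonneg_of_le_pi (by linarith)
      (by linarith) hv'
    have h5 := taylor_six_le_cos (x := 1.08) (by norm_num)
    norm_num at h4 h5
    nlinarith

lemma arcSide_shieldPt_neg (hv : 1.3 ≤ v) (hv' : v ≤ Real.pi - chi) : arcSide v shieldPt < 0 := by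
  rw [arcSide_shieldPt]
  have h0 := rad_cos_half_eps_gt
  have hc := chi_gt
  have h1 : Real.cos v ≤ Real.cos 1.3 := Real.cos_le_cos_of_nonneg_of_le_pi (by norm_num)
    (by linarith) hv
  have h2 := cos_le_taylor_four (x := 1.3) (by norm_num)
  have h3 := Real.cos_le_one (psi - v)
  norm_num at h1 h2
  linarith

lemma arcSide_mirror_shieldPt_neg (hv : chi ≤ v) (hv' : v ≤ Real.pi - chi) :
    arcSide v (mirror shieldPt) < 0 := by
  rw [arcSide_mirror_shieldPt]
  have h1 : Real.cos (psi + v) ≤ 0 := Real.cos_nonpos_of_pi_div_two_le_of_le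
    (by linarith [psi_gt, chi_gt, Real.pi_lt_d2]) (by linarith [psi_lt, chi_gt, Real.pi_gt_three])
  linarith [rad_cos_half_eps_gt, Real.cos_le_one v]

lemma arcSide_neg_shieldPt_neg (hv : chi ≤ v) (hv' : v ≤ Real.pi - chi) :
    arcSide v (-shieldPt) < 0 := by
  rw [arcSide_neg_shieldPt]
  have h1 : 0 < Real.cos (psi - v) := cos_pos_of_abs_lt (abs_lt.2
    ⟨by linarith [psi_gt, chi_gt, Real.pi_lt_d2], by linarith [psi_lt, chi_gt, Real.pi_gt_three]⟩)
  linarith [rad_cos_half_eps_gt, Real.neg_one_le_cos v]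

lemma arcSide_neg_mirror_shieldPt_neg (hv : 0 ≤ Real.cos v) :
    arcSide v (-mirror shieldPt) < 0 := by
  rw [arcSide_neg_mirror_shieldPt]
  linarith [rad_cos_half_eps_gt, Real.neg_one_le_cos (psi + v)]

end arc

/-! ### Powers with respect to the three circles -/

/-- The power with respect to the right unit circle. -/
noncomputable def pwRight (x : Plane) : ℝ := pw (rightCentre 0.58) 1 x

/-- The power with respect to the middle circle. -/
noncomputable def pwMid (x : Plane) : ℝ := pw 0 (rad ^ 2) x

lemma pwRight_eq (x : Plane) : pwRight x = (x 0 - 0.29) ^ 2 + x 1 ^ 2 - 1 := by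
  have h0 : rightCentre 0.58 0 = 0.29 := by
    change (0.58 / 2 : ℝ) = 0.29; norm_num
  have h1 : rightCentre 0.58 1 = 0 := rfl
  rw [pwRight, pw, h0, h1, sub_zero]

lemma pwMid_eq (x : Plane) : pwMid x = x 0 ^ 2 + x 1 ^ 2 - rad ^ 2 := by
  simp [pwMid, pw]

lemma pwMid_neg (x : Plane) : pwMid (-x) = pwMid x := by
  simp [pwMid_eq]

/-- The corner `q` lies on both circles; `0.9159 = 1 - 0.29²`. -/
lemma rad_sq : rad ^ 2 = 0.9159 + 0.58 * (rad * Real.cos chi) := by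
  rw [rad_mul_cos_chi, rad]; norm_num

section
variable (θ ω : ℝ)

lemma pwRight_unitPt : pwRight (unitPt θ) = 0 := by
  rw [pwRight_eq]; simp only [unitPt_zero, unitPt_one]
  linear_combination Real.sin_sq_add_cos_sq θ

lemma pwRight_neg_unitPt : pwRight (-unitPt θ) = 1.16 * (0.29 + Real.cos θ) := by
  rw [pwRight_eq]; simp only [PiLp.neg_apply, unitPt_zero, unitPt_one]
  linear_combination Real.sin_sq_add_cos_sq θ

/-- On one circle the power with respect to another is affine, here in the abscissa, and it vanishes
at `q`. So comparing cosines settles which points are outside. -/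
lemma pwRight_midPt : pwRight (midPt ω) = 0.58 * rad * (Real.cos chi - Real.cos ω) := by
  rw [pwRight_eq]; simp only [midPt_zero, midPt_one]
  linear_combination rad ^ 2 * Real.sin_sq_add_cos_sq ω + rad_sq

lemma pwRight_neg_midPt : pwRight (-midPt ω) = 0.58 * rad * (Real.cos chi + Real.cos ω) := by
  rw [pwRight_eq]; simp only [PiLp.neg_apply, midPt_zero, midPt_one]
  linear_combination rad ^ 2 * Real.sin_sq_add_cos_sq ω + rad_sq

lemma pwMid_midPt : pwMid (midPt ω) = 0 := by
  rw [pwMid_eq]; simp only [midPt_zero, midPt_one]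
  linear_combination rad ^ 2 * Real.sin_sq_add_cos_sq ω

lemma pwMid_unitPt : pwMid (unitPt θ) = 0.58 * (Real.cos θ - Real.cos psi) := by
  rw [pwMid_eq]; simp only [unitPt_zero, unitPt_one]
  linear_combination Real.sin_sq_add_cos_sq θ - rad_sq - 0.58 * rad_cos_chi

end

lemma pwRight_shieldPt : pwRight shieldPt = 0.0609 := by
  rw [pwRight_eq]; simp only [shieldPt_zero, shieldPt_one]
  linear_combination 1.03 ^ 2 * Real.sin_sq_add_cos_sq psi

lemma pwRight_neg_shieldPt : 0 < pwRight (-shieldPt) := by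
  rw [pwRight_eq]; simp only [PiLp.neg_apply, shieldPt_zero, shieldPt_one]
  nlinarith [Real.sin_sq_add_cos_sq psi, cos_psi]

lemma pwRight_mirror (x : Plane) : pwRight (mirror x) = pwRight x := by
  rw [pwRight_eq, pwRight_eq]; simp

lemma pwMid_mirror (x : Plane) : pwMid (mirror x) = pwMid x := by
  rw [pwMid_eq, pwMid_eq]; simp

lemma pwMid_shieldPt : pwMid shieldPt = 0.0174 * Real.cos psi + 0.0609 := by
  rw [pwMid_eq]; simp only [shieldPt_zero, shieldPt_one]
  linear_combination 1.03 ^ 2 * Real.sin_sq_add_cos_sq psi - rad_sq - 0.58 * rad_cos_chi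

lemma abs_capAngle_le {i : ℕ} (h : i ≤ 783) : |capAngle i| ≤ psi :=
  abs_le.2 ⟨capAngle_ge i, capAngle_le h⟩

lemma cos_arcAngle_le {ω : ℝ} (h : chi ≤ ω) (h' : ω ≤ Real.pi - chi) :
    Real.cos ω ≤ Real.cos chi ∧ -Real.cos chi ≤ Real.cos ω := by
  have hc := chi_gt
  constructor
  · exact Real.cos_le_cos_of_nonneg_of_le_pi (by linarith) (by linarith) h
  · rw [← Real.cos_pi_sub]
    exact Real.cos_le_cos_of_nonneg_of_le_pi (by linarith) (by linarith) h'

lemma pwRight_nonneg {x : Plane} (h : IsSite x) : 0 ≤ pwRight x := by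
  have hr := rad_pos
  revert x
  apply IsSite.cases
  · intro i _; rw [capPt, pwRight_unitPt]
  · intro j hj
    have := (cos_arcAngle_le (arcAngle_ge j) (arcAngle_le hj)).1
    rw [arcPt, pwRight_midPt]; exact mul_nonneg (by positivity) (by linarith)
  · intro i hi
    have := cos_psi_le_cos (abs_capAngle_le hi)
    rw [capPt, pwRight_neg_unitPt]; linarith
  · intro j hj
    have := (cos_arcAngle_le (arcAngle_ge j) (arcAngle_le hj)).2
    rw [arcPt, pwRight_neg_midPt]; exact mul_nonneg (by positivity) (by linarith)
  · rw [pwRight_shieldPt]; norm_num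
  · rw [pwRight_mirror, pwRight_shieldPt]; norm_num
  · exact pwRight_neg_shieldPt.le
  · rw [← mirror_neg, pwRight_mirror]; exact pwRight_neg_shieldPt.le

lemma pwMid_shieldPt_pos : 0 < pwMid shieldPt := by
  rw [pwMid_shieldPt, cos_psi]; norm_num

lemma pwMid_nonneg {x : Plane} (h : IsSite x) : 0 ≤ pwMid x := by
  have h1 : ∀ i ≤ 783, 0 ≤ pwMid (capPt i) := fun i hi => by
    have := cos_psi_le_cos (abs_capAngle_le hi)
    rw [capPt, pwMid_unitPt, cos_psi]; linarith
  revert x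
  apply IsSite.cases
  · exact h1
  · intro j _; rw [arcPt, pwMid_midPt]
  · intro i hi; rw [pwMid_neg]; exact h1 i hi
  · intro j _; rw [pwMid_neg, arcPt, pwMid_midPt]
  · exact pwMid_shieldPt_pos.le
  · rw [pwMid_mirror]; exact pwMid_shieldPt_pos.le
  · rw [pwMid_neg]; exact pwMid_shieldPt_pos.le
  · rw [pwMid_neg, pwMid_mirror]; exact pwMid_shieldPt_pos.le

/-! ### The circumcircles of the fan triangles are empty -/

/-- The circle through `u`, `v`, `s` exists, and all other sites are outside. -/
def FanEmpty (u v s : Plane) : Prop :=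
  ∃ z q, pw z q u = 0 ∧ pw z q v = 0 ∧ pw z q s = 0 ∧
    ∀ x, IsSite x → x = u ∨ x = v ∨ x = s ∨ 0 < pw z q x

/-- The circles through `u` and `v` have power functions `pw z q + t * crs u v`. The value of `t`
that makes `s` a zero gives the circumcircle of the fan triangle, and the inequality required here
is positivity of this power after multiplication by `-crs u v s > 0`. -/
lemma FanEmpty.of_pencil {u v s z : Plane} {q : ℝ} (hs : crs u v s < 0) (hu : pw z q u = 0)
    (hv : pw z q v = 0) (h : ∀ x, IsSite x → x = u ∨ x = v ∨ x = s ∨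
      0 < pw z q x * (-crs u v s) + pw z q s * crs u v x) : FanEmpty u v s := by
  set t : ℝ := pw z q s / (-crs u v s) with ht
  have hs' : 0 < -crs u v s := by linarith
  have hts : t * (-crs u v s) = pw z q s := div_mul_cancel₀ _ hs'.ne'
  obtain ⟨z', q', hz⟩ : ∃ z' q', ∀ x, pw z' q' x = pw z q x + t * crs u v x := by
    refine ⟨!₂[z 0 + t * (v 1 - u 1) / 2, z 1 - t * (v 0 - u 0) / 2],
      (z 0 + t * (v 1 - u 1) / 2) ^ 2 + (z 1 - t * (v 0 - u 0) / 2) ^ 2 -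
        (z 0 ^ 2 + z 1 ^ 2 - q + t * ((v 1 - u 1) * u 0 - (v 0 - u 0) * u 1)), fun x => ?_⟩
    simp only [pw, crs, Matrix.cons_val_zero, Matrix.cons_val_one]
    ring
  have c1 : crs u v u = 0 := by simp only [crs]; ring
  have c2 : crs u v v = 0 := by simp only [crs]; ring
  refine ⟨z', q', ?_, ?_, ?_, fun x hx => ?_⟩
  · rw [hz, hu, c1]; ring
  · rw [hz, hv, c2]; ring
  · rw [hz]; linarith
  · rcases h x hx with h | h | h | h
    · exact Or.inl h
    · exact Or.inr (Or.inl h)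
    · exact Or.inr (Or.inr (Or.inl h))
    · right; right; right
      rw [hz]
      refine pos_of_mul_pos_left ?_ hs'.le
      calc 0 < _ := h
        _ = _ := by rw [← hts]; ring

lemma FanEmpty.neg {u v s : Plane} (h : FanEmpty u v s) : FanEmpty (-u) (-v) (-s) := by
  obtain ⟨z, q, hu, hv, hs, hx⟩ := h
  refine ⟨-z, q, by rwa [pw_neg], by rwa [pw_neg], by rwa [pw_neg], fun x hxs => ?_⟩
  have := hx (-x) hxs.neg
  rwa [neg_eq_iff_eq_neg, neg_eq_iff_eq_neg, neg_eq_iff_eq_neg, ← pw_neg, neg_neg] at this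

lemma mirror_eq_iff {x y : Plane} : mirror x = y ↔ x = mirror y :=
  ⟨fun h => by rw [← h, mirror_mirror], fun h => by rw [h, mirror_mirror]⟩

lemma FanEmpty.map_mirror {u v s : Plane} (h : FanEmpty u v s) :
    FanEmpty (mirror v) (mirror u) (mirror s) := by
  obtain ⟨z, q, hu, hv, hs, hx⟩ := h
  refine ⟨mirror z, q, by rwa [pw_mirror], by rwa [pw_mirror], by rwa [pw_mirror],
    fun x hxs => ?_⟩
  have := hx (mirror x) hxs.map_mirror
  rw [mirror_eq_iff, mirror_eq_iff, mirror_eq_iff, ← pw_mirror, mirror_mirror] at this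
  tauto

lemma capMid_bounds {i : ℕ} (hi : i < 783) :
    -psi ≤ capAngle i + del / 2 ∧ capAngle i + del / 2 ≤ psi - del / 2 := by
  have h1 := capAngle_ge i
  have h2 := capAngle_le (i := i + 1) hi
  rw [capAngle_succ] at h2
  constructor <;> linarith [del_pos]

lemma arcMid_bounds {j : ℕ} (hj : j < 140) :
    chi + eps / 2 ≤ arcAngle j + eps / 2 ∧ arcAngle j + eps / 2 ≤ Real.pi - chi - eps / 2 := by
  have h1 := arcAngle_ge j
  have h2 := arcAngle_le (j := j + 1) hj
  rw [arcAngle_succ] at h2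
  constructor <;> linarith [eps_pos]

lemma abs_capMid_le {i : ℕ} (hi : i < 783) : |capAngle i + del / 2| ≤ psi :=
  abs_le.2 ⟨(capMid_bounds hi).1, by linarith [(capMid_bounds hi).2, del_pos]⟩

lemma half_lt_abs_of_ne {d : ℝ} (hd : 0 < d) {i k : ℕ} (h1 : k ≠ i) (h2 : k ≠ i + 1) :
    d / 2 < |((k : ℝ) - i) * d - d / 2| := by
  rcases lt_or_gt_of_ne h1 with h | h
  · have : (k : ℝ) + 1 ≤ i := by exact_mod_cast h
    rw [lt_abs]; right; nlinarith
  · have : (i : ℝ) + 2 ≤ k := by exact_mod_cast (by omega : i + 2 ≤ k)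
    rw [lt_abs]; left; nlinarith

lemma capSide_capPt_nonpos {i k : ℕ} (hi : i < 783) (hk : k ≤ 783) :
    capSide (capAngle i + del / 2) (capPt k) ≤ 0 ∧
      (k ≠ i → k ≠ i + 1 → capSide (capAngle i + del / 2) (capPt k) < 0) := by
  have e : capAngle k - (capAngle i + del / 2) = ((k : ℝ) - i) * del - del / 2 := by
    simp only [capAngle]; ring
  have hpi := Real.pi_gt_three
  have hle : |capAngle k - (capAngle i + del / 2)| ≤ Real.pi :=
    (abs_sub _ _).trans (by linarith [abs_capAngle_le hk, abs_capMid_le hi, psi_lt])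
  have strict : k ≠ i → k ≠ i + 1 → capSide (capAngle i + del / 2) (capPt k) < 0 := by
    intro h1 h2
    rw [capPt, capSide_unitPt, sub_neg, ← Real.cos_abs (_ - _)]
    refine Real.cos_lt_cos_of_nonneg_of_le_pi (by linarith [del_pos]) hle ?_
    rw [e]; exact half_lt_abs_of_ne del_pos h1 h2
  refine ⟨?_, strict⟩
  by_cases h1 : k = i
  · rw [capPt, capSide_unitPt, h1, sub_add_cancel_left, Real.cos_neg, sub_self]
  by_cases h2 : k = i + 1
  · rw [capPt, capSide_unitPt, h2, capAngle_succ, show capAngle i + del - (capAngle i + del / 2)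
      = del / 2 by ring, sub_self]
  exact (strict h1 h2).le

lemma arcSide_arcPt_nonpos {i k : ℕ} (hi : i < 140) (hk : k ≤ 140) :
    arcSide (arcAngle i + eps / 2) (arcPt k) ≤ 0 ∧
      (k ≠ i → k ≠ i + 1 → arcSide (arcAngle i + eps / 2) (arcPt k) < 0) := by
  have e : arcAngle k - (arcAngle i + eps / 2) = ((k : ℝ) - i) * eps - eps / 2 := by
    simp only [arcAngle]; ring
  have hr := rad_pos
  have hle : |arcAngle k - (arcAngle i + eps / 2)| ≤ Real.pi := by
    have h1 := arcMid_bounds hi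
    have h2 := arcAngle_ge k
    have h3 := arcAngle_le hk
    have := chi_gt
    have := eps_pos
    rw [abs_le]; constructor <;> linarith
  have strict : k ≠ i → k ≠ i + 1 → arcSide (arcAngle i + eps / 2) (arcPt k) < 0 := by
    intro h1 h2
    rw [arcPt, arcSide_midPt]
    refine mul_neg_of_pos_of_neg hr ?_
    rw [sub_neg, ← Real.cos_abs (_ - _)]
    refine Real.cos_lt_cos_of_nonneg_of_le_pi (by linarith [eps_pos]) hle ?_
    rw [e]; exact half_lt_abs_of_ne eps_pos h1 h2
  refine ⟨?_, strict⟩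
  by_cases h1 : k = i
  · rw [arcPt, arcSide_midPt, h1, sub_add_cancel_left, Real.cos_neg, sub_self, mul_zero]
  by_cases h2 : k = i + 1
  · rw [arcPt, arcSide_midPt, h2, arcAngle_succ, show arcAngle i + eps - (arcAngle i + eps / 2)
      = eps / 2 by ring, sub_self, mul_zero]
  exact (strict h1 h2).le

lemma sin_ge_of_chi_add {m : ℝ} (h1 : chi + eps / 2 ≤ m) (h2 : m ≤ Real.pi / 2) :
    0.7939 < Real.sin m := by
  have h3 : Real.sin 0.9173 ≤ Real.sin m := Real.sin_le_sin_of_le_of_le_pi_div_two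
    (by linarith [Real.pi_gt_three]) h2 (by linarith [chi_gt, eps_gt])
  refine lt_of_lt_of_le ?_ ((taylor_seven_le_sin (x := 0.9173) (by norm_num)).trans h3)
  norm_num

/-- This is the delicate case: upper arc points can lie on the shield's side of the chord line.
Compare with the corner `q = midPt chi`, whose power is zero and whose side is nonpositive.
Sum-to-product formulas make both the power of `midPt ω` and the change of side from `q` multiples
of `sin g`. What remains is an inequality in `m` and `u`, and the full step `eps` between `ω` and
`chi` is used to prove it. -/
lemma midPt_outside_cap_fan {u ω : ℝ} (hu : 0.87 ≤ u) (hu' : u ≤ psi - del / 2)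
    (hω : chi + eps ≤ ω) (hω' : ω ≤ Real.pi - chi) (hs : 0 < capSide u shieldPt) :
    0 < pwRight (midPt ω) * capSide u shieldPt - pwRight shieldPt * capSide u (midPt ω) := by
  have hq : capSide u (midPt chi) ≤ 0 := by
    rw [midPt_chi, capSide_unitPt, sub_nonpos]
    exact Real.cos_le_cos_of_nonneg_of_le_pi (by linarith [del_pos])
      (by linarith [psi_lt, Real.pi_gt_three]) (by linarith)
  have hr := rad_pos
  set m := (ω + chi) / 2 with hm
  set g := (ω - chi) / 2 with hg
  have eω : ω = m + g := by rw [hm, hg]; ring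
  have eχ : chi = m - g := by rw [hm, hg]; ring
  have hg0 : 0 < Real.sin g := Real.sin_pos_of_pos_of_lt_pi (by linarith [eps_pos])
    (by linarith [chi_gt, Real.pi_gt_three])
  have hm1 : chi + eps / 2 ≤ m := by rw [hm]; linarith
  have hm2 : m ≤ Real.pi / 2 := by rw [hm]; linarith
  have hsm := sin_ge_of_chi_add hm1 hm2
  have e1 : pwRight (midPt ω) = 0.58 * rad * (2 * Real.sin m * Real.sin g) := by
    rw [pwRight_midPt, eω]; rw [eχ]; rw [Real.cos_add, Real.cos_sub]; ring
  have e2 : capSide u (midPt ω) - capSide u (midPt chi)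
      = rad * (2 * Real.sin (u - m) * Real.sin g) := by
    rw [capSide_midPt, capSide_midPt, eω]
    rw [eχ]
    rw [show m + g - u = -(u - m) + g by ring, show m - g - u = -(u - m) - g by ring,
      Real.cos_add, Real.cos_sub, Real.sin_neg]
    ring
  have key : 0 < 0.58 * Real.sin m * capSide u shieldPt - 0.0609 * Real.sin (u - m) := by
    rcases le_total u m with h | h
    · have h1 : Real.sin (u - m) ≤ 0 := Real.sin_nonpos_of_nonpos_of_neg_pi_le (by linarith)
        (by linarith [Real.pi_gt_three])
      have : 0 < Real.sin m * capSide u shieldPt := mul_pos (by linarith) hs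
      linarith
    · have h1 : Real.sin (u - m) ≤ u - m := Real.sin_le (by linarith)
      have h2 : 0.03 - 0.515 * (psi - u) ^ 2 ≤ capSide u shieldPt := by
        rw [capSide_shieldPt]
        have := Real.one_sub_sq_div_two_le_cos (x := psi - u)
        linarith [Real.cos_le_one (del / 2)]
      have h3 : 0.7939 * capSide u shieldPt ≤ Real.sin m * capSide u shieldPt :=
        mul_le_mul_of_nonneg_right hsm.le hs.le
      have h4 : u - m ≤ 0.2267925 - (psi - u) := by linarith [psi_lt, chi_gt, eps_gt]
      nlinarith [del_gt, psi_lt, chi_gt]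
  have e3 : pwRight (midPt ω) * capSide u shieldPt - pwRight shieldPt * capSide u (midPt ω)
      = 2 * rad * Real.sin g * (0.58 * Real.sin m * capSide u shieldPt - 0.0609 * Real.sin (u - m))
        - 0.0609 * capSide u (midPt chi) := by
    rw [pwRight_shieldPt, e1]
    linear_combination (-0.0609) * e2
  rw [e3]
  have : 0 < 2 * rad * Real.sin g *
      (0.58 * Real.sin m * capSide u shieldPt - 0.0609 * Real.sin (u - m)) := by positivity
  linarith

/-- The counterpart with the two circles exchanged: again `q` is the reference point, the factor
`sin g` is split off, and the angle stays a full step `del` away from `q`. -/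
lemma unitPt_outside_arc_fan {v θ : ℝ} (hv : chi + eps / 2 ≤ v) (hv' : v ≤ 1.04)
    (hθ : -psi ≤ θ) (hθ' : θ ≤ psi - del) (hs : 0 < arcSide v shieldPt) :
    0 < pwMid (unitPt θ) * arcSide v shieldPt - pwMid shieldPt * arcSide v (unitPt θ) := by
  have hpi := Real.pi_gt_three
  have hq : arcSide v (unitPt psi) ≤ 0 := by
    rw [← midPt_chi, arcSide_midPt]
    refine mul_nonpos_of_nonneg_of_nonpos rad_pos.le (sub_nonpos.2 ?_)
    rw [← Real.cos_neg (chi - v), neg_sub]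
    exact Real.cos_le_cos_of_nonneg_of_le_pi (by linarith [eps_pos])
      (by linarith [chi_gt]) (by linarith)
  have hps : pwMid shieldPt < 0.0681004 := by rw [pwMid_shieldPt, cos_psi]; norm_num
  have hps0 := pwMid_shieldPt_pos
  set m := (psi + θ) / 2 with hm
  set g := (psi - θ) / 2 with hg
  have eθ : θ = m - g := by rw [hm, hg]; ring
  have eψ : psi = m + g := by rw [hm, hg]; ring
  have hg0 : 0 < Real.sin g := Real.sin_pos_of_pos_of_lt_pi (by linarith [del_pos])
    (by linarith [psi_lt])
  have hm1 : 0 ≤ m := by rw [hm]; linarith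
  have hm2 : m ≤ psi - del / 2 := by rw [hm]; linarith
  have hm3 : 0 ≤ Real.sin m :=
    Real.sin_nonneg_of_nonneg_of_le_pi hm1 (by linarith [psi_lt, del_pos])
  have e1 : pwMid (unitPt θ) = 0.58 * (2 * Real.sin m * Real.sin g) := by
    rw [pwMid_unitPt, eθ]; rw [eψ]; rw [Real.cos_add, Real.cos_sub]; ring
  have e2 : arcSide v (unitPt θ) - arcSide v (unitPt psi)
      = 2 * Real.sin (m - v) * Real.sin g := by
    rw [arcSide_unitPt, arcSide_unitPt, eθ]
    rw [eψ]
    rw [show m - g - v = (m - v) - g by ring, show m + g - v = (m - v) + g by ring,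
      Real.cos_add, Real.cos_sub]
    ring
  have hχ := chi_gt
  have key : 0 < 0.58 * Real.sin m * arcSide v shieldPt - pwMid shieldPt * Real.sin (m - v) := by
    rcases lt_or_ge m v with h | h
    · have h1 : Real.sin (m - v) < 0 := Real.sin_neg_of_neg_of_neg_pi_lt (by linarith)
        (by linarith)
      have h2 : 0 ≤ Real.sin m * arcSide v shieldPt := mul_nonneg hm3 hs.le
      have h3 := mul_neg_of_pos_of_neg hps0 h1
      linarith
    · set M := psi - del / 2 with hM
      have hm4 : 0 < Real.sin m := Real.sin_pos_of_pos_of_lt_pi (by linarith [eps_pos])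
        (by linarith [psi_lt, del_pos])
      have hMs : 0.9097 < Real.sin M := by
        have h3 : Real.sin 1.142694 ≤ Real.sin M := Real.sin_le_sin_of_le_of_le_pi_div_two
          (by linarith) (by linarith [psi_lt, del_pos, Real.pi_gt_d2])
          (by linarith [psi_gt, del_lt])
        refine lt_of_lt_of_le ?_ ((taylor_seven_le_sin (x := 1.142694) (by norm_num)).trans h3)
        norm_num
      have hv1 : 0 ≤ Real.sin v := Real.sin_nonneg_of_nonneg_of_le_pi (by linarith [eps_pos])
        (by linarith)
      have hd : 0 ≤ Real.sin (M - m) := Real.sin_nonneg_of_nonneg_of_le_pi (by linarith)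
        (by linarith [psi_lt, del_pos])
      -- This identity says that `sin (m - v) / sin m` increases with `m`, so the worst case is `m =
      -- M`.
      have id : Real.sin (M - v) * Real.sin m - Real.sin (m - v) * Real.sin M
          = Real.sin v * Real.sin (M - m) := by
        rw [Real.sin_sub M v, Real.sin_sub m v, Real.sin_sub M m]; ring
      have h1 : Real.sin (M - v) ≤ M - v := Real.sin_le (by linarith)
      have h2 : 0.03 * (1 - (psi - v) ^ 2 / 2) - 0.57535 * (v - chi) ^ 2
          ≤ arcSide v shieldPt := by
        have c1 := Real.one_sub_sq_div_two_le_cos (x := psi - v)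
        have c2 := Real.one_sub_sq_div_two_le_cos (x := chi - v)
        -- Both sides are the inner product of `q` with the unit vector at angle `v`, in the two
        -- polar descriptions of `q`.
        have c3 : 0.29 * Real.cos v + Real.cos (psi - v) = rad * Real.cos (chi - v) := by
          rw [Real.cos_sub, Real.cos_sub]
          linear_combination (-Real.cos v) * rad_cos_chi - Real.sin v * rad_sin_chi
        have c4 := rad_cos_half_eps_le
        rw [arcSide_shieldPt]
        have c5 : rad * (1 - (chi - v) ^ 2 / 2) ≤ rad * Real.cos (chi - v) :=
          mul_le_mul_of_nonneg_left c2 rad_pos.le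
        have c6 : rad * (1 - (chi - v) ^ 2 / 2) = 1.1507 - 0.57535 * (v - chi) ^ 2 := by
          rw [rad]; ring
        linarith
      have h3 : 0.0681004 * (M - v) < 0.58 * 0.9097 * arcSide v shieldPt := by
        have a1 : psi - v = (psi - chi) - (v - chi) := by ring
        have a2 : M - v ≤ 0.2300325 - (v - chi) := by linarith [psi_lt, del_gt]
        have a3 : psi - chi < 0.2314925 := by linarith [psi_lt]
        have a4 : 0.0047 ≤ v - chi := by linarith [eps_gt]
        have a5 : v - chi ≤ 0.1274 := by linarith
        have a6 : (psi - v) ^ 2 ≤ (0.2314925 - (v - chi)) ^ 2 := by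
          have : 0 ≤ psi - v := by linarith [psi_gt]
          apply pow_le_pow_left₀ this; linarith
        nlinarith
      have h4 : pwMid shieldPt * Real.sin (M - v) ≤ 0.0681004 * (M - v) := by
        calc _ ≤ pwMid shieldPt * (M - v) := mul_le_mul_of_nonneg_left h1 hps0.le
          _ ≤ _ := mul_le_mul_of_nonneg_right hps.le (by linarith)
      have h5 : 0.9097 * arcSide v shieldPt ≤ Real.sin M * arcSide v shieldPt :=
        mul_le_mul_of_nonneg_right hMs.le hs.le
      have h6 : 0 < 0.58 * Real.sin M * arcSide v shieldPt - pwMid shieldPt * Real.sin (M - v) := by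
        linarith
      have h7 : Real.sin (m - v) * Real.sin M ≤ Real.sin (M - v) * Real.sin m := by
        have := mul_nonneg hv1 hd
        linarith
      refine pos_of_mul_pos_left (b := Real.sin M) ?_ (by linarith)
      have h8 := mul_pos hm4 h6
      have h9 := mul_le_mul_of_nonneg_left h7 hps0.le
      nlinarith
  have e3 : pwMid (unitPt θ) * arcSide v shieldPt - pwMid shieldPt * arcSide v (unitPt θ)
      = 2 * Real.sin g *
        (0.58 * Real.sin m * arcSide v shieldPt - pwMid shieldPt * Real.sin (m - v))
        - pwMid shieldPt * arcSide v (unitPt psi) := by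
    rw [e1]
    linear_combination (-pwMid shieldPt) * e2
  rw [e3]
  have h1 : 0 < 2 * Real.sin g *
      (0.58 * Real.sin m * arcSide v shieldPt - pwMid shieldPt * Real.sin (m - v)) := by positivity
  have h2 := mul_nonneg_of_nonpos_of_nonpos (neg_nonpos.2 hps0.le) hq
  linarith

/-- On the inner side of the chord line the fan circle runs inside the original circle. A site
behind the chord and outside the original circle is therefore outside the fan circle. -/
lemma pencil_pos {a b c d : ℝ} (ha : 0 ≤ a) (hb : 0 < b) (hc : 0 < c) (hd : d < 0) :
    0 < a * b - c * d := by nlinarith [mul_nonneg ha hb.le, mul_pos hc (neg_pos.2 hd)]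

lemma capMid_gt_of_visible {i : ℕ} (hi : i < 783)
    (hs : 0 < capSide (capAngle i + del / 2) shieldPt) :
    0.87 < capAngle i + del / 2 := by
  by_contra! h
  exact absurd (capSide_shieldPt_neg (capMid_bounds hi).1 h) (not_lt.2 hs.le)

lemma arcMid_lt_of_visible {j : ℕ} (hj : j < 140)
    (hs : 0 < arcSide (arcAngle j + eps / 2) shieldPt) :
    arcAngle j + eps / 2 < 1.3 := by
  by_contra! h
  exact absurd (arcSide_shieldPt_neg h (by linarith [(arcMid_bounds hj).2, eps_pos]))
    (not_lt.2 hs.le)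

lemma cos_nonneg_of_arcMid_le {v : ℝ} (h1 : chi ≤ v) (h2 : v ≤ 1.32) : 0 ≤ Real.cos v :=
  Real.cos_nonneg_of_neg_pi_div_two_le_of_le (by linarith [chi_gt, Real.pi_gt_three])
    (by linarith [Real.pi_gt_three])

lemma fanEmpty_cap {i : ℕ} (hi : i < 783) (hs : crs (capPt i) (capPt (i + 1)) shieldPt < 0) :
    FanEmpty (capPt i) (capPt (i + 1)) shieldPt := by
  have hl := (crs_capPt_neg_iff _ _).1 hs
  have hu := capMid_gt_of_visible hi hl
  have hu' := (capMid_bounds hi).2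
  have hua := abs_capMid_le hi
  have hd := del_pos
  have hk : 0 < 2 * Real.sin (del / 2) := by linarith [sin_half_del_pos]
  have hps : 0 < pwRight shieldPt := by rw [pwRight_shieldPt]; norm_num
  refine FanEmpty.of_pencil (z := rightCentre 0.58) (q := 1) hs (pwRight_unitPt _)
    (pwRight_unitPt _) fun x hx => ?_
  suffices h : x = capPt i ∨ x = capPt (i + 1) ∨ x = shieldPt ∨
      0 < pwRight x * capSide (capAngle i + del / 2) shieldPt
        - pwRight shieldPt * capSide (capAngle i + del / 2) x by
    rcases h with h | h | h | h
    · exact Or.inl h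
    · exact Or.inr (Or.inl h)
    · exact Or.inr (Or.inr (Or.inl h))
    · right; right; right
      rw [crs_capPt, crs_capPt]
      calc 0 < 2 * Real.sin (del / 2) * _ := mul_pos hk h
        _ = _ := by simp only [pwRight]; ring
  have strict : ∀ {y}, IsSite y → capSide (capAngle i + del / 2) y < 0 →
      0 < pwRight y * capSide (capAngle i + del / 2) shieldPt
        - pwRight shieldPt * capSide (capAngle i + del / 2) y :=
    fun hy h => pencil_pos (pwRight_nonneg hy) hl hps h
  have main : ∀ k ≤ 783, capPt k = capPt i ∨ capPt k = capPt (i + 1) ∨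
      0 < pwRight (capPt k) * capSide (capAngle i + del / 2) shieldPt
        - pwRight shieldPt * capSide (capAngle i + del / 2) (capPt k) := by
    intro k hk
    by_cases h1 : k = i
    · left; rw [h1]
    by_cases h2 : k = i + 1
    · right; left; rw [h2]
    right; right
    exact strict (Or.inl (onOutline_capPt hk)) ((capSide_capPt_nonpos hi hk).2 h1 h2)
  refine IsSite.cases (Q := fun x => x = capPt i ∨ x = capPt (i + 1) ∨ x = shieldPt ∨
      0 < pwRight x * capSide (capAngle i + del / 2) shieldPt
        - pwRight shieldPt * capSide (capAngle i + del / 2) x) ?_ ?_ ?_ ?_ ?_ ?_ ?_ ?_ hx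
  · intro k hk
    have := main k hk
    tauto
  · intro j hj
    -- The corner belongs to both arcs and may be an endpoint of the chord, so it is treated as the
    -- last cap point.
    rcases Nat.eq_zero_or_pos j with rfl | h
    · have := main 783 le_rfl
      rw [capPt_last] at this
      tauto
    · right; right; right
      refine midPt_outside_cap_fan hu.le hu' ?_ (arcAngle_le hj) hl
      have := arcAngle_strictMono.monotone h
      rw [arcAngle_succ, arcAngle_zero] at this
      exact this
  · intro k hk
    right; right; right
    exact strict (Or.inl (onOutline_capPt hk).neg) (capSide_neg_unitPt_neg hua (abs_capAngle_le hk))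
  · intro j hj
    right; right; right
    exact strict (Or.inl (onOutline_arcPt hj).neg)
      (capSide_neg_midPt_neg hu.le (by linarith) (arcAngle_ge j) (arcAngle_le hj))
  · right; right; left; rfl
  · right; right; right
    exact strict (Or.inr (by simp [IsShield])) (capSide_mirror_shieldPt_neg (by linarith)
      (by linarith))
  · right; right; right
    exact strict (Or.inr (by simp [IsShield])) (capSide_neg_shieldPt_neg hua).1
  · right; right; right
    exact strict (Or.inr (by simp [IsShield])) (capSide_neg_shieldPt_neg hua).2

lemma abs_cos_le_of_arcMid {v : ℝ} (h1 : 1.04 ≤ v) (h2 : v ≤ Real.pi - 1.04) :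
    |Real.cos v| ≤ 0.51 := by
  have h3 := cos_le_taylor_four (x := 1.04) (by norm_num)
  have h4 : Real.cos v ≤ Real.cos 1.04 := Real.cos_le_cos_of_nonneg_of_le_pi (by norm_num)
    (by linarith) h1
  have h5 : Real.cos (Real.pi - 1.04) ≤ Real.cos v := Real.cos_le_cos_of_nonneg_of_le_pi
    (by linarith) (by linarith) h2
  rw [Real.cos_pi_sub] at h5
  norm_num at h3 h4 h5
  rw [abs_le]; constructor <;> linarith

lemma abs_arcAngle_sub_arcMid_le {i k : ℕ} (hi : i < 140) (hk : k ≤ 140) :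
    |arcAngle k - (arcAngle i + eps / 2)| ≤ Real.pi - 2 * chi := by
  have h1 := arcMid_bounds hi
  have h2 := arcAngle_ge k
  have h3 := arcAngle_le hk
  have := eps_pos
  rw [abs_le]; constructor <;> linarith

lemma fanEmpty_arc {i : ℕ} (hi : i < 140) (hs : crs (arcPt i) (arcPt (i + 1)) shieldPt < 0) :
    FanEmpty (arcPt i) (arcPt (i + 1)) shieldPt := by
  have hl := (crs_arcPt_neg_iff _ _).1 hs
  have hv := arcMid_lt_of_visible hi hl
  have hv' := (arcMid_bounds hi).1
  have hv2 := (arcMid_bounds hi).2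
  have hd := eps_pos
  have hcos : 0 ≤ Real.cos (arcAngle i + eps / 2) :=
    cos_nonneg_of_arcMid_le (by linarith) (by linarith)
  have hk : 0 < 2 * rad * Real.sin (eps / 2) := by
    have := sin_half_eps_pos
    have := rad_pos
    positivity
  have hps := pwMid_shieldPt_pos
  refine FanEmpty.of_pencil (z := 0) (q := rad ^ 2) hs (pwMid_midPt _)
    (pwMid_midPt _) fun x hx => ?_
  suffices h : x = arcPt i ∨ x = arcPt (i + 1) ∨ x = shieldPt ∨
      0 < pwMid x * arcSide (arcAngle i + eps / 2) shieldPt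
        - pwMid shieldPt * arcSide (arcAngle i + eps / 2) x by
    rcases h with h | h | h | h
    · exact Or.inl h
    · exact Or.inr (Or.inl h)
    · exact Or.inr (Or.inr (Or.inl h))
    · right; right; right
      rw [crs_arcPt, crs_arcPt]
      calc 0 < 2 * rad * Real.sin (eps / 2) * _ := mul_pos hk h
        _ = _ := by simp only [pwMid]; ring
  have strict : ∀ {y}, IsSite y → arcSide (arcAngle i + eps / 2) y < 0 →
      0 < pwMid y * arcSide (arcAngle i + eps / 2) shieldPt
        - pwMid shieldPt * arcSide (arcAngle i + eps / 2) y :=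
    fun hy h => pencil_pos (pwMid_nonneg hy) hl hps h
  have main : ∀ k ≤ 140, arcPt k = arcPt i ∨ arcPt k = arcPt (i + 1) ∨
      0 < pwMid (arcPt k) * arcSide (arcAngle i + eps / 2) shieldPt
        - pwMid shieldPt * arcSide (arcAngle i + eps / 2) (arcPt k) := by
    intro k hk
    by_cases h1 : k = i
    · left; rw [h1]
    by_cases h2 : k = i + 1
    · right; left; rw [h2]
    right; right
    exact strict (Or.inl (onOutline_arcPt hk)) ((arcSide_arcPt_nonpos hi hk).2 h1 h2)
  refine IsSite.cases (Q := fun x => x = arcPt i ∨ x = arcPt (i + 1) ∨ x = shieldPt ∨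
      0 < pwMid x * arcSide (arcAngle i + eps / 2) shieldPt
        - pwMid shieldPt * arcSide (arcAngle i + eps / 2) x) ?_ ?_ ?_ ?_ ?_ ?_ ?_ ?_ hx
  · intro k hk
    rcases hk.eq_or_lt with rfl | h
    · have := main 0 (Nat.zero_le _)
      rw [← capPt_last] at this
      tauto
    · right; right; right
      -- From mid-angle `1.04` on, the right unit disk is entirely behind the chord; only below that
      -- value is the pencil estimate needed.
      rcases le_total (arcAngle i + eps / 2) 1.04 with h1 | h1
      · refine unitPt_outside_arc_fan hv' h1 (capAngle_ge k) ?_ hl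
        have := capAngle_le (i := k + 1) h
        rw [capAngle_succ] at this
        linarith
      · exact strict (Or.inl (onOutline_capPt hk)) (arcSide_unitPt_neg
          (abs_cos_le_of_arcMid h1 (by linarith [Real.pi_gt_three]))).1
  · intro j hj
    have := main j hj
    tauto
  · intro k hk
    right; right; right
    exact strict (Or.inl (onOutline_capPt hk).neg) (arcSide_neg_unitPt_neg hcos)
  · intro j hj
    right; right; right
    exact strict (Or.inl (onOutline_arcPt hj).neg)
      (arcSide_neg_midPt_neg (abs_arcAngle_sub_arcMid_le hi hj))
  · right; right; left; rfl
  · right; right; right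
    exact strict (Or.inr (by simp [IsShield])) (arcSide_mirror_shieldPt_neg (by linarith)
      (by linarith))
  · right; right; right
    exact strict (Or.inr (by simp [IsShield])) (arcSide_neg_shieldPt_neg (by linarith)
      (by linarith))
  · right; right; right
    exact strict (Or.inr (by simp [IsShield])) (arcSide_neg_mirror_shieldPt_neg hcos)

/-- Only the chords on its own side are visible from a shield point. -/
lemma isArcChord_of_visible {u v : Plane} (h : IsChord u v) (hs : crs u v shieldPt < 0) :
    IsArcChord u v := by
  rcases h with h | h
  · exact h
  exfalso
  rw [← crs_neg] at hs
  rcases h with ⟨i, hi, hu, hv⟩ | ⟨j, hj, hu, hv⟩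
  · rw [hu, hv, crs_capPt_neg_iff] at hs
    linarith [(capSide_neg_shieldPt_neg (abs_capMid_le hi)).1]
  · rw [hu, hv, crs_arcPt_neg_iff] at hs
    have := arcMid_bounds hj
    linarith [arcSide_neg_shieldPt_neg (v := arcAngle j + eps / 2) (by linarith [eps_pos])
      (by linarith [eps_pos])]

lemma fanEmpty {u v s : Plane} (h : IsChord u v) (hs : IsShield s) (hneg : crs u v s < 0) :
    FanEmpty u v s := by
  refine IsShield.cases (Q := fun u v s => crs u v s < 0 → FanEmpty u v s) ?_ ?_ ?_ hs h hneg
  · intro u v s hQ h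
    rw [crs_neg] at h
    exact (hQ h).neg
  · intro u v s hQ h
    rw [crs_mirror] at h
    exact (hQ h).map_mirror
  · intro u v h hs
    rcases isArcChord_of_visible h hs with ⟨i, hi, rfl, rfl⟩ | ⟨j, hj, rfl, rfl⟩
    · exact fanEmpty_cap hi hs
    · exact fanEmpty_arc hj hs

/-! ### The boundary of the convex hull -/

lemma capSide_nonpos_of_ne {i : ℕ} (hi : i < 783) (h1 : 0.8 ≤ capAngle i + del / 2)
    (h2 : capAngle i + del / 2 ≤ 1) {x : Plane} (hx : IsSite x) :
    x = shieldPt ∨ capSide (capAngle i + del / 2) x ≤ 0 := by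
  have ha : |capAngle i + del / 2| ≤ 1 := abs_le.2 ⟨by linarith, h2⟩
  have hb := abs_capMid_le hi
  revert x
  apply IsSite.cases
  · intro k hk; exact Or.inr (capSide_capPt_nonpos hi hk).1
  · intro j _; exact Or.inr (capSide_midPt_nonpos ha).1
  · intro k hk; exact Or.inr (capSide_neg_unitPt_neg hb (abs_capAngle_le hk)).le
  · intro j _; exact Or.inr (capSide_midPt_nonpos ha).2
  · exact Or.inl rfl
  · exact Or.inr (capSide_mirror_shieldPt_neg h1 (abs_le.1 hb).2).le
  · exact Or.inr (capSide_neg_shieldPt_neg hb).1.le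
  · exact Or.inr (capSide_neg_shieldPt_neg hb).2.le

lemma arcSide_nonpos_of_ne {j : ℕ} (hj : j < 140) (h1 : 1.04 ≤ arcAngle j + eps / 2)
    (h2 : arcAngle j + eps / 2 ≤ 1.32) {x : Plane} (hx : IsSite x) :
    x = shieldPt ∨ arcSide (arcAngle j + eps / 2) x ≤ 0 := by
  have ha := abs_cos_le_of_arcMid h1 (by linarith [Real.pi_gt_three])
  have hb := arcMid_bounds hj
  have he := eps_pos
  have hc : 0 ≤ Real.cos (arcAngle j + eps / 2) := cos_nonneg_of_arcMid_le (by linarith) h2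
  revert x
  apply IsSite.cases
  · intro k hk; exact Or.inr (arcSide_unitPt_neg ha).1.le
  · intro k hk; exact Or.inr (arcSide_arcPt_nonpos hj hk).1
  · intro k hk; exact Or.inr (arcSide_unitPt_neg ha).2.le
  · intro k hk; exact Or.inr (arcSide_neg_midPt_neg (abs_arcAngle_sub_arcMid_le hj hk)).le
  · exact Or.inl rfl
  · exact Or.inr (arcSide_mirror_shieldPt_neg (by linarith) (by linarith)).le
  · exact Or.inr (arcSide_neg_shieldPt_neg (by linarith) (by linarith)).le
  · exact Or.inr (arcSide_neg_mirror_shieldPt_neg hc).le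

/-- A chord that no shield point sees is an edge of the convex hull. -/
lemma crs_nonneg_of_unseen {u v : Plane} (h : IsChord u v)
    (hs : ∀ s, IsShield s → 0 ≤ crs u v s) {x : Plane} (hx : IsSite x) : 0 ≤ crs u v x := by
  refine IsChord.cases (Q := fun u v => (∀ s, IsShield s → 0 ≤ crs u v s) →
    ∀ x, IsSite x → 0 ≤ crs u v x) ?_ ?_ ?_ h hs x hx
  · intro i hi hs x hx
    have hb := abs_capMid_le hi
    have hb' := abs_le.1 hb
    have s1 := (crs_capPt_nonneg_iff _ _).1 (hs shieldPt (by simp [IsShield]))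
    have s2 := (crs_capPt_nonneg_iff _ _).1 (hs (mirror shieldPt) (by simp [IsShield]))
    -- A mid-angle of absolute value above `1` would be seen by one of the two right shields.
    have ha : |capAngle i + del / 2| ≤ 1 := by
      rw [abs_le]
      constructor
      · by_contra! hc
        have := capSide_shieldPt_pos (u := -(capAngle i + del / 2)) (by linarith) (by linarith)
        rw [capSide_shieldPt, sub_neg_eq_add] at this
        rw [capSide_mirror_shieldPt] at s2
        linarith
      · by_contra! hc
        linarith [capSide_shieldPt_pos (u := capAngle i + del / 2) (by linarith) hb'.2]
    rcases hx with ((⟨k, hk, rfl⟩ | ⟨j, hj, rfl⟩) | (⟨k, hk, hx⟩ | ⟨j, hj, hx⟩)) | hx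
    · exact (crs_capPt_nonneg_iff _ _).2 (capSide_capPt_nonpos hi hk).1
    · exact (crs_capPt_nonneg_iff _ _).2 (capSide_midPt_nonpos ha).1
    · rw [← neg_neg x, hx]
      exact (crs_capPt_nonneg_iff _ _).2 (capSide_neg_unitPt_neg hb (abs_capAngle_le hk)).le
    · rw [← neg_neg x, hx]
      exact (crs_capPt_nonneg_iff _ _).2 (capSide_midPt_nonpos ha).2
    · exact hs x hx
  · intro i hi hs x hx
    have hb := arcMid_bounds hi
    have he := eps_pos
    have s1 := (crs_arcPt_nonneg_iff _ _).1 (hs shieldPt (by simp [IsShield]))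
    have s2 := (crs_arcPt_nonneg_iff _ _).1 (hs (-mirror shieldPt) (by simp [IsShield]))
    have ha : |Real.cos (arcAngle i + eps / 2)| ≤ 0.51 := by
      refine abs_cos_le_of_arcMid ?_ ?_
      · by_contra! hc
        linarith [arcSide_shieldPt_pos (v := arcAngle i + eps / 2) (by linarith) (by linarith)]
      · by_contra! hc
        have := arcSide_shieldPt_pos (v := Real.pi - (arcAngle i + eps / 2)) (by linarith)
          (by linarith)
        rw [arcSide_shieldPt, Real.cos_pi_sub, show psi - (Real.pi - (arcAngle i + eps / 2))
          = (psi + (arcAngle i + eps / 2)) - Real.pi by ring, Real.cos_sub_pi] at this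
        rw [arcSide_neg_mirror_shieldPt] at s2
        linarith
    rcases hx with ((⟨k, hk, rfl⟩ | ⟨j, hj, rfl⟩) | (⟨k, hk, hx⟩ | ⟨j, hj, hx⟩)) | hx
    · exact (crs_arcPt_nonneg_iff _ _).2 (arcSide_unitPt_neg ha).1.le
    · exact (crs_arcPt_nonneg_iff _ _).2 (arcSide_arcPt_nonpos hi hj).1
    · rw [← neg_neg x, hx]
      exact (crs_arcPt_nonneg_iff _ _).2 (arcSide_unitPt_neg ha).2.le
    · rw [← neg_neg x, hx]
      exact (crs_arcPt_nonneg_iff _ _).2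
        (arcSide_neg_midPt_neg (abs_arcAngle_sub_arcMid_le hi hj)).le
    · exact hs x hx
  · intro u v hQ hs x hx
    rw [← crs_neg, neg_neg, neg_neg]
    refine hQ (fun s hs' => ?_) (-x) hx.neg
    rw [← crs_neg]
    exact hs (-s) hs'.neg

/-- At `v` the shield `s` passes from seeing `u v` to not seeing `v w`. Every site other than `s` is
behind both chord lines, and the identity writes `crs s v x` as a combination of the two chord
functions with nonnegative coefficients. So `s v` is a tangent edge of the hull. -/
lemma crs_nonneg_of_tangent_left {u v w s : Plane} (h0 : 0 < crs v w u) (h1 : crs u v s < 0)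
    (h2 : 0 ≤ crs v w s) (h3 : ∀ x, IsSite x → x = s ∨ 0 ≤ crs u v x)
    (h4 : ∀ x, IsSite x → x = s ∨ 0 ≤ crs v w x) {x : Plane} (hx : IsSite x) :
    0 ≤ crs s v x := by
  rcases h3 x hx with rfl | h3
  · simp only [crs]; ring_nf; rfl
  rcases h4 x hx with rfl | h4
  · simp only [crs]; ring_nf; rfl
  have : crs s v x * crs v w u = crs u v x * crs v w s - crs v w x * crs u v s := by
    simp only [crs]; ring
  refine nonneg_of_mul_nonneg_left ?_ h0
  rw [this]
  nlinarith [mul_nonneg h3 h2, mul_nonneg h4 (neg_nonneg.2 h1.le)]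

lemma crs_nonneg_of_tangent_right {u v w s : Plane} (h0 : 0 < crs w u v) (h1 : crs u v s < 0)
    (h2 : 0 ≤ crs w u s) (h3 : ∀ x, IsSite x → x = s ∨ 0 ≤ crs u v x)
    (h4 : ∀ x, IsSite x → x = s ∨ 0 ≤ crs w u x) {x : Plane} (hx : IsSite x) :
    0 ≤ crs u s x := by
  rcases h3 x hx with rfl | h3
  · simp only [crs]; ring_nf; rfl
  rcases h4 x hx with rfl | h4
  · simp only [crs]; ring_nf; rfl
  have : crs u s x * crs w u v = crs u v x * crs w u s - crs w u x * crs u v s := by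
    simp only [crs]; ring
  refine nonneg_of_mul_nonneg_left ?_ h0
  rw [this]
  nlinarith [mul_nonneg h3 h2, mul_nonneg h4 (neg_nonneg.2 h1.le)]

lemma crs_capPt_pos {i k : ℕ} (hi : i < 783) (hk : k ≤ 783) (h1 : k ≠ i) (h2 : k ≠ i + 1) :
    0 < crs (capPt i) (capPt (i + 1)) (capPt k) := by
  have := (capSide_capPt_nonpos hi hk).2 h1 h2
  have := sin_half_del_pos
  rw [crs_capPt]
  exact mul_pos_of_neg_of_neg (by linarith) (by assumption)

lemma crs_arcPt_pos {i k : ℕ} (hi : i < 140) (hk : k ≤ 140) (h1 : k ≠ i) (h2 : k ≠ i + 1) :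
    0 < crs (arcPt i) (arcPt (i + 1)) (arcPt k) := by
  have := (arcSide_arcPt_nonpos hi hk).2 h1 h2
  have := mul_pos rad_pos sin_half_eps_pos
  rw [crs_arcPt]
  exact mul_pos_of_neg_of_neg (by linarith) (by assumption)

/-- The two edges at the shield point of a fan triangle are shared with another triangle of the
fan or lie on the boundary of the convex hull. -/
def FanEdges (u v s : Plane) : Prop :=
  ((∃ w, IsChord v w ∧ crs v w s < 0) ∨ ∀ x, IsSite x → 0 ≤ crs s v x) ∧
    ((∃ w, IsChord w u ∧ crs w u s < 0) ∨ ∀ x, IsSite x → 0 ≤ crs u s x)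

lemma fanEdges_cap {i : ℕ} (hi : i < 783) (hs : crs (capPt i) (capPt (i + 1)) shieldPt < 0) :
    FanEdges (capPt i) (capPt (i + 1)) shieldPt := by
  have hl := (crs_capPt_neg_iff _ _).1 hs
  have hu := capMid_gt_of_visible hi hl
  have hd := del_lt
  have hd' := del_pos
  constructor
  · rcases Nat.lt_or_ge (i + 1) 783 with hi' | hi'
    · by_cases hv : crs (capPt (i + 1)) (capPt (i + 1 + 1)) shieldPt < 0
      · exact Or.inl ⟨_, isChord_capPt hi', hv⟩
      right
      -- Visibility changes only with mid-angles between `0.87` and `0.93`. In that window every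
      -- site except the shield is behind both chords, so the tangent lemma applies.
      have hv' : ¬ 0.93 ≤ capAngle (i + 1) + del / 2 := fun h => hv ((crs_capPt_neg_iff _ _).2
        (capSide_shieldPt_pos h (by linarith [(capMid_bounds hi').2])))
      rw [not_le] at hv'
      have e := capAngle_succ i
      refine fun x hx => crs_nonneg_of_tangent_left
        (crs_capPt_pos hi' hi.le (by omega) (by omega)) hs (not_lt.1 hv) ?_ ?_ hx
      · exact fun y hy => (capSide_nonpos_of_ne hi (by linarith) (by linarith) hy).imp_right
          (crs_capPt_nonneg_iff _ _).2
      · exact fun y hy => (capSide_nonpos_of_ne hi' (by linarith) (by linarith) hy).imp_right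
          (crs_capPt_nonneg_iff _ _).2
    · left
      have : i + 1 = 783 := by omega
      rw [this, capPt_last]
      refine ⟨_, isChord_arcPt (by norm_num), (crs_arcPt_neg_iff _ _).2 ?_⟩
      rw [arcAngle_zero]
      exact arcSide_shieldPt_pos (by linarith [eps_pos]) (by linarith [chi_lt, eps_lt])
  · obtain ⟨k, rfl⟩ : ∃ k, i = k + 1 := by
      refine Nat.exists_eq_succ_of_ne_zero ?_
      rintro rfl
      rw [capAngle_zero] at hu
      linarith [psi_gt]
    have hk : k < 783 := by omega
    by_cases hv : crs (capPt k) (capPt (k + 1)) shieldPt < 0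
    · exact Or.inl ⟨_, isChord_capPt hk, hv⟩
    right
    have hv' : ¬ 0.93 ≤ capAngle k + del / 2 := fun h => hv ((crs_capPt_neg_iff _ _).2
      (capSide_shieldPt_pos h (by linarith [(capMid_bounds hk).2])))
    rw [not_le] at hv'
    have e := capAngle_succ k
    refine fun x hx => crs_nonneg_of_tangent_right
      (crs_capPt_pos hk hi (by omega) (by omega)) hs (not_lt.1 hv) ?_ ?_ hx
    · exact fun y hy => (capSide_nonpos_of_ne hi (by linarith) (by linarith) hy).imp_right
        (crs_capPt_nonneg_iff _ _).2
    · exact fun y hy => (capSide_nonpos_of_ne hk (by linarith) (by linarith) hy).imp_right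
        (crs_capPt_nonneg_iff _ _).2

lemma fanEdges_arc {i : ℕ} (hi : i < 140) (hs : crs (arcPt i) (arcPt (i + 1)) shieldPt < 0) :
    FanEdges (arcPt i) (arcPt (i + 1)) shieldPt := by
  have hl := (crs_arcPt_neg_iff _ _).1 hs
  have hu := arcMid_lt_of_visible hi hl
  have hd := eps_lt
  have hd' := eps_pos
  constructor
  · have hi' : i + 1 < 140 := by
      by_contra hc
      have : i + 1 = 140 := by omega
      have h2 := arcAngle_succ i
      rw [this, arcAngle_last] at h2
      linarith [chi_lt, Real.pi_gt_three]
    by_cases hv : crs (arcPt (i + 1)) (arcPt (i + 1 + 1)) shieldPt < 0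
    · exact Or.inl ⟨_, isChord_arcPt hi', hv⟩
    right
    have hv' : ¬ arcAngle (i + 1) + eps / 2 ≤ 1.08 := fun h => hv ((crs_arcPt_neg_iff _ _).2
      (arcSide_shieldPt_pos (by linarith [(arcMid_bounds hi').1]) h))
    rw [not_le] at hv'
    have e := arcAngle_succ i
    refine fun x hx => crs_nonneg_of_tangent_left
      (crs_arcPt_pos hi' hi.le (by omega) (by omega)) hs (not_lt.1 hv) ?_ ?_ hx
    · exact fun y hy => (arcSide_nonpos_of_ne hi (by linarith) (by linarith) hy).imp_right
        (crs_arcPt_nonneg_iff _ _).2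
    · exact fun y hy => (arcSide_nonpos_of_ne hi' (by linarith) (by linarith) hy).imp_right
        (crs_arcPt_nonneg_iff _ _).2
  · rcases Nat.eq_zero_or_pos i with rfl | hpos
    · left
      rw [← capPt_last]
      refine ⟨_, isChord_capPt (i := 782) (by norm_num), (crs_capPt_neg_iff _ _).2 ?_⟩
      have h1 := capAngle_succ 782
      rw [capAngle_last] at h1
      exact capSide_shieldPt_pos (by linarith [psi_gt, del_lt]) (by linarith [del_pos])
    obtain ⟨k, rfl⟩ : ∃ k, i = k + 1 := Nat.exists_eq_succ_of_ne_zero (by omega)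
    have hk : k < 140 := by omega
    by_cases hv : crs (arcPt k) (arcPt (k + 1)) shieldPt < 0
    · exact Or.inl ⟨_, isChord_arcPt hk, hv⟩
    right
    have hv' : ¬ arcAngle k + eps / 2 ≤ 1.08 := fun h => hv ((crs_arcPt_neg_iff _ _).2
      (arcSide_shieldPt_pos (by linarith [(arcMid_bounds hk).1]) h))
    rw [not_le] at hv'
    have e := arcAngle_succ k
    refine fun x hx => crs_nonneg_of_tangent_right
      (crs_arcPt_pos hk hi (by omega) (by omega)) hs (not_lt.1 hv) ?_ ?_ hx
    · exact fun y hy => (arcSide_nonpos_of_ne hi (by linarith) (by linarith) hy).imp_right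
        (crs_arcPt_nonneg_iff _ _).2
    · exact fun y hy => (arcSide_nonpos_of_ne hk (by linarith) (by linarith) hy).imp_right
        (crs_arcPt_nonneg_iff _ _).2

lemma FanEdges.neg {u v s : Plane} (h : FanEdges u v s) : FanEdges (-u) (-v) (-s) := by
  refine ⟨?_, ?_⟩
  · rcases h.1 with ⟨w, hw, hs⟩ | h
    · exact Or.inl ⟨-w, hw.neg, by rwa [crs_neg]⟩
    · exact Or.inr fun x hx => by rw [← crs_neg, neg_neg, neg_neg]; exact h _ hx.neg
  · rcases h.2 with ⟨w, hw, hs⟩ | h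
    · exact Or.inl ⟨-w, hw.neg, by rwa [crs_neg]⟩
    · exact Or.inr fun x hx => by rw [← crs_neg, neg_neg, neg_neg]; exact h _ hx.neg

lemma FanEdges.map_mirror {u v s : Plane} (h : FanEdges u v s) :
    FanEdges (mirror v) (mirror u) (mirror s) := by
  refine ⟨?_, ?_⟩
  · rcases h.2 with ⟨w, hw, hs⟩ | h
    · exact Or.inl ⟨mirror w, hw.map_mirror, by rwa [crs_mirror]⟩
    · exact Or.inr fun x hx => by
        rw [← crs_mirror, mirror_mirror, mirror_mirror]; exact h _ hx.map_mirror
  · rcases h.1 with ⟨w, hw, hs⟩ | h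
    · exact Or.inl ⟨mirror w, hw.map_mirror, by rwa [crs_mirror]⟩
    · exact Or.inr fun x hx => by
        rw [← crs_mirror, mirror_mirror, mirror_mirror]; exact h _ hx.map_mirror

lemma fanEdges {u v s : Plane} (h : IsChord u v) (hs : IsShield s) (hneg : crs u v s < 0) :
    FanEdges u v s := by
  refine IsShield.cases (Q := fun u v s => crs u v s < 0 → FanEdges u v s) ?_ ?_ ?_ hs h hneg
  · intro u v s hQ h
    rw [crs_neg] at h
    exact (hQ h).neg
  · intro u v s hQ h
    rw [crs_mirror] at h
    exact (hQ h).map_mirror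
  · intro u v h hs
    rcases isArcChord_of_visible h hs with ⟨i, hi, rfl, rfl⟩ | ⟨j, hj, rfl, rfl⟩
    · exact fanEdges_cap hi hs
    · exact fanEdges_arc hj hs

/-! ### The triangles -/

/-- The triangles inscribed in the right unit circle, and those of the upper half of the middle
circle. Each of them is given by a chord of the outline and an apex. -/
def IsInnerArc (u v w : Plane) : Prop :=
  (∃ j < 783, j ≠ 702 ∧ u = capPt j ∧ v = capPt (j + 1) ∧ w = capPt (min 783 (1405 - j))) ∨
    ∃ j < 140, u = arcPt j ∧ v = arcPt (j + 1) ∧ w = capPt 0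

/-- The triangles inscribed in one of the three circles. -/
def IsInner (u v w : Plane) : Prop := IsInnerArc u v w ∨ IsInnerArc (-u) (-v) (-w)

/-- The fan triangles: a chord of the outline and a shield point that sees it. -/
def IsFan (u v w : Plane) : Prop := IsChord v u ∧ IsShield w ∧ crs v u w < 0

/-- The triangles, listed from a chord of the outline. -/
def IsBase (u v w : Plane) : Prop := IsInner u v w ∨ IsFan u v w

/-- The triangles, in counterclockwise order. -/
def IsCell (u v w : Plane) : Prop := IsBase u v w ∨ IsBase v w u ∨ IsBase w u v

lemma IsInner.neg {u v w : Plane} (h : IsInner u v w) : IsInner (-u) (-v) (-w) := by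
  rcases h with h | h
  · right; simpa using h
  · left; exact h

lemma IsFan.neg {u v w : Plane} (h : IsFan u v w) : IsFan (-u) (-v) (-w) :=
  ⟨h.1.neg, h.2.1.neg, by rw [crs_neg]; exact h.2.2⟩

lemma IsFan.map_mirror {u v w : Plane} (h : IsFan u v w) :
    IsFan (mirror v) (mirror u) (mirror w) :=
  ⟨h.1.map_mirror, h.2.1.map_mirror, by rw [crs_mirror]; exact h.2.2⟩

lemma IsBase.neg {u v w : Plane} (h : IsBase u v w) : IsBase (-u) (-v) (-w) :=
  h.imp IsInner.neg IsFan.neg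

lemma IsCell.neg {u v w : Plane} (h : IsCell u v w) : IsCell (-u) (-v) (-w) :=
  h.imp IsBase.neg (Or.imp IsBase.neg IsBase.neg)

lemma IsCell.rotate {u v w : Plane} (h : IsCell u v w) : IsCell v w u := by
  rcases h with h | h | h
  · exact Or.inr (Or.inr h)
  · exact Or.inl h
  · exact Or.inr (Or.inl h)

lemma IsBase.cell {u v w : Plane} (h : IsBase u v w) : IsCell u v w := Or.inl h

/-- Up to `j = 622` the apex is the upper corner 783, giving a fan. Afterwards it is `1405 - j`, so
diagonals have index sum 1405 or 1406 and zigzag about 703. At `j = 702` the apex would coincide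
with the endpoint 703, hence the exclusion. -/
lemma isBase_cap {j : ℕ} (h : j < 783) (h' : j ≠ 702) :
    IsBase (capPt j) (capPt (j + 1)) (capPt (min 783 (1405 - j))) :=
  Or.inl (Or.inl (Or.inl ⟨j, h, h', rfl, rfl, rfl⟩))

lemma isBase_arc {j : ℕ} (h : j < 140) : IsBase (arcPt j) (arcPt (j + 1)) (capPt 0) :=
  Or.inl (Or.inl (Or.inr ⟨j, h, rfl, rfl, rfl⟩))

/-- A property of all base triangles. -/
lemma IsBase.cases {Q : Plane → Plane → Plane → Prop} (hneg : ∀ u v w, Q u v w → Q (-u) (-v) (-w))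
    (h1 : ∀ j < 783, j ≠ 702 → Q (capPt j) (capPt (j + 1)) (capPt (min 783 (1405 - j))))
    (h2 : ∀ j < 140, Q (arcPt j) (arcPt (j + 1)) (capPt 0))
    (h3 : ∀ u v w, IsFan u v w → Q u v w) {u v w : Plane} (h : IsBase u v w) : Q u v w := by
  have key : ∀ u v w, IsInnerArc u v w → Q u v w := by
    rintro u v w (⟨j, hj, hj', rfl, rfl, rfl⟩ | ⟨j, hj, rfl, rfl, rfl⟩)
    · exact h1 j hj hj'
    · exact h2 j hj
  rcases h with (h | h) | h
  · exact key u v w h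
  · have := hneg _ _ _ (key _ _ _ h)
    rwa [neg_neg, neg_neg, neg_neg] at this
  · exact h3 u v w h

lemma arcSide_capPt_zero {j : ℕ} (hj : j < 140) :
    arcSide (arcAngle j + eps / 2) (capPt 0) < 0 := by
  have h1 := arcMid_bounds hj
  have h2 := chi_gt
  have h3 := eps_pos
  rw [capPt_zero, arcSide_midPt]
  refine mul_neg_of_pos_of_neg rad_pos (sub_neg.2 ?_)
  rw [← Real.cos_neg (-chi - _)]
  exact Real.cos_lt_cos_of_nonneg_of_le_pi (by linarith) (by linarith) (by linarith)

lemma IsBase.crs_pos {u v w : Plane} (h : IsBase u v w) : 0 < crs u v w := by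
  refine IsBase.cases (Q := fun u v w => 0 < crs u v w) ?_ ?_ ?_ ?_ h
  · intro u v w h; rwa [crs_neg]
  · intro j hj hj'
    exact crs_capPt_pos hj (by omega) (by omega) (by omega)
  · intro j hj
    have := arcSide_capPt_zero hj
    have := mul_pos rad_pos sin_half_eps_pos
    rw [crs_arcPt]
    exact mul_pos_of_neg_of_neg (by linarith) (by assumption)
  · rintro u v w ⟨-, -, h⟩
    rw [crs_swap]; linarith

lemma IsCell.crs_pos {u v w : Plane} (h : IsCell u v w) : 0 < crs u v w := by
  rcases h with h | h | h
  · exact h.crs_pos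
  · rw [← crs_rotate]; exact h.crs_pos
  · rw [← crs_rotate, ← crs_rotate]; exact h.crs_pos

lemma pwMid_capPt_zero : pwMid (capPt 0) = 0 := by rw [capPt_zero, pwMid_midPt]

lemma IsChord.onOutline {u v : Plane} (h : IsChord u v) : OnOutline u ∧ OnOutline v := by
  refine IsChord.cases (Q := fun u v => OnOutline u ∧ OnOutline v) ?_ ?_ ?_ h
  · exact fun i hi => ⟨onOutline_capPt hi.le, onOutline_capPt hi⟩
  · exact fun i hi => ⟨onOutline_arcPt hi.le, onOutline_arcPt hi⟩
  · exact fun u v h => ⟨h.1.neg, h.2.neg⟩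

lemma IsBase.isSite {u v w : Plane} (h : IsBase u v w) : IsSite u ∧ IsSite v ∧ IsSite w := by
  refine IsBase.cases (Q := fun u v w => IsSite u ∧ IsSite v ∧ IsSite w) ?_ ?_ ?_ ?_ h
  · exact fun u v w h => ⟨h.1.neg, h.2.1.neg, h.2.2.neg⟩
  · exact fun j hj _ => ⟨Or.inl (onOutline_capPt hj.le), Or.inl (onOutline_capPt hj),
      Or.inl (onOutline_capPt (min_le_left _ _))⟩
  · exact fun j hj => ⟨Or.inl (onOutline_arcPt hj.le), Or.inl (onOutline_arcPt hj),
      Or.inl (onOutline_capPt (Nat.zero_le _))⟩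
  · exact fun u v w h => ⟨Or.inl h.1.onOutline.2, Or.inl h.1.onOutline.1, Or.inr h.2.1⟩

lemma IsBase.circle {u v w : Plane} (h : IsBase u v w) : ∃ z q, pw z q u = 0 ∧ pw z q v = 0 ∧
    pw z q w = 0 ∧ ∀ x, IsSite x → 0 ≤ pw z q x := by
  refine IsBase.cases (Q := fun u v w => ∃ z q, pw z q u = 0 ∧ pw z q v = 0 ∧
    pw z q w = 0 ∧ ∀ x, IsSite x → 0 ≤ pw z q x) ?_ ?_ ?_ ?_ h
  · rintro u v w ⟨z, q, hu, hv, hw, hx⟩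
    refine ⟨-z, q, by rwa [pw_neg], by rwa [pw_neg], by rwa [pw_neg], fun x hxs => ?_⟩
    rw [← pw_neg, neg_neg]; exact hx _ hxs.neg
  · exact fun j _ _ => ⟨rightCentre 0.58, 1, pwRight_unitPt _, pwRight_unitPt _, pwRight_unitPt _,
      fun x hx => pwRight_nonneg hx⟩
  · exact fun j _ => ⟨0, rad ^ 2, pwMid_midPt _, pwMid_midPt _, pwMid_capPt_zero,
      fun x hx => pwMid_nonneg hx⟩
  · rintro u v w ⟨h1, h2, h3⟩
    obtain ⟨z, q, hv, hu, hw, hx⟩ := fanEmpty h1 h2 h3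
    refine ⟨z, q, hu, hv, hw, fun x hxs => ?_⟩
    rcases hx x hxs with rfl | rfl | rfl | h
    · exact hv.ge
    · exact hu.ge
    · exact hw.ge
    · exact h.le

/-! ### Neighbours -/

/-- The edge `u v` is shared with a triangle on its right or lies on the boundary of the hull. -/
def IsCovered (u v : Plane) : Prop := (∃ w, IsCell v u w) ∨ ∀ x, IsSite x → 0 ≤ crs u v x

lemma IsCovered.neg {u v : Plane} (h : IsCovered u v) : IsCovered (-u) (-v) := by
  rcases h with ⟨w, h⟩ | h
  · exact Or.inl ⟨-w, h.neg⟩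
  · exact Or.inr fun x hx => by rw [← crs_neg, neg_neg, neg_neg]; exact h _ hx.neg

lemma IsBase.isCovered_mid {u v w : Plane} (h : IsBase u v w) {x y : Plane} (e : x = w)
    (e' : y = v) : IsCovered x y := by
  subst e e'; exact Or.inl ⟨u, h.cell.rotate⟩
lemma IsBase.isCovered_right {u v w : Plane} (h : IsBase u v w) {x y : Plane} (e : x = u)
    (e' : y = w) : IsCovered x y := by
  subst e e'; exact Or.inl ⟨v, h.cell.rotate.rotate⟩

lemma IsChord.isCovered {u v : Plane} (h : IsChord u v) : IsCovered u v := by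
  by_cases hs : ∀ s, IsShield s → 0 ≤ crs u v s
  · exact Or.inr fun x hx => crs_nonneg_of_unseen h hs hx
  · push Not at hs
    obtain ⟨s, hs, hneg⟩ := hs
    exact Or.inl ⟨s, Or.inl (Or.inr ⟨h, hs, hneg⟩)⟩

lemma IsChord.exists_cell {u v : Plane} (h : IsChord u v) : ∃ w, IsCell u v w := by
  refine IsChord.cases (Q := fun u v => ∃ w, IsCell u v w) ?_ ?_ ?_ h
  · intro i hi
    -- The chord from 702 to 703 has no triangle listed from it; it is a side of the last zigzag
    -- triangle, listed from `j = 703` with apex 702.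
    by_cases h' : i = 702
    · subst h'
      exact ⟨_, (isBase_cap (j := 703) (by norm_num) (by norm_num)).cell.rotate.rotate⟩
    · exact ⟨_, (isBase_cap hi h').cell⟩
  · exact fun j hj => ⟨_, (isBase_arc hj).cell⟩
  · exact fun u v ⟨w, h⟩ => ⟨-w, h.neg⟩

lemma IsBase.isCovered {u v w : Plane} (h : IsBase u v w) :
    IsCovered u v ∧ IsCovered v w ∧ IsCovered w u := by
  refine IsBase.cases (Q := fun u v w => IsCovered u v ∧ IsCovered v w ∧ IsCovered w u)
    ?_ ?_ ?_ ?_ h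
  · exact fun u v w h => ⟨h.1.neg, h.2.1.neg, h.2.2.neg⟩
  · intro j hj hj'
    refine ⟨(isChord_capPt hj).isCovered, ?_, ?_⟩
    · rcases Nat.lt_or_ge j 703 with h | h
      -- While the apex stays at 783 the next triangle is `j + 1`; in the zigzag it is the one based
      -- on the opposite chord, `1404 - j`.
      · rcases Nat.lt_or_ge j 622 with h2 | h2
        · refine (isBase_cap (j := j + 1) (by omega) (by omega)).isCovered_right rfl ?_
          congr 1; omega
        · rw [show min 783 (1405 - j) = 1405 - j by omega]
          refine (isBase_cap (j := 1404 - j) (by omega) (by omega)).isCovered_mid ?_ ?_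
          · congr 1; omega
          · congr 1; omega
      · rw [show min 783 (1405 - j) = 1405 - j by omega]
        refine (isBase_cap (j := 1404 - j) (by omega) (by omega)).isCovered_mid ?_ ?_
        · congr 1; omega
        · congr 1; omega
    · rcases Nat.lt_or_ge j 703 with h | h
      · rcases Nat.lt_or_ge j 623 with h2 | h2
        · rw [show min 783 (1405 - j) = 783 by omega]
          rcases Nat.eq_zero_or_pos j with rfl | hpos
          · rw [capPt_last]
            exact (isBase_arc (j := 0) (by norm_num)).isCovered_right rfl rfl
          · refine (isBase_cap (j := j - 1) (by omega) (by omega)).isCovered_mid ?_ ?_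
            · congr 1; omega
            · congr 1; omega
        · rw [show min 783 (1405 - j) = 1405 - j by omega]
          refine (isBase_cap (j := 1405 - j) (by omega) (by omega)).isCovered_right rfl ?_
          congr 1; omega
      · rw [show min 783 (1405 - j) = 1405 - j by omega]
        -- For `j = 703` this side is the outline chord from 702 to 703.
        rcases h.eq_or_lt with rfl | h
        · exact (isChord_capPt (i := 702) (by norm_num)).isCovered
        · refine (isBase_cap (j := 1405 - j) (by omega) (by omega)).isCovered_right rfl ?_
          congr 1; omega
  · intro j hj
    refine ⟨(isChord_arcPt hj).isCovered, ?_, ?_⟩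
    · rcases Nat.lt_or_ge (j + 1) 140 with h | h
      · exact (isBase_arc h).isCovered_right rfl rfl
      -- The last side of the upper fan is the diameter from `capPt 0` to `-capPt 0`, shared with
      -- the point-reflected fan.
      · rw [show j + 1 = 140 by omega]
        refine (isBase_arc (j := 139) (by norm_num)).neg.isCovered_mid ?_ ?_
        · exact arcPt_last
        · rw [arcPt_last, neg_neg]
    · rcases Nat.eq_zero_or_pos j with rfl | hpos
      · rw [← capPt_last]
        exact (isBase_cap (j := 0) (by norm_num) (by norm_num)).isCovered_right rfl rfl
      · refine (isBase_arc (j := j - 1) (by omega)).isCovered_mid rfl ?_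
        congr 1; omega
  · rintro u v w ⟨h1, h2, h3⟩
    obtain ⟨e1, e2⟩ := fanEdges h1 h2 h3
    refine ⟨Or.inl h1.exists_cell, ?_, ?_⟩
    · rcases e2 with ⟨x, hx, hxw⟩ | e2
      · exact IsBase.isCovered_right (u := v) (v := x) (w := w) (Or.inr ⟨hx, h2, hxw⟩) rfl rfl
      · exact Or.inr e2
    · rcases e1 with ⟨x, hx, hxw⟩ | e1
      · exact IsBase.isCovered_mid (u := x) (v := u) (w := w) (Or.inr ⟨hx, h2, hxw⟩) rfl rfl
      · exact Or.inr e1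

lemma IsCell.isCovered {u v w : Plane} (h : IsCell u v w) : IsCovered u v := by
  rcases h with h | h | h
  · exact h.isCovered.1
  · exact h.isCovered.2.2
  · exact h.isCovered.2.1

lemma isFan_shieldPt : IsFan (capPt 783) (capPt 782) shieldPt := by
  refine ⟨isChord_capPt (by norm_num), by simp [IsShield], (crs_capPt_neg_iff _ _).2 ?_⟩
  have h1 := capAngle_succ 782
  rw [capAngle_last] at h1
  exact capSide_shieldPt_pos (by linarith [psi_gt, del_lt]) (by linarith [del_pos])

lemma IsSite.exists_cell {x : Plane} (h : IsSite x) : ∃ v w, IsCell x v w := by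
  have hneg : ∀ x, (∃ v w, IsCell x v w) → ∃ v w, IsCell (-x) v w := fun x ⟨v, w, h⟩ =>
    ⟨-v, -w, h.neg⟩
  have hfan : ∀ {u v w}, IsFan u v w → ∃ a b, IsCell w a b := fun {u v w} h =>
    ⟨u, v, Or.inr (Or.inl (Or.inr h))⟩
  have h2 : ∀ i < 140, ∃ v w, IsCell (arcPt i) v w := fun i h =>
    ⟨_, (isChord_arcPt h).exists_cell⟩
  have h1 : ∀ i ≤ 783, ∃ v w, IsCell (capPt i) v w := fun i hi => by
    rcases hi.eq_or_lt with rfl | h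
    · rw [capPt_last]; exact h2 0 (by norm_num)
    · exact ⟨_, (isChord_capPt h).exists_cell⟩
  have h3 : ∀ i ≤ 140, ∃ v w, IsCell (arcPt i) v w := fun i hi => by
    rcases hi.eq_or_lt with rfl | h
    · rw [arcPt_last]; exact hneg _ (h1 0 (by norm_num))
    · exact h2 i h
  refine IsSite.cases (Q := fun x => ∃ v w, IsCell x v w) h1 h3 ?_ ?_ ?_ ?_ ?_ ?_ h
  · exact fun i hi => hneg _ (h1 i hi)
  · exact fun i hi => hneg _ (h3 i hi)
  · exact hfan isFan_shieldPt
  · exact hfan isFan_shieldPt.map_mirror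
  · exact hfan isFan_shieldPt.neg
  · exact hfan isFan_shieldPt.map_mirror.neg

/-! ### Intersections of triangles -/

/-- The convex hulls of `A` and `B` meet in the convex hull of their common points. -/
def MeetsWell (A B : Set Plane) : Prop :=
  convexHull ℝ A ∩ convexHull ℝ B ⊆ convexHull ℝ (A ∩ B)

lemma MeetsWell.symm {A B : Set Plane} (h : MeetsWell A B) : MeetsWell B A := by
  rw [MeetsWell, Set.inter_comm, Set.inter_comm B]; exact h

lemma meetsWell_self (A : Set Plane) : MeetsWell A A := by
  rw [MeetsWell, Set.inter_self, Set.inter_self]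

lemma MeetsWell.neg {A B : Set Plane} (h : MeetsWell A B) : MeetsWell (-A) (-B) := by
  rw [MeetsWell, convexHull_neg, convexHull_neg, ← Set.inter_neg, ← Set.inter_neg, convexHull_neg]
  exact Set.neg_subset_neg.2 h

lemma neg_triple (u v w : Plane) : ({-u, -v, -w} : Set Plane) = -{u, v, w} := by
  ext x
  simp only [Set.mem_insert_iff, Set.mem_singleton_iff, Set.mem_neg]
  rw [eq_comm, neg_eq_iff_eq_neg, eq_comm (b := -v), neg_eq_iff_eq_neg (b := x),
    eq_comm (b := -w), neg_eq_iff_eq_neg (b := x)]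
  constructor <;> rintro (h | h | h) <;> simp [h]

lemma meetsWell_of_line {u v w u' v' w' e₁ e₂ : Plane} (a b c : ℝ)
    (hA : ∀ x ∈ ({u, v, w} : Set Plane), 0 ≤ a * x 0 + b * x 1 + c ∧
      (a * x 0 + b * x 1 + c = 0 → x = e₁ ∨ x = e₂))
    (hB : ∀ x ∈ ({u', v', w'} : Set Plane), a * x 0 + b * x 1 + c ≤ 0 ∧
      (a * x 0 + b * x 1 + c = 0 → x = e₁ ∨ x = e₂)) :
    MeetsWell {u, v, w} {u', v', w'} := by
  have := convexHull_inter_subset_of_line (A := {u, v, w}) (B := {u', v', w'}) (e₁ := e₁)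
    (e₂ := e₂) a b c (fun x hx => (hA x (by simpa using hx)).1)
    (fun x hx => (hB x (by simpa using hx)).1) (fun x hx => (hA x (by simpa using hx)).2)
    (fun x hx => (hB x (by simpa using hx)).2)
  simpa [MeetsWell] using this

lemma meetsWell_of_crs {u v w u' v' w' e₁ e₂ : Plane}
    (hA : ∀ x ∈ ({u, v, w} : Set Plane), 0 ≤ crs e₁ e₂ x ∧ (crs e₁ e₂ x = 0 → x = e₁ ∨ x = e₂))
    (hB : ∀ x ∈ ({u', v', w'} : Set Plane), crs e₁ e₂ x ≤ 0 ∧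
      (crs e₁ e₂ x = 0 → x = e₁ ∨ x = e₂)) :
    MeetsWell {u, v, w} {u', v', w'} := by
  refine meetsWell_of_line (-(e₂ 1 - e₁ 1)) (e₂ 0 - e₁ 0)
    ((e₂ 1 - e₁ 1) * e₁ 0 - (e₂ 0 - e₁ 0) * e₁ 1) (e₁ := e₁) (e₂ := e₂) ?_ ?_
  · intro x hx; rw [← crs_eq_affine]; exact hA x hx
  · intro x hx; rw [← crs_eq_affine]; exact hB x hx

/-- A fan circle passes through no site other than its three vertices, so the radical-axis argument
handles a fan triangle against any other triangle at once. -/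
lemma meetsWell_fan {u v w u' v' w' : Plane} (h : IsBase u v w) (h' : IsFan u' v' w') :
    MeetsWell {u, v, w} {u', v', w'} := by
  obtain ⟨z, q, hu, hv, hw, hx⟩ := h.circle
  obtain ⟨z', q', hv', hu', hw', hx'⟩ := fanEmpty h'.1 h'.2.1 h'.2.2
  obtain ⟨su, sv, sw⟩ := h.isSite
  obtain ⟨su', sv', sw'⟩ := IsBase.isSite (Or.inr h')
  have key : ∀ x, IsSite x → 0 ≤ pw z' q' x ∧
      (pw z' q' x = 0 → x ∈ ({u', v', w'} : Finset Plane)) := by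
    intro x hxs
    rcases hx' x hxs with rfl | rfl | rfl | h
    · exact ⟨hv'.ge, fun _ => by simp⟩
    · exact ⟨hu'.ge, fun _ => by simp⟩
    · exact ⟨hw'.ge, fun _ => by simp⟩
    · exact ⟨h.le, fun h0 => absurd h0 h.ne'⟩
  have hsite : ∀ x ∈ ({u, v, w} : Finset Plane), IsSite x ∧ pw z q x = 0 := by
    intro x hx
    simp only [Finset.mem_insert, Finset.mem_singleton] at hx
    rcases hx with rfl | rfl | rfl
    exacts [⟨su, hu⟩, ⟨sv, hv⟩, ⟨sw, hw⟩]
  have hsite' : ∀ x ∈ ({u', v', w'} : Finset Plane), IsSite x ∧ pw z' q' x = 0 := by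
    intro x hx
    simp only [Finset.mem_insert, Finset.mem_singleton] at hx
    rcases hx with rfl | rfl | rfl
    exacts [⟨su', hu'⟩, ⟨sv', hv'⟩, ⟨sw', hw'⟩]
  have := convexHull_inter_subset_of_empty_circles (A := {u, v, w}) (B := {u', v', w'})
    (fun x hx => (hsite x hx).2) (fun x hx => (hsite' x hx).2)
    (fun x hx => (key x (hsite x hx).1).1) (fun y hy => hx y (hsite' y hy).1)
    (fun x hx => (key x (hsite x hx).1).2)
  simpa [MeetsWell] using this

/-! #### Abscissas -/

lemma capPt_abscissa {i : ℕ} (hi : i ≤ 783) : 40821049 / 58000000 ≤ capPt i 0 ∧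
    (capPt i 0 = 40821049 / 58000000 → capPt i = capPt 0 ∨ capPt i = capPt 783) := by
  have h0 : capPt i 0 = 0.29 + Real.cos (capAngle i) := rfl
  have h1 := cos_psi_le_cos (abs_capAngle_le hi)
  rw [h0]
  refine ⟨by linarith, fun h => ?_⟩
  by_contra! hne
  have i0 : 0 < i := Nat.pos_of_ne_zero fun h => hne.1 (by rw [h])
  have i1 : i < 783 := lt_of_le_of_ne hi fun h => hne.2 (by rw [h])
  have a0 := capAngle_strictMono i0
  have a1 := capAngle_strictMono i1
  rw [capAngle_zero] at a0
  rw [capAngle_last] at a1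
  have : Real.cos psi < Real.cos (capAngle i) := by
    rw [← Real.cos_abs (capAngle i)]
    exact Real.cos_lt_cos_of_nonneg_of_le_pi (abs_nonneg _) (by linarith [psi_lt, Real.pi_gt_three])
      (abs_lt.2 ⟨a0, a1⟩)
  rw [cos_psi] at this
  linarith

lemma capPt_zero_abscissa : capPt 0 0 = 40821049 / 58000000 := by
  rw [capPt_zero, midPt_zero, Real.cos_neg, rad_mul_cos_chi]

lemma arcPt_abscissa {j : ℕ} (hj : j ≤ 140) :
    (arcPt j 0 ≤ 40821049 / 58000000 ∧ (arcPt j 0 = 40821049 / 58000000 → arcPt j = capPt 783)) ∧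
    (-(40821049 / 58000000) ≤ arcPt j 0 ∧
      (arcPt j 0 = -(40821049 / 58000000) → -arcPt j = capPt 0)) := by
  have h0 : arcPt j 0 = rad * Real.cos (arcAngle j) := rfl
  have h1 := arcAngle_ge j
  have h2 := arcAngle_le hj
  have h3 := chi_gt
  rw [h0, ← rad_mul_cos_chi]
  have hc := cos_arcAngle_le h1 h2
  refine ⟨⟨mul_le_mul_of_nonneg_left hc.1 rad_pos.le, fun h => ?_⟩, ⟨?_, fun h => ?_⟩⟩
  · have h := mul_left_cancel₀ rad_pos.ne' h
    have := Real.injOn_cos ⟨by linarith, by linarith⟩ ⟨by linarith, by linarith⟩ h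
    rw [capPt_last, arcPt, arcPt, this, arcAngle_zero]
  · rw [← mul_neg]; exact mul_le_mul_of_nonneg_left hc.2 rad_pos.le
  · rw [← mul_neg, ← Real.cos_pi_sub] at h
    have h := mul_left_cancel₀ rad_pos.ne' h
    have := Real.injOn_cos ⟨by linarith, by linarith⟩ ⟨by linarith, by linarith⟩ h
    rw [neg_eq_iff_eq_neg, ← arcPt_last, arcPt, arcPt, this, arcAngle_last]

/-! #### Triangles in the same circle -/

/-- The side of the chord from `a` to `b` depends on whether the angular distance from its mid
direction is below or above the half-angle `d`. So position relative to a chord is read off from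
indices. -/
lemma crs_capPt_capPt {a b k : ℕ} (hab : a < b) (hb : b ≤ 783) (hk : k ≤ 783) :
    (a ≤ k → k ≤ b → crs (capPt a) (capPt b) (capPt k) ≤ 0) ∧
    (k ≤ a ∨ b ≤ k → 0 ≤ crs (capPt a) (capPt b) (capPt k)) ∧
    (crs (capPt a) (capPt b) (capPt k) = 0 → capPt k = capPt a ∨ capPt k = capPt b) := by
  set v := (capAngle a + capAngle b) / 2 with hv
  set d := (capAngle b - capAngle a) / 2 with hd
  have ea : capAngle a = v - d := by rw [hv, hd]; ring
  have eb : capAngle b = v + d := by rw [hv, hd]; ring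
  have hlt := capAngle_strictMono hab
  have hd0 : 0 < d := by rw [hd]; linarith
  have ga := capAngle_ge a
  have lb := capAngle_le hb
  have gk := capAngle_ge k
  have lk := capAngle_le hk
  have hψ := psi_lt
  have hpi := Real.pi_gt_three
  have hdpi : d ≤ Real.pi := by linarith
  have hs : 0 < Real.sin d := Real.sin_pos_of_pos_of_lt_pi hd0 (by linarith)
  have e : crs (capPt a) (capPt b) (capPt k)
      = 2 * Real.sin d * (Real.cos d - Real.cos (capAngle k - v)) := by
    rw [capPt, capPt, ea, eb, crs_unitPt, capPt, unitPt_zero, unitPt_one, Real.cos_sub]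
    ring
  have habs : |capAngle k - v| ≤ Real.pi := abs_le.2 ⟨by linarith, by linarith⟩
  rw [e]
  refine ⟨fun h1 h2 => ?_, fun h => ?_, fun h => ?_⟩
  · have h1 := capAngle_strictMono.monotone h1
    have h2 := capAngle_strictMono.monotone h2
    have : Real.cos d ≤ Real.cos (capAngle k - v) :=
      cos_le_cos_of_abs_le (abs_le.2 ⟨by linarith, by linarith⟩) hdpi
    exact mul_nonpos_of_nonneg_of_nonpos (by positivity) (by linarith)
  · have : Real.cos (capAngle k - v) ≤ Real.cos d := by
      rw [← Real.cos_abs (_ - _)]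
      refine Real.cos_le_cos_of_nonneg_of_le_pi hd0.le habs ?_
      rcases h with h | h
      · have h := capAngle_strictMono.monotone h
        rw [le_abs]; right; linarith
      · have h := capAngle_strictMono.monotone h
        rw [le_abs]; left; linarith
    exact mul_nonneg (by positivity) (by linarith)
  · have h1 : Real.cos d = Real.cos |capAngle k - v| := by
      rw [Real.cos_abs]
      have := (mul_eq_zero.1 h).resolve_left (by positivity)
      linarith
    have h2 := Real.injOn_cos ⟨hd0.le, hdpi⟩ ⟨abs_nonneg _, habs⟩ h1
    rcases abs_cases (capAngle k - v) with ⟨h3, -⟩ | ⟨h3, -⟩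
    · right
      rw [capPt, capPt]; congr 1; linarith
    · left
      rw [capPt, capPt]; congr 1; linarith

/-- The chord from `a` to `b` separates the triangles: one has all indices outside the open span,
the other all inside the closed span. -/
lemma meetsWell_cap_nested {j k a b : ℕ} (hj : j < 783) (hk : k < 783) (hab : a < b)
    (hb : b ≤ 783) (h1 : j ≤ a ∨ b ≤ j) (h2 : j + 1 ≤ a ∨ b ≤ j + 1)
    (h3 : min 783 (1405 - j) ≤ a ∨ b ≤ min 783 (1405 - j)) (h4 : a ≤ k) (h5 : k + 1 ≤ b)
    (h6 : a ≤ min 783 (1405 - k)) (h7 : min 783 (1405 - k) ≤ b) :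
    MeetsWell {capPt j, capPt (j + 1), capPt (min 783 (1405 - j))}
      {capPt k, capPt (k + 1), capPt (min 783 (1405 - k))} := by
  refine meetsWell_of_crs (e₁ := capPt a) (e₂ := capPt b) ?_ ?_
  · rintro x (rfl | rfl | rfl)
    · have := crs_capPt_capPt hab hb hj.le; exact ⟨this.2.1 h1, this.2.2⟩
    · have := crs_capPt_capPt hab hb hj; exact ⟨this.2.1 h2, this.2.2⟩
    · have := crs_capPt_capPt hab hb (min_le_left 783 (1405 - j)); exact ⟨this.2.1 h3, this.2.2⟩
  · rintro x (rfl | rfl | rfl)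
    · have := crs_capPt_capPt hab hb hk.le; exact ⟨this.1 h4 (by omega), this.2.2⟩
    · have := crs_capPt_capPt hab hb hk; exact ⟨this.1 (by omega) h5, this.2.2⟩
    · have := crs_capPt_capPt hab hb (min_le_left 783 (1405 - k)); exact ⟨this.1 h6 h7, this.2.2⟩

/-- The spans of the triangles in the right unit circle are nested. -/
lemma meetsWell_cap {j k : ℕ} (hj : j < 783) (hj' : j ≠ 702) (hk : k < 783) (hk' : k ≠ 702) :
    MeetsWell {capPt j, capPt (j + 1), capPt (min 783 (1405 - j))}
      {capPt k, capPt (k + 1), capPt (min 783 (1405 - k))} := by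
  have key : ∀ {j k : ℕ}, j < 783 → j ≠ 702 → k < 783 → k ≠ 702 →
      (if j < 702 then j < k ∧ k + 1 ≤ min 783 (1405 - j) ∧ min 783 (1405 - k) ≤ min 783 (1405 - j)
        ∧ j < min 783 (1405 - k)
        else 1405 - j ≤ k ∧ k < j ∧ 1405 - j ≤ min 783 (1405 - k) ∧ min 783 (1405 - k) ≤ j) →
      MeetsWell {capPt j, capPt (j + 1), capPt (min 783 (1405 - j))}
        {capPt k, capPt (k + 1), capPt (min 783 (1405 - k))} := by
    intro j k hj hj' hk hk' h
    split_ifs at h with h0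
    -- In the lower branch the separating chord is the side from `j + 1` to the apex; in the upper
    -- branch it is the side from the apex `1405 - j` to `j`. All triangles nested inside lie beyond
    -- it.
    · exact meetsWell_cap_nested (a := j + 1) (b := min 783 (1405 - j)) hj hk (by omega) (by omega)
        (by omega) (by omega) (by omega) (by omega) (by omega) (by omega) (by omega)
    · exact meetsWell_cap_nested (a := 1405 - j) (b := j) hj hk (by omega) (by omega)
        (by omega) (by omega) (by omega) (by omega) (by omega) (by omega) (by omega)
  rcases eq_or_ne j k with rfl | hne
  · exact meetsWell_self _
  by_cases h : (if j < 702 then j < k ∧ k + 1 ≤ min 783 (1405 - j) ∧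
      min 783 (1405 - k) ≤ min 783 (1405 - j) ∧ j < min 783 (1405 - k)
      else 1405 - j ≤ k ∧ k < j ∧ 1405 - j ≤ min 783 (1405 - k) ∧ min 783 (1405 - k) ≤ j)
  · exact key hj hj' hk hk' h
  · refine (key hk hk' hj hj' ?_).symm
    split_ifs at h ⊢ <;> omega

lemma crs_capPt_zero_arcPt {a k : ℕ} (ha : a ≤ 140) (hk : k ≤ 140) :
    (k ≤ a → crs (capPt 0) (arcPt a) (arcPt k) ≤ 0) ∧
    (a ≤ k → 0 ≤ crs (capPt 0) (arcPt a) (arcPt k)) ∧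
    (crs (capPt 0) (arcPt a) (arcPt k) = 0 → arcPt k = arcPt a) := by
  set v := (-chi + arcAngle a) / 2 with hv
  set d := (arcAngle a + chi) / 2 with hd
  have ea : -chi = v - d := by rw [hv, hd]; ring
  have eb : arcAngle a = v + d := by rw [hv, hd]; ring
  have hχ := chi_gt
  have ga := arcAngle_ge a
  have la := arcAngle_le ha
  have gk := arcAngle_ge k
  have lk := arcAngle_le hk
  have hd0 : 0 < d := by rw [hd]; linarith
  have hdpi : d ≤ Real.pi := by linarith
  have hs : 0 < Real.sin d := Real.sin_pos_of_pos_of_lt_pi hd0 (by linarith)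
  have hr := rad_pos
  have e : crs (capPt 0) (arcPt a) (arcPt k)
      = 2 * rad ^ 2 * Real.sin d * (Real.cos d - Real.cos (arcAngle k - v)) := by
    rw [capPt_zero, arcPt, ea, eb, crs_midPt, arcPt, midPt_zero, midPt_one, Real.cos_sub]
    ring
  have habs : |arcAngle k - v| ≤ Real.pi := abs_le.2 ⟨by linarith, by linarith⟩
  rw [e]
  refine ⟨fun h => ?_, fun h => ?_, fun h => ?_⟩
  · have h := arcAngle_strictMono.monotone h
    have : Real.cos d ≤ Real.cos (arcAngle k - v) :=
      cos_le_cos_of_abs_le (abs_le.2 ⟨by linarith, by linarith⟩) hdpi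
    exact mul_nonpos_of_nonneg_of_nonpos (by positivity) (by linarith)
  · have h := arcAngle_strictMono.monotone h
    have : Real.cos (arcAngle k - v) ≤ Real.cos d :=
      Real.cos_le_cos_of_nonneg_of_le_pi hd0.le (le_of_abs_le habs) (by linarith)
    exact mul_nonneg (by positivity) (by linarith)
  · have h1 : Real.cos d = Real.cos |arcAngle k - v| := by
      rw [Real.cos_abs]
      have := (mul_eq_zero.1 h).resolve_left (by positivity)
      linarith
    have h2 := Real.injOn_cos ⟨hd0.le, hdpi⟩ ⟨abs_nonneg _, habs⟩ h1
    rcases abs_cases (arcAngle k - v) with ⟨h3, -⟩ | ⟨h3, -⟩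
    · rw [arcPt, arcPt]; congr 1; linarith
    · linarith

lemma meetsWell_arc {j k : ℕ} (hj : j < 140) (hk : k < 140) :
    MeetsWell {arcPt j, arcPt (j + 1), capPt 0} {arcPt k, arcPt (k + 1), capPt 0} := by
  have key : ∀ {j k : ℕ}, j < k → k < 140 →
      MeetsWell {arcPt k, arcPt (k + 1), capPt 0} {arcPt j, arcPt (j + 1), capPt 0} := by
    intro j k hjk hk
    have hz : crs (capPt 0) (arcPt (j + 1)) (capPt 0) = 0 := by simp only [crs]; ring
    have c := fun {i : ℕ} (hi : i ≤ 140) => crs_capPt_zero_arcPt (a := j + 1) (k := i) (by omega) hi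
    refine meetsWell_of_crs (e₁ := capPt 0) (e₂ := arcPt (j + 1)) ?_ ?_
    · rintro x (rfl | rfl | rfl)
      · exact ⟨(c hk.le).2.1 (by omega), fun h => Or.inr ((c hk.le).2.2 h)⟩
      · exact ⟨(c hk).2.1 (by omega), fun h => Or.inr ((c hk).2.2 h)⟩
      · exact ⟨hz.ge, fun _ => Or.inl rfl⟩
    · rintro x (rfl | rfl | rfl)
      · exact ⟨(c (by omega)).1 (by omega), fun h => Or.inr ((c (by omega)).2.2 h)⟩
      · exact ⟨(c (by omega)).1 (by omega), fun h => Or.inr ((c (by omega)).2.2 h)⟩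
      · exact ⟨hz.le, fun _ => Or.inl rfl⟩
  rcases lt_trichotomy j k with h | rfl | h
  · exact (key h hk).symm
  · exact meetsWell_self _
  · exact key h hj

/-- The diameter through `capPt 0` separates the two halves of the middle polygon, since point
reflection exchanges its sides. -/
lemma meetsWell_arc_neg {j k : ℕ} (hj : j < 140) (hk : k < 140) :
    MeetsWell {arcPt j, arcPt (j + 1), capPt 0} {-arcPt k, -arcPt (k + 1), -capPt 0} := by
  have hz : crs (capPt 0) (arcPt 140) (capPt 0) = 0 := by simp only [crs]; ring
  have hz' : crs (capPt 0) (arcPt 140) (-capPt 0) = 0 := by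
    rw [← arcPt_last]; simp only [crs]; ring
  have c := fun {i : ℕ} (hi : i ≤ 140) => crs_capPt_zero_arcPt (a := 140) (k := i) le_rfl hi
  have hn : ∀ x, crs (capPt 0) (arcPt 140) (-x) = -crs (capPt 0) (arcPt 140) x := by
    intro x
    rw [arcPt_last]; simp only [crs, PiLp.neg_apply]; ring
  refine (meetsWell_of_crs (e₁ := capPt 0) (e₂ := arcPt 140) ?_ ?_).symm
  · rintro x (rfl | rfl | rfl)
    · rw [hn]
      refine ⟨neg_nonneg.2 ((c hk.le).1 hk.le), fun h => Or.inl ?_⟩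
      rw [(c hk.le).2.2 (neg_eq_zero.1 h), arcPt_last, neg_neg]
    · rw [hn]
      refine ⟨neg_nonneg.2 ((c hk).1 hk), fun h => Or.inl ?_⟩
      rw [(c hk).2.2 (neg_eq_zero.1 h), arcPt_last, neg_neg]
    · exact ⟨hz'.ge, fun _ => Or.inr arcPt_last.symm⟩
  · rintro x (rfl | rfl | rfl)
    · exact ⟨(c hj.le).1 hj.le, fun h => Or.inr ((c hj.le).2.2 h)⟩
    · exact ⟨(c hj).1 hj, fun h => Or.inr ((c hj).2.2 h)⟩
    · exact ⟨hz.le, fun _ => Or.inl rfl⟩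

/-! #### Triangles in different circles -/

/-- The separating line is vertical through the two right corners, the radical axis of the right and
middle circles. -/
lemma meetsWell_cap_of_abscissa {j : ℕ} (hj : j < 783) {u v w : Plane}
    (h : ∀ x ∈ ({u, v, w} : Set Plane), x 0 ≤ 40821049 / 58000000 ∧
      (x 0 = 40821049 / 58000000 → x = capPt 0 ∨ x = capPt 783)) :
    MeetsWell {capPt j, capPt (j + 1), capPt (min 783 (1405 - j))} {u, v, w} := by
  have c : ∀ i ≤ 783, 0 ≤ 1 * capPt i 0 + 0 * capPt i 1 + -(40821049 / 58000000) ∧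
      (1 * capPt i 0 + 0 * capPt i 1 + -(40821049 / 58000000) = 0 →
        capPt i = capPt 0 ∨ capPt i = capPt 783) := by
    intro i hi
    have := capPt_abscissa hi
    exact ⟨by linarith, fun h => this.2 (by linarith)⟩
  refine meetsWell_of_line 1 0 (-(40821049 / 58000000)) (e₁ := capPt 0) (e₂ := capPt 783) ?_ ?_
  · rintro x (rfl | rfl | rfl)
    · exact c _ hj.le
    · exact c _ hj
    · exact c _ (min_le_left _ _)
  · intro x hx
    have := h x hx
    exact ⟨by linarith, fun h => this.2 (by linarith)⟩

lemma meetsWell_cap_arc {j k : ℕ} (hj : j < 783) (hk : k < 140) :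
    MeetsWell {capPt j, capPt (j + 1), capPt (min 783 (1405 - j))}
      {arcPt k, arcPt (k + 1), capPt 0} := by
  refine meetsWell_cap_of_abscissa hj ?_
  rintro x (rfl | rfl | rfl)
  · have := (arcPt_abscissa hk.le).1; exact ⟨this.1, fun h => Or.inr (this.2 h)⟩
  · have := (arcPt_abscissa hk).1; exact ⟨this.1, fun h => Or.inr (this.2 h)⟩
  · exact ⟨capPt_zero_abscissa.le, fun _ => Or.inl rfl⟩

lemma meetsWell_cap_neg_arc {j k : ℕ} (hj : j < 783) (hk : k < 140) :
    MeetsWell {capPt j, capPt (j + 1), capPt (min 783 (1405 - j))}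
      {-arcPt k, -arcPt (k + 1), -capPt 0} := by
  refine meetsWell_cap_of_abscissa hj ?_
  rintro x (rfl | rfl | rfl)
  · have := (arcPt_abscissa hk.le).2
    rw [PiLp.neg_apply]
    exact ⟨by linarith, fun h => Or.inl (this.2 (by linarith))⟩
  · have := (arcPt_abscissa hk).2
    rw [PiLp.neg_apply]
    exact ⟨by linarith, fun h => Or.inl (this.2 (by linarith))⟩
  · rw [PiLp.neg_apply, capPt_zero_abscissa]
    exact ⟨by norm_num, fun h => by norm_num at h⟩

lemma meetsWell_cap_neg_cap {j k : ℕ} (hj : j < 783) (hk : k < 783) :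
    MeetsWell {capPt j, capPt (j + 1), capPt (min 783 (1405 - j))}
      {-capPt k, -capPt (k + 1), -capPt (min 783 (1405 - k))} := by
  have c : ∀ i ≤ 783, (-capPt i : Plane) 0 ≤ 40821049 / 58000000 ∧
      ((-capPt i : Plane) 0 = 40821049 / 58000000 → -capPt i = capPt 0 ∨ -capPt i = capPt 783) := by
    intro i hi
    have := (capPt_abscissa hi).1
    rw [PiLp.neg_apply]
    exact ⟨by linarith, fun h => by linarith⟩
  refine meetsWell_cap_of_abscissa hj ?_
  rintro x (rfl | rfl | rfl)
  · exact c _ hk.le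
  · exact c _ hk
  · exact c _ (min_le_left _ _)

lemma meetsWell_innerArc {u v w u' v' w' : Plane} (h : IsInnerArc u v w)
    (h' : IsInnerArc u' v' w') : MeetsWell {u, v, w} {u', v', w'} := by
  rcases h with ⟨j, hj, hj', rfl, rfl, rfl⟩ | ⟨j, hj, rfl, rfl, rfl⟩ <;>
  rcases h' with ⟨k, hk, hk', rfl, rfl, rfl⟩ | ⟨k, hk, rfl, rfl, rfl⟩
  · exact meetsWell_cap hj hj' hk hk'
  · exact meetsWell_cap_arc hj hk
  · exact (meetsWell_cap_arc hk hj).symm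
  · exact meetsWell_arc hj hk

lemma meetsWell_innerArc_neg {u v w u' v' w' : Plane} (h : IsInnerArc u v w)
    (h' : IsInnerArc u' v' w') : MeetsWell {u, v, w} {-u', -v', -w'} := by
  rcases h with ⟨j, hj, hj', rfl, rfl, rfl⟩ | ⟨j, hj, rfl, rfl, rfl⟩ <;>
  rcases h' with ⟨k, hk, hk', rfl, rfl, rfl⟩ | ⟨k, hk, rfl, rfl, rfl⟩
  · exact meetsWell_cap_neg_cap hj hk
  · exact meetsWell_cap_neg_arc hj hk
  · have := (meetsWell_cap_neg_arc hk hj).symm.neg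
    rw [← neg_triple, ← neg_triple] at this
    simpa only [neg_neg] using this
  · exact meetsWell_arc_neg hj hk

lemma IsBase.meetsWell {u v w u' v' w' : Plane} (h : IsBase u v w) (h' : IsBase u' v' w') :
    MeetsWell {u, v, w} {u', v', w'} := by
  rcases h' with h' | h'
  swap
  · exact meetsWell_fan h h'
  rcases h with h | h
  swap
  · exact (meetsWell_fan (Or.inl h') h).symm
  rcases h with h | h <;> rcases h' with h' | h'
  · exact meetsWell_innerArc h h'
  · have := meetsWell_innerArc_neg h h'
    simpa only [neg_neg] using this
  · have := (meetsWell_innerArc_neg h' h).symm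
    simpa only [neg_neg] using this
  · have := (meetsWell_innerArc h h').neg
    rw [← neg_triple, ← neg_triple] at this
    simpa only [neg_neg] using this

lemma IsCell.exists_base {u v w : Plane} (h : IsCell u v w) :
    ∃ a b c, IsBase a b c ∧ ({u, v, w} : Set Plane) = {a, b, c} := by
  rcases h with h | h | h
  · exact ⟨_, _, _, h, rfl⟩
  · exact ⟨_, _, _, h, (triangle_rotate _ _ _).symm⟩
  · exact ⟨_, _, _, h, by rw [triangle_rotate]⟩

lemma IsCell.meetsWell {u v w u' v' w' : Plane} (h : IsCell u v w) (h' : IsCell u' v' w') :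
    MeetsWell {u, v, w} {u', v', w'} := by
  obtain ⟨a, b, c, hb, e⟩ := h.exists_base
  obtain ⟨a', b', c', hb', e'⟩ := h'.exists_base
  rw [e, e']
  exact hb.meetsWell hb'

/-! ### The triangulation -/

open Classical in
/-- The set of sites. -/
noncomputable def sites : Finset Plane :=
  (Finset.range 784).image capPt ∪ (Finset.range 141).image arcPt ∪
    (Finset.range 784).image (fun i => -capPt i) ∪ (Finset.range 141).image (fun j => -arcPt j) ∪
    {shieldPt, mirror shieldPt, -shieldPt, -mirror shieldPt}

lemma mem_sites {x : Plane} : x ∈ sites ↔ IsSite x := by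
  classical
  simp only [sites, Finset.mem_union, Finset.mem_image, Finset.mem_range, Finset.mem_insert,
    Finset.mem_singleton, IsSite, OnOutline, OnArc, IsShield, Nat.lt_succ_iff,
    neg_eq_iff_eq_neg (a := x), eq_comm (b := x)]
  constructor
  · rintro ((((⟨i, hi, h⟩ | ⟨i, hi, h⟩) | ⟨i, hi, h⟩) | ⟨i, hi, h⟩) | h)
    · exact Or.inl (Or.inl (Or.inl ⟨i, hi, h⟩))
    · exact Or.inl (Or.inl (Or.inr ⟨i, hi, h⟩))
    · exact Or.inl (Or.inr (Or.inl ⟨i, hi, h.symm ▸ rfl⟩))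
    · exact Or.inl (Or.inr (Or.inr ⟨i, hi, h.symm ▸ rfl⟩))
    · exact Or.inr h
  · rintro (((⟨i, hi, h⟩ | ⟨i, hi, h⟩) | (⟨i, hi, h⟩ | ⟨i, hi, h⟩)) | h)
    · exact Or.inl (Or.inl (Or.inl (Or.inl ⟨i, hi, h⟩)))
    · exact Or.inl (Or.inl (Or.inl (Or.inr ⟨i, hi, h⟩)))
    · exact Or.inl (Or.inl (Or.inr ⟨i, hi, by rw [h]⟩))
    · exact Or.inl (Or.inr ⟨i, hi, by rw [h]⟩)
    · exact Or.inr h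

lemma IsCell.isSite {u v w : Plane} (h : IsCell u v w) : IsSite u := by
  rcases h with h | h | h
  · exact h.isSite.1
  · exact h.isSite.2.2
  · exact h.isSite.2.1

lemma delaunayCells : DelaunayCells sites IsCell where
  nonempty := ⟨shieldPt, mem_sites.2 (Or.inr (Or.inl rfl))⟩
  rotate := IsCell.rotate
  crs_pos := IsCell.crs_pos
  mem h := mem_sites.2 h.isSite
  exists_cell x hx := (mem_sites.1 hx).exists_cell
  neighbour h := h.isCovered.imp_right fun h x hx => h x (mem_sites.1 hx)
  inter h h' := h.meetsWell h'
  circle := by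
    intro u v w h
    rcases h with h | h | h
    · obtain ⟨z, q, h1, h2, h3, h4⟩ := h.circle
      exact ⟨z, q, h1, h2, h3, fun x hx => h4 x (mem_sites.1 hx)⟩
    · obtain ⟨z, q, h1, h2, h3, h4⟩ := h.circle
      exact ⟨z, q, h3, h1, h2, fun x hx => h4 x (mem_sites.1 hx)⟩
    · obtain ⟨z, q, h1, h2, h3, h4⟩ := h.circle
      exact ⟨z, q, h2, h3, h1, fun x hx => h4 x (mem_sites.1 hx)⟩

/-! ### Lengths of edges -/

/-- The length of the chords of the unit circles. -/
noncomputable def capLen : ℝ := 2 * Real.sin (del / 2)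

/-- The length of the chords of the middle circle. -/
noncomputable def arcLen : ℝ := 2 * (rad * Real.sin (eps / 2))

lemma capLen_pos : 0 < capLen := mul_pos two_pos sin_half_del_pos
lemma arcLen_pos : 0 < arcLen := mul_pos two_pos (mul_pos rad_pos sin_half_eps_pos)

lemma capLen_le : capLen ≤ del := by
  have := Real.sin_le (x := del / 2) (by linarith [del_pos])
  rw [capLen]; linarith

lemma arcLen_le : arcLen ≤ rad * eps := by
  have := mul_le_mul_of_nonneg_left (Real.sin_le (x := eps / 2) (by linarith [eps_pos])) rad_pos.le
  rw [arcLen]; linarith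

lemma dist_unitPt (a b : ℝ) : dist (unitPt a) (unitPt b) = 2 * |Real.sin ((a - b) / 2)| := by
  refine (sq_eq_sq₀ dist_nonneg (by positivity)).1 ?_
  have h := Real.cos_sq' ((a - b) / 2)
  rw [Real.cos_sq, mul_div_cancel₀ _ two_ne_zero, Real.cos_sub] at h
  rw [dist_sq_plane, mul_pow, sq_abs]
  simp only [unitPt_zero, unitPt_one]
  linear_combination Real.sin_sq_add_cos_sq a + Real.sin_sq_add_cos_sq b - 4 * h

lemma dist_midPt (a b : ℝ) : dist (midPt a) (midPt b) = 2 * rad * |Real.sin ((a - b) / 2)| := by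
  have := rad_pos
  refine (sq_eq_sq₀ dist_nonneg (by positivity)).1 ?_
  have h := Real.cos_sq' ((a - b) / 2)
  rw [Real.cos_sq, mul_div_cancel₀ _ two_ne_zero, Real.cos_sub] at h
  rw [dist_sq_plane, mul_pow, sq_abs]
  simp only [midPt_zero, midPt_one]
  linear_combination
    rad ^ 2 * (Real.sin_sq_add_cos_sq a + Real.sin_sq_add_cos_sq b - 4 * h)

lemma dist_mirror (x y : Plane) : dist (mirror x) (mirror y) = dist x y := by
  refine (sq_eq_sq₀ dist_nonneg dist_nonneg).1 ?_
  rw [dist_sq_plane, dist_sq_plane]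
  simp only [mirror_zero, mirror_one]; ring

lemma dist_capPt_succ (i : ℕ) : dist (capPt i) (capPt (i + 1)) = capLen := by
  rw [capPt, capPt, dist_unitPt, capAngle_succ, sub_add_cancel_left, neg_div, Real.sin_neg, abs_neg,
    abs_of_pos sin_half_del_pos, capLen]

lemma dist_arcPt_succ (j : ℕ) : dist (arcPt j) (arcPt (j + 1)) = arcLen := by
  rw [arcPt, arcPt, dist_midPt, arcAngle_succ, sub_add_cancel_left, neg_div, Real.sin_neg, abs_neg,
    abs_of_pos sin_half_eps_pos, arcLen, mul_assoc]

lemma dist_capPt {a b : ℕ} (hab : a ≤ b) (hb : b ≤ 783) :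
    dist (capPt a) (capPt b) = 2 * Real.sin ((b - a) * del / 2) := by
  have h1 : (capAngle a - capAngle b) / 2 = -((b - a) * del / 2) := by
    rw [capAngle_sub_capAngle]; ring
  have h2 : (b : ℝ) ≤ 783 := by exact_mod_cast hb
  have h3 : (a : ℝ) ≤ b := by exact_mod_cast hab
  have h4 : (0 : ℝ) ≤ a := a.cast_nonneg
  have h5 : (b - a : ℝ) * del ≤ 783 * del := mul_le_mul_of_nonneg_right (by linarith) del_pos.le
  have h6 : 0 ≤ (b - a : ℝ) * del := mul_nonneg (by linarith) del_pos.le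
  rw [capPt, capPt, dist_unitPt, h1, Real.sin_neg, abs_neg, abs_of_nonneg]
  exact Real.sin_nonneg_of_nonneg_of_le_pi (by linarith)
    (by linarith [del_lt, Real.pi_gt_three])

lemma capLen_le_dist {a b : ℕ} (hab : a < b) (hb : b ≤ 783) :
    capLen ≤ dist (capPt a) (capPt b) := by
  have h2 : (b : ℝ) ≤ 783 := by exact_mod_cast hb
  have h3 : (a : ℝ) + 1 ≤ b := by exact_mod_cast hab
  have h4 : (0 : ℝ) ≤ a := a.cast_nonneg
  have h5 : (b - a : ℝ) * del ≤ 783 * del := mul_le_mul_of_nonneg_right (by linarith) del_pos.le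
  have h6 : 1 * del ≤ (b - a : ℝ) * del := mul_le_mul_of_nonneg_right (by linarith) del_pos.le
  have h7 : 783 * del = 2 * psi := by rw [del]; ring
  rw [dist_capPt hab.le hb, capLen]
  refine mul_le_mul_of_nonneg_left (Real.sin_le_sin_of_le_of_le_pi_div_two ?_ ?_ ?_) two_pos.le <;>
  linarith [del_pos, psi_lt, Real.pi_gt_three]

/-- The long diagonals of the right unit circle. -/
lemma sub_mul_capLen_le_dist {j : ℕ} (hj : j ≤ 623) :
    (623 - j) * capLen ≤ dist (capPt j) (capPt 783) := by
  have h3 : (j : ℝ) ≤ 623 := by exact_mod_cast hj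
  have h4 : (0 : ℝ) ≤ j := j.cast_nonneg
  have h5 : (623 - j : ℝ) * capLen ≤ (623 - j) * del :=
    mul_le_mul_of_nonneg_left capLen_le (by linarith)
  have h6 : 0 ≤ j * del := mul_nonneg h4 del_pos.le
  have h7 : 783 * del = 2 * psi := by rw [del]; ring
  -- Sine is 1-Lipschitz, so the diagonal is at least `2 sin ψ - j del`; the claim reduces to `623
  -- del ≤ 2 sin ψ`, the condition behind the index 703.
  have h8 := abs_le.1 (Real.abs_sin_sub_sin_le psi ((783 - j) * del / 2))
  rw [abs_of_nonneg (by linarith)] at h8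
  rw [dist_capPt (by omega) le_rfl]
  push_cast
  linarith [sin_psi_gt, psi_lt, h8.2]

/-- The central angle is between `2χ` and `π`, so the shortest of these segments is the vertical
chord, of length `2 rad sin χ = 2 sin ψ`. -/
lemma dist_capPt_zero_arcPt {j : ℕ} (hj : j ≤ 140) :
    2 * Real.sin psi ≤ dist (capPt 0) (arcPt j) := by
  have h1 := arcAngle_ge j
  have h2 := arcAngle_le hj
  have h3 := chi_gt
  have h4 := chi_lt
  have h5 := Real.pi_gt_three
  rw [← rad_sin_chi, capPt_zero, arcPt, dist_midPt, ← mul_assoc]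
  refine mul_le_mul_of_nonneg_left ?_ (by linarith [rad_pos])
  rw [show (-chi - arcAngle j) / 2 = -((chi + arcAngle j) / 2) by ring, Real.sin_neg, abs_neg]
  exact (Real.sin_le_sin_of_le_of_le_pi_div_two (by linarith) (by linarith) (by linarith)).trans
    (le_abs_self _)

lemma dist_shieldPt_unitPt_sq (θ : ℝ) :
    dist shieldPt (unitPt θ) ^ 2 = 0.0009 + 2.06 * (1 - Real.cos (psi - θ)) := by
  rw [dist_sq_plane, Real.cos_sub]
  simp only [unitPt_zero, unitPt_one, shieldPt_zero, shieldPt_one]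
  linear_combination Real.sin_sq_add_cos_sq θ + 1.0609 * Real.sin_sq_add_cos_sq psi

lemma dist_shieldPt_midPt_sq (ω : ℝ) : dist shieldPt (midPt ω) ^ 2 =
    0.0009 + 2 * rad ^ 2 * (1 - Real.cos (ω - chi))
      - 0.06 * rad * (Real.sin (ω - chi) * Real.sin (psi - chi)
        - (1 - Real.cos (ω - chi)) * Real.cos (psi - chi)) := by
  have h0 : shieldPt 0 = rad * Real.cos chi + 0.03 * Real.cos psi := by
    rw [rad_cos_chi, shieldPt_zero]; ring
  have h1 : shieldPt 1 = rad * Real.sin chi + 0.03 * Real.sin psi := by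
    rw [rad_sin_chi, shieldPt_one]; ring
  have h2 := Real.cos_sub (ω - chi) (psi - chi)
  rw [sub_sub_sub_cancel_right] at h2
  have h3 : Real.sin (ω - chi) * Real.sin (psi - chi)
      - (1 - Real.cos (ω - chi)) * Real.cos (psi - chi)
        = Real.cos (ω - psi) - Real.cos (psi - chi) := by rw [h2]; ring
  rw [h3, dist_sq_plane, h0, h1, midPt_zero, midPt_one, Real.cos_sub, Real.cos_sub, Real.cos_sub]
  linear_combination rad ^ 2 * (Real.sin_sq_add_cos_sq ω + Real.sin_sq_add_cos_sq chi)
    + 0.0009 * Real.sin_sq_add_cos_sq psi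

/-- The edges from the shield point to the right unit circle. -/
lemma le_dist_shieldPt_capPt {i : ℕ} (hi : i ≤ 783) (h : 0.865 ≤ capAngle i) :
    (783 - i) * capLen + 0.004 ≤ dist shieldPt (capPt i) := by
  have h1 : capAngle 783 - capAngle i = (783 - i) * del := by
    rw [capAngle_sub_capAngle]; norm_num
  have h2 := capAngle_le hi
  have h3 : (i : ℝ) ≤ 783 := by exact_mod_cast hi
  have h4 : (783 - i : ℝ) * capLen ≤ (783 - i) * del :=
    mul_le_mul_of_nonneg_left capLen_le (by linarith)
  have h5 := psi_lt
  rw [capAngle_last] at h1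
  have h6 := dist_shieldPt_unitPt_sq (capAngle i)
  have h7 := cos_le_taylor_four (x := psi - capAngle i) (by linarith)
  rw [← h1] at h4
  have hy : psi - capAngle i ≤ 0.28 := by linarith
  have hy0 : 0 ≤ psi - capAngle i := by linarith
  change dist shieldPt (capPt i) ^ 2 = _ at h6
  generalize psi - capAngle i = y at *
  refine (add_le_add_left h4 _).trans (abs_le_of_sq_le_sq' ?_ dist_nonneg).2
  have : y ^ 4 ≤ 0.0784 * y ^ 2 := by
    have := mul_le_mul_of_nonneg_right (pow_le_pow_left₀ hy0 hy 2) (sq_nonneg y)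
    linarith
  -- With the quartic absorbed, what remains is a positive quadratic with its minimum near `0.17`.
  nlinarith [sq_nonneg (y - 0.17)]

/-- The edges from the shield point to the middle circle. -/
lemma le_dist_shieldPt_arcPt {j : ℕ} (h : arcAngle j ≤ 1.31) :
    j * arcLen - 0.004 ≤ dist shieldPt (arcPt j) ∧ 0.004 ≤ dist shieldPt (arcPt j) := by
  have h1 : arcAngle j - chi = j * eps := by rw [arcAngle]; ring
  have h4 : j * arcLen ≤ j * (rad * eps) :=
    mul_le_mul_of_nonneg_left arcLen_le j.cast_nonneg
  have h2 := arcAngle_ge j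
  have h3 := chi_gt
  have h5 : j * (rad * eps) = 1.1507 * (arcAngle j - chi) := by rw [h1, rad]; ring
  have h6 := dist_shieldPt_midPt_sq (arcAngle j)
  have h7 := cos_le_taylor_four (x := arcAngle j - chi) (by linarith)
  have h8 := Real.sin_le (x := arcAngle j - chi) (by linarith)
  have hg : Real.sin (psi - chi) ≤ 0.2299 := by
    have := sin_le_taylor_five (x := psi - chi) (by linarith [chi_lt, psi_gt])
    have l1 : psi - chi ≤ 0.2315 := by linarith [psi_lt]
    have l2 : 0.23149 ≤ psi - chi := by linarith [psi_gt, chi_lt]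
    have l3 := pow_le_pow_left₀ (by norm_num) l2 3
    have l4 := pow_le_pow_left₀ (by linarith) l1 5
    norm_num at l3 l4
    linarith
  have hg' : 0.973 ≤ Real.cos (psi - chi) := by
    have := Real.one_sub_sq_div_two_le_cos (x := psi - chi)
    have l1 : psi - chi ≤ 0.2315 := by linarith [psi_lt]
    have l4 := pow_le_pow_left₀ (by linarith [chi_lt, psi_gt]) l1 2
    norm_num at l4
    linarith
  have hg0 : 0 ≤ Real.sin (psi - chi) := Real.sin_nonneg_of_nonneg_of_le_pi
    (by linarith [chi_lt, psi_gt]) (by linarith [psi_lt, Real.pi_gt_three])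
  have h9 := Real.cos_le_one (arcAngle j - chi)
  change dist shieldPt (arcPt j) ^ 2 = _ at h6
  have hw0 : 0 ≤ arcAngle j - chi := by linarith
  have hw : arcAngle j - chi ≤ 0.4 := by linarith
  rw [h5] at h4
  generalize arcAngle j - chi = w at *
  have p1 : Real.sin w * Real.sin (psi - chi) ≤ w * 0.2299 := mul_le_mul h8 hg hg0 hw0
  have p2 : (w ^ 2 / 2 - w ^ 4 / 24) * 0.973 ≤ (1 - Real.cos w) * Real.cos (psi - chi) :=
    mul_le_mul (by linarith) hg' (by norm_num) (by linarith)
  have p3 : w ^ 4 ≤ 0.16 * w ^ 2 := by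
    have := mul_le_mul_of_nonneg_right (pow_le_pow_left₀ hw0 hw 2) (sq_nonneg w)
    linarith
  have key : (1.1507 * w - 0.004) ^ 2 ≤ dist shieldPt (arcPt j) ^ 2 ∧
      0.004 ^ 2 ≤ dist shieldPt (arcPt j) ^ 2 := by
    rw [h6, show rad = 1.1507 by norm_num [rad]]
    constructor
    -- Again quadratics after absorbing `w ^ 4`; the centres of the squares are close to their
    -- minimisers.
    · nlinarith [sq_nonneg (w - 0.21)]
    · nlinarith [sq_nonneg (w - 0.007)]
  exact ⟨(sub_le_sub_right h4 _).trans (abs_le_of_sq_le_sq' key.1 dist_nonneg).2,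
    (abs_le_of_sq_le_sq' key.2 dist_nonneg).2⟩

/-- The points of the outline near the shield point. -/
def NearShield (x : Plane) : Prop :=
  (∃ i ≤ 783, 0.865 ≤ capAngle i ∧ x = capPt i) ∨ ∃ j ≤ 140, arcAngle j ≤ 1.31 ∧ x = arcPt j

lemma nearShield_of_visible {u v : Plane} (h : IsChord u v) (hs : crs u v shieldPt < 0) :
    NearShield u ∧ NearShield v := by
  rcases isArcChord_of_visible h hs with ⟨i, hi, rfl, rfl⟩ | ⟨j, hj, rfl, rfl⟩
  · have := capMid_gt_of_visible hi ((crs_capPt_neg_iff _ _).1 hs)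
    have := del_lt
    have := del_pos
    exact ⟨Or.inl ⟨i, hi.le, by linarith, rfl⟩,
      Or.inl ⟨i + 1, hi, by rw [capAngle_succ]; linarith, rfl⟩⟩
  · have := arcMid_lt_of_visible hj ((crs_arcPt_neg_iff _ _).1 hs)
    have := eps_lt
    have := eps_pos
    exact ⟨Or.inr ⟨j, hj.le, by linarith, rfl⟩,
      Or.inr ⟨j + 1, hj, by rw [arcAngle_succ]; linarith, rfl⟩⟩

/-! ### A potential that is 1-Lipschitz along edges -/

/-- Half of the length of the outline polygon. -/
noncomputable def halfLen : ℝ := 783 * capLen + 140 * arcLen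

open Classical in
/-- The distance along the outline polygon from `capPt 703`, on the right and upper arcs, and its
value at the right shield points. -/
noncomputable def arcPot (x : Plane) : ℝ :=
  if 40821049 / 58000000 ≤ x 0 then
    if pwRight x = 0 then capLen / del * |Real.arcsin (x 1) - capAngle 703|
    else if 0 < x 1 then 80 * capLen + 0.004 else 703 * capLen + 0.004
  else 80 * capLen + arcLen / eps * (Real.arccos (x 0 / rad) - chi)

open Classical in
/-- The distance along the outline polygon from `capPt 703`, extended to the shield points. -/
noncomputable def pot (x : Plane) : ℝ :=
  if 40821049 / 58000000 ≤ x 0 ∨ -(40821049 / 58000000) < x 0 ∧ 0 < x 1 then arcPot x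
  else halfLen - arcPot (-x)

lemma pot_eq_arcPot {x : Plane} (h : 40821049 / 58000000 ≤ x 0) :
    pot x = arcPot x ∧ pot (-x) = halfLen - arcPot x := by
  constructor
  · rw [pot, if_pos (Or.inl h)]
  · rw [pot, if_neg, neg_neg]
    rw [PiLp.neg_apply]
    rintro (h' | h') <;> linarith

lemma pot_capPt {i : ℕ} (hi : i ≤ 783) :
    pot (capPt i) = |(i : ℝ) - 703| * capLen ∧
      pot (-capPt i) = halfLen - |(i : ℝ) - 703| * capLen := by
  have h := (capPt_abscissa hi).1
  have e : arcPot (capPt i) = |(i : ℝ) - 703| * capLen := by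
    have h1 := abs_le.1 (abs_capAngle_le hi)
    have h2 := psi_lt
    have h3 := Real.pi_gt_three
    rw [arcPot, if_pos h, capPt, if_pos (pwRight_unitPt _), unitPt_one,
      Real.arcsin_sin (by linarith) (by linarith), capAngle_sub_capAngle, abs_mul,
      abs_of_pos del_pos]
    push_cast
    field_simp [del_pos.ne']
  rw [(pot_eq_arcPot h).1, (pot_eq_arcPot h).2, e]
  exact ⟨rfl, rfl⟩

lemma pot_arcPt {j : ℕ} (hj : j ≤ 140) :
    pot (arcPt j) = 80 * capLen + j * arcLen ∧
      pot (-arcPt j) = halfLen - (80 * capLen + j * arcLen) := by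
  have h0 : arcPt j 0 = rad * Real.cos (arcAngle j) := rfl
  have h1 := arcAngle_ge j
  have h2 := arcAngle_le hj
  have h3 := chi_gt
  have habs := arcPt_abscissa hj
  -- The two ends of the arc are corners, and the case split by abscissa assigns them to cap points.
  -- The cap and arc formulas agree there because of the value of `halfLen`.
  rcases eq_or_ne (arcPt j 0) (40821049 / 58000000) with h | h
  · have hj0 : j = 0 := by
      rw [h0, ← rad_mul_cos_chi] at h
      have := Real.injOn_cos ⟨by linarith, by linarith⟩ ⟨by linarith, by linarith⟩
        (mul_left_cancel₀ rad_pos.ne' h)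
      rw [← arcAngle_zero] at this
      exact arcAngle_strictMono.injective this
    subst hj0
    rw [← capPt_last, (pot_capPt le_rfl).1, (pot_capPt le_rfl).2]
    norm_num
  rcases eq_or_ne (arcPt j 0) (-(40821049 / 58000000)) with h' | h'
  · have hj0 : j = 140 := by
      rw [h0, ← rad_mul_cos_chi, ← mul_neg, ← Real.cos_pi_sub] at h'
      have := Real.injOn_cos ⟨by linarith, by linarith⟩ ⟨by linarith, by linarith⟩
        (mul_left_cancel₀ rad_pos.ne' h')
      rw [← arcAngle_last] at this
      exact arcAngle_strictMono.injective this
    subst hj0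
    rw [arcPt_last, neg_neg, (pot_capPt (Nat.zero_le _)).1, (pot_capPt (Nat.zero_le _)).2, halfLen]
    norm_num
    constructor <;> ring
  have l1 := lt_of_le_of_ne habs.1.1 h
  have l2 := lt_of_le_of_ne habs.2.1 h'.symm
  have l3 : 0 < arcPt j 1 :=
    mul_pos rad_pos (Real.sin_pos_of_pos_of_lt_pi (by linarith) (by linarith))
  have e : arcPot (arcPt j) = 80 * capLen + j * arcLen := by
    rw [arcPot, if_neg (not_le.2 l1), h0, mul_div_cancel_left₀ _ rad_pos.ne',
      Real.arccos_cos (by linarith) (by linarith), arcAngle]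
    field_simp [eps_pos.ne']
    ring
  constructor
  · rw [pot, if_pos (Or.inr ⟨l2, l3⟩), e]
  · rw [pot, if_neg, neg_neg, e]
    simp only [PiLp.neg_apply]
    rintro (h | h) <;> linarith

lemma pot_shieldPt : pot shieldPt = 80 * capLen + 0.004 ∧
    pot (-shieldPt) = halfLen - (80 * capLen + 0.004) := by
  have h : 40821049 / 58000000 ≤ shieldPt 0 := by rw [shieldPt_zero, cos_psi]; norm_num
  have h1 : 0 < shieldPt 1 := by rw [shieldPt_one]; linarith [sin_psi_gt]
  rw [(pot_eq_arcPot h).1, (pot_eq_arcPot h).2, arcPot, if_pos h, if_pos h1, if_neg]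
  · exact ⟨rfl, rfl⟩
  · rw [pwRight_shieldPt]; norm_num

lemma pot_mirror_shieldPt : pot (mirror shieldPt) = 703 * capLen + 0.004 ∧
    pot (-mirror shieldPt) = halfLen - (703 * capLen + 0.004) := by
  have h : 40821049 / 58000000 ≤ mirror shieldPt 0 := by
    rw [mirror_zero, shieldPt_zero, cos_psi]; norm_num
  have h1 : ¬ 0 < mirror shieldPt 1 := by
    rw [mirror_one, shieldPt_one]; linarith [sin_psi_gt]
  rw [(pot_eq_arcPot h).1, (pot_eq_arcPot h).2, arcPot, if_pos h, if_neg h1, if_neg]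
  · exact ⟨rfl, rfl⟩
  · rw [pwRight_mirror, pwRight_shieldPt]; norm_num

/-- Outline distances from `p` to opposite points add up to `halfLen`. Hence the Lipschitz property
of an edge passes to its point reflection. -/
lemma pot_neg {x : Plane} (h : IsSite x) : pot (-x) = halfLen - pot x := by
  refine IsSite.cases (Q := fun x => pot (-x) = halfLen - pot x) ?_ ?_ ?_ ?_ ?_ ?_ ?_ ?_ h
  · intro i hi; rw [(pot_capPt hi).1, (pot_capPt hi).2]
  · intro i hi; rw [(pot_arcPt hi).1, (pot_arcPt hi).2]
  · intro i hi; rw [neg_neg, (pot_capPt hi).1, (pot_capPt hi).2]; ring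
  · intro i hi; rw [neg_neg, (pot_arcPt hi).1, (pot_arcPt hi).2]; ring
  · rw [pot_shieldPt.1, pot_shieldPt.2]
  · rw [pot_mirror_shieldPt.1, pot_mirror_shieldPt.2]
  · rw [neg_neg, pot_shieldPt.1, pot_shieldPt.2]; ring
  · rw [neg_neg, pot_mirror_shieldPt.1, pot_mirror_shieldPt.2]; ring

/-- The potential difference is at most the distance. -/
def PotLe (u v : Plane) : Prop := |pot u - pot v| ≤ dist u v

lemma PotLe.symm {u v : Plane} (h : PotLe u v) : PotLe v u := by
  rw [PotLe, abs_sub_comm, dist_comm]; exact h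

lemma PotLe.neg {u v : Plane} (hu : IsSite u) (hv : IsSite v) (h : PotLe u v) :
    PotLe (-u) (-v) := by
  rw [PotLe, pot_neg hu, pot_neg hv, dist_neg_neg, sub_sub_sub_cancel_left, abs_sub_comm]
  exact h

/-- In the zigzag the two ends are almost equally many chords away from 703: the numbers differ by
at most one, and no diagonal is shorter than a chord. -/
lemma potLe_capPt_capPt {a b : ℕ} (hab : a < b) (hb : b ≤ 783) (h : 1405 ≤ a + b)
    (h' : a + b ≤ 1407) : PotLe (capPt a) (capPt b) := by
  have h1 : |(a : ℝ) - 703| - |(b : ℝ) - 703| ≤ 1 ∧ -1 ≤ |(a : ℝ) - 703| - |(b : ℝ) - 703| := by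
    have h2 : (1405 : ℝ) ≤ a + b := by exact_mod_cast h
    have h3 : (a + b : ℝ) ≤ 1407 := by exact_mod_cast h'
    have h4 : (a + 1 : ℝ) ≤ b := by exact_mod_cast hab
    rcases abs_cases ((a : ℝ) - 703) with ⟨e, _⟩ | ⟨e, _⟩ <;>
    rcases abs_cases ((b : ℝ) - 703) with ⟨e', _⟩ | ⟨e', _⟩ <;> rw [e, e'] <;>
    constructor <;> linarith
  rw [PotLe, (pot_capPt (hab.le.trans hb)).1, (pot_capPt hb).1, ← sub_mul, abs_mul,
    abs_of_pos capLen_pos]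
  refine le_trans ?_ (capLen_le_dist hab hb)
  exact mul_le_of_le_one_left capLen_pos.le (abs_le.2 h1.symm)

lemma potLe_capPt_succ {i : ℕ} (hi : i < 783) : PotLe (capPt i) (capPt (i + 1)) := by
  rw [PotLe, (pot_capPt hi.le).1, (pot_capPt hi).1, dist_capPt_succ, ← sub_mul, abs_mul,
    abs_of_pos capLen_pos]
  refine mul_le_of_le_one_left capLen_pos.le ((abs_abs_sub_abs_le _ _).trans ?_)
  push_cast
  rw [show (i : ℝ) - 703 - (i + 1 - 703) = -1 by ring]; simp

lemma potLe_capPt_last {j : ℕ} (hj : j ≤ 622) : PotLe (capPt j) (capPt 783) := by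
  have h : (j : ℝ) ≤ 622 := by exact_mod_cast hj
  have h1 : |(j : ℝ) - 703| = 703 - j := by rw [abs_of_nonpos (by linarith)]; ring
  rw [PotLe, (pot_capPt (by omega)).1, (pot_capPt le_rfl).1, h1]
  refine le_trans (le_of_eq ?_) (sub_mul_capLen_le_dist (by omega))
  norm_num
  rw [← sub_mul, abs_mul, abs_of_pos capLen_pos, abs_of_nonneg (by linarith)]
  ring

lemma potLe_arcPt_succ {j : ℕ} (hj : j < 140) : PotLe (arcPt j) (arcPt (j + 1)) := by
  rw [PotLe, (pot_arcPt hj.le).1, (pot_arcPt hj).1, dist_arcPt_succ]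
  push_cast
  rw [show 80 * capLen + j * arcLen - (80 * capLen + (j + 1) * arcLen) = -arcLen by ring, abs_neg,
    abs_of_pos arcLen_pos]

/-- The difference is `623 capLen - j arcLen`. The critical case is `j = 0`, the vertical chord,
where `623 del` falls short of `2 sin ψ` by only about `10⁻⁵`; with 704 in place of 703 there would
be 625 chords, which is too many. -/
lemma potLe_capPt_zero_arcPt {j : ℕ} (hj : j ≤ 140) : PotLe (capPt 0) (arcPt j) := by
  rw [PotLe, (pot_capPt (Nat.zero_le _)).1, (pot_arcPt hj).1]
  refine le_trans ?_ (dist_capPt_zero_arcPt hj)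
  have h0 : (j : ℝ) ≤ 140 := by exact_mod_cast hj
  have h1 : j * arcLen ≤ 140 * arcLen := mul_le_mul_of_nonneg_right h0 arcLen_pos.le
  have h2 : 0 ≤ j * arcLen := mul_nonneg j.cast_nonneg arcLen_pos.le
  have h3 := arcLen_le
  have h4 : 140 * (rad * eps) = 1.1507 * (Real.pi - 2 * chi) := by rw [eps, rad]; ring
  have h5 := capLen_le
  have h6 : 623 * del = 1246 / 783 * psi := by rw [del]; ring
  have h7 := capLen_pos
  rw [abs_le]
  norm_num
  constructor <;> linarith [sin_psi_gt, psi_lt, chi_gt, Real.pi_lt_d2]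

/-- The shield gets `0.004` more than its corner. This is small enough for the edges back to the cap
and for the edge to the corner, and large enough for the edges ahead to the middle arc, some of
which are shorter than the outline path from the corner. -/
lemma potLe_shieldPt {x : Plane} (h : NearShield x) : PotLe shieldPt x := by
  rcases h with ⟨i, hi, h, rfl⟩ | ⟨j, hj, h, rfl⟩
  · have h1 := le_dist_shieldPt_capPt hi h
    have hi' : (i : ℝ) ≤ 783 := by exact_mod_cast hi
    have hi0 : (623 : ℝ) ≤ i := by
      by_contra! hlt
      have := mul_le_mul_of_nonneg_right hlt.le del_pos.le
      rw [capAngle] at h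
      linarith [psi_gt, del_lt]
    have h2 : |(i : ℝ) - 703| ≤ 80 := abs_le.2 ⟨by linarith, by linarith⟩
    have h3 := neg_abs_le ((i : ℝ) - 703)
    have h4 := le_abs_self ((i : ℝ) - 703)
    have h5 := capLen_pos
    rw [PotLe, pot_shieldPt.1, (pot_capPt hi).1, abs_of_nonneg]
    · refine le_trans ?_ h1
      have := mul_le_mul_of_nonneg_right h4 h5.le
      linarith
    · have := mul_le_mul_of_nonneg_right h2 h5.le
      linarith
  · have h1 := le_dist_shieldPt_arcPt h
    have h2 : 0 ≤ j * arcLen := mul_nonneg j.cast_nonneg arcLen_pos.le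
    rw [PotLe, pot_shieldPt.1, (pot_arcPt hj).1, abs_le]
    constructor <;> linarith [h1.1, h1.2]

lemma potLe_mirror_shieldPt {x : Plane} (h : NearShield (mirror x)) :
    PotLe (mirror shieldPt) x := by
  rw [PotLe, ← mirror_mirror x, dist_mirror, mirror_mirror]
  rcases h with ⟨i, hi, h, hx⟩ | ⟨j, hj, h, hx⟩
  · have h1 := le_dist_shieldPt_capPt hi h
    have e : x = capPt (783 - i) := by rw [← mirror_capPt hi, ← hx, mirror_mirror]
    have hi' : (i : ℝ) ≤ 783 := by exact_mod_cast hi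
    have hi0 : (80 : ℝ) ≤ i := by
      by_contra! hlt
      have := mul_le_mul_of_nonneg_right hlt.le del_pos.le
      rw [capAngle] at h
      linarith [psi_gt, del_lt]
    have h5 := capLen_pos
    have h6 : |((783 - i : ℕ) : ℝ) - 703| = i - 80 := by
      rw [Nat.cast_sub hi, abs_of_nonpos] <;> push_cast <;> linarith
    rw [hx, pot_mirror_shieldPt.1, e, (pot_capPt (Nat.sub_le _ _)).1, h6, abs_of_nonneg]
    · linarith
    · have := mul_le_mul_of_nonneg_right hi' h5.le
      linarith
  · have h1 := le_dist_shieldPt_arcPt h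
    have e : x = -arcPt (140 - j) := by rw [← mirror_arcPt hj, ← hx, mirror_mirror]
    have h2 : 0 ≤ j * arcLen := mul_nonneg j.cast_nonneg arcLen_pos.le
    rw [hx, pot_mirror_shieldPt.1, e, (pot_arcPt (Nat.sub_le _ _)).2, abs_le, Nat.cast_sub hj,
      halfLen]
    push_cast
    constructor <;> linarith [h1.1, h1.2]

lemma IsChord.potLe {u v : Plane} (h : IsChord u v) : PotLe u v := by
  have := IsChord.cases (Q := fun u v => (IsSite u ∧ IsSite v) ∧ PotLe u v) ?_ ?_ ?_ h
  · exact this.2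
  · exact fun i hi => ⟨⟨Or.inl (onOutline_capPt hi.le), Or.inl (onOutline_capPt hi)⟩,
      potLe_capPt_succ hi⟩
  · exact fun i hi => ⟨⟨Or.inl (onOutline_arcPt hi.le), Or.inl (onOutline_arcPt hi)⟩,
      potLe_arcPt_succ hi⟩
  · exact fun u v h => ⟨⟨h.1.1.neg, h.1.2.neg⟩, h.2.neg h.1.1 h.1.2⟩

lemma potLe_of_visible {u v s : Plane} (h : IsChord u v) (hs : IsShield s) (hv : crs u v s < 0) :
    PotLe s u ∧ PotLe s v := by
  have h1 : ∀ u v, IsChord u v → crs u v shieldPt < 0 → PotLe shieldPt u ∧ PotLe shieldPt v :=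
    fun u v h hv => ⟨potLe_shieldPt (nearShield_of_visible h hv).1,
      potLe_shieldPt (nearShield_of_visible h hv).2⟩
  have h2 : ∀ u v, IsChord u v → crs u v (mirror shieldPt) < 0 →
      PotLe (mirror shieldPt) u ∧ PotLe (mirror shieldPt) v := fun u v h hv => by
    have := nearShield_of_visible h.map_mirror (by rw [← crs_mirror]; simpa using hv)
    exact ⟨potLe_mirror_shieldPt this.2, potLe_mirror_shieldPt this.1⟩
  have hneg : ∀ s, IsShield s →
      (∀ u v, IsChord u v → crs u v s < 0 → PotLe s u ∧ PotLe s v) →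
      ∀ u v, IsChord u v → crs u v (-s) < 0 → PotLe (-s) u ∧ PotLe (-s) v := by
    intro s hs H u v h hv
    have := H _ _ h.neg (by rw [← crs_neg]; simpa using hv)
    have hu := this.1.neg (Or.inr hs) (Or.inl h.onOutline.1.neg)
    have hv := this.2.neg (Or.inr hs) (Or.inl h.onOutline.2.neg)
    rw [neg_neg] at hu hv
    exact ⟨hu, hv⟩
  rcases hs with rfl | rfl | rfl | rfl
  · exact h1 u v h hv
  · exact h2 u v h hv
  · exact hneg _ (Or.inl rfl) h1 u v h hv
  · exact hneg _ (Or.inr (Or.inl rfl)) h2 u v h hv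

lemma IsBase.potLe {u v w : Plane} (h : IsBase u v w) : PotLe u v ∧ PotLe v w ∧ PotLe w u := by
  have := IsBase.cases (Q := fun u v w => (IsSite u ∧ IsSite v ∧ IsSite w) ∧
    PotLe u v ∧ PotLe v w ∧ PotLe w u) ?_ ?_ ?_ ?_ h
  · exact this.2
  · rintro u v w ⟨⟨hu, hv, hw⟩, h1, h2, h3⟩
    exact ⟨⟨hu.neg, hv.neg, hw.neg⟩, h1.neg hu hv, h2.neg hv hw, h3.neg hw hu⟩
  · intro j hj hj'
    refine ⟨(isBase_cap hj hj').isSite, potLe_capPt_succ hj, ?_⟩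
    rcases le_or_gt j 621 with h | h
    · rw [min_eq_left (by omega)]
      exact ⟨potLe_capPt_last (by omega), (potLe_capPt_last (by omega)).symm⟩
    · rw [min_eq_right (by omega)]
      rcases lt_or_gt_of_ne hj' with h' | h'
      · exact ⟨potLe_capPt_capPt (by omega) (by omega) (by omega) (by omega),
          (potLe_capPt_capPt (by omega) (by omega) (by omega) (by omega)).symm⟩
      · exact ⟨(potLe_capPt_capPt (by omega) (by omega) (by omega) (by omega)).symm,
          potLe_capPt_capPt (by omega) (by omega) (by omega) (by omega)⟩
  · exact fun j hj => ⟨(isBase_arc hj).isSite, potLe_arcPt_succ hj,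
      (potLe_capPt_zero_arcPt hj).symm, potLe_capPt_zero_arcPt hj.le⟩
  · exact fun u v w h => ⟨IsBase.isSite (Or.inr h), h.1.potLe.symm,
      (potLe_of_visible h.1 h.2.1 h.2.2).1.symm, (potLe_of_visible h.1 h.2.1 h.2.2).2⟩

/-- The complex of the triangulation. -/
noncomputable def triangulation : Geometry.SimplicialComplex ℝ Plane := delaunayCells.complex

lemma potLe_of_adj {u v : Plane} (h : (edgeGraph triangulation).Adj u v) : PotLe u v := by
  obtain ⟨hne, f, hf, hu, hv⟩ := h
  obtain ⟨-, a, b, c, hc, hsub⟩ := delaunayCells.mem_faces.1 hf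
  have hu := hsub hu
  have hv := hsub hv
  have key : ∀ a b c, IsBase a b c → u ∈ ({a, b, c} : Finset Plane) →
      v ∈ ({a, b, c} : Finset Plane) → PotLe u v := by
    intro a b c h hu hv
    obtain ⟨h1, h2, h3⟩ := h.potLe
    simp only [Finset.mem_insert, Finset.mem_singleton] at hu hv
    rcases hu with rfl | rfl | rfl <;> rcases hv with rfl | rfl | rfl <;>
    first
    | exact absurd rfl hne
    | assumption
    | exact PotLe.symm (by assumption)
  rcases hc with h | h | h
  · exact key _ _ _ h hu hv
  · refine key _ _ _ h ?_ ?_ <;> simp only [Finset.mem_insert, Finset.mem_singleton] at * <;> tauto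
  · refine key _ _ _ h ?_ ?_ <;> simp only [Finset.mem_insert, Finset.mem_singleton] at * <;> tauto

/-! ### The shortest path -/

/-- The increments of the potential telescope along the walk; cutting negative values off at zero is
harmless because `ENNReal.ofReal` is subadditive. -/
lemma ofReal_le_walkLength {u v : Plane} (w : (edgeGraph triangulation).Walk u v) :
    ENNReal.ofReal (pot v - pot u) ≤ walkLength w := by
  induction w with
  | nil => simp [walkLength]
  | @cons a b c h w ih =>
    have h1 := (abs_le.1 (potLe_of_adj h)).1
    have e : walkLength (SimpleGraph.Walk.cons h w) = edist a b + walkLength w := by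
      simp [walkLength]
    rw [e, edist_dist]
    refine le_trans ?_ (add_le_add_right ih _)
    rw [← sub_add_sub_cancel, add_comm]
    refine ENNReal.ofReal_add_le.trans (add_le_add_left (ENNReal.ofReal_le_ofReal ?_) _)
    linarith

lemma adj_of_isChord {u v : Plane} (h : IsChord u v) : (edgeGraph triangulation).Adj u v := by
  obtain ⟨w, hw⟩ := h.exists_cell
  refine ⟨fun e => ?_, {u, v, w}, delaunayCells.mem_faces.2 ⟨⟨u, by simp⟩, u, v, w, hw, subset_rfl⟩,
    by simp, by simp⟩
  have := hw.crs_pos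
  rw [e] at this
  simp [crs] at this

lemma pathDist_triangle {G : SimpleGraph Plane} (u v w : Plane) :
    pathDist G u w ≤ pathDist G u v + pathDist G v w := by
  rw [pathDist, pathDist, pathDist, ENNReal.iInf_add]
  refine le_iInf fun a => ?_
  rw [ENNReal.add_iInf]
  refine le_iInf fun b => (iInf_le _ (a.append b)).trans (le_of_eq ?_)
  simp [walkLength, SimpleGraph.Walk.darts_append]

lemma pathDist_le_mul {G : SimpleGraph Plane} {f : ℕ → Plane} {c : ℝ} (hc : 0 ≤ c) (n : ℕ)
    (h : ∀ i < n, G.Adj (f i) (f (i + 1)) ∧ dist (f i) (f (i + 1)) = c) :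
    pathDist G (f 0) (f n) ≤ ENNReal.ofReal (n * c) := by
  induction n with
  | zero => exact (iInf_le _ SimpleGraph.Walk.nil).trans (by simp [walkLength])
  | succ n ih =>
    obtain ⟨h1, h2⟩ := h n n.lt_succ_self
    refine (pathDist_triangle _ (f n) _).trans ?_
    have h3 : pathDist G (f n) (f (n + 1)) ≤ ENNReal.ofReal c := by
      rw [← h2, ← edist_dist]
      exact (iInf_le _ (SimpleGraph.Walk.cons h1 SimpleGraph.Walk.nil)).trans (by simp [walkLength])
    refine (add_le_add (ih fun i hi => h i (hi.trans n.lt_succ_self)) h3).trans (le_of_eq ?_)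
    rw [← ENNReal.ofReal_add (by positivity) hc]
    push_cast
    congr 1; ring

/-- The potential rises from `0` to `halfLen`, which bounds every path from below. The outline path
with 80 cap chords, 140 arc chords and 703 chords of the opposite cap attains the bound. -/
lemma pathDist_eq_halfLen :
    pathDist (edgeGraph triangulation) (capPt 703) (-capPt 703) = ENNReal.ofReal halfLen := by
  have hc := capLen_pos.le
  have ha := arcLen_pos.le
  refine le_antisymm ?_ (le_iInf fun w => ?_)
  · have h1 := pathDist_le_mul (G := edgeGraph triangulation) (f := fun i => capPt (703 + i)) hc 80
      fun i hi => ⟨adj_of_isChord (isChord_capPt (by omega)), dist_capPt_succ _⟩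
    have h2 := pathDist_le_mul (G := edgeGraph triangulation) (f := arcPt) ha 140
      fun i hi => ⟨adj_of_isChord (isChord_arcPt hi), dist_arcPt_succ _⟩
    have h3 := pathDist_le_mul (G := edgeGraph triangulation) (f := fun i => -capPt i) hc 703
      fun i hi => ⟨adj_of_isChord (isChord_capPt (by omega)).neg,
        (dist_neg_neg _ _).trans (dist_capPt_succ _)⟩
    simp only [Nat.reduceAdd, add_zero, capPt_last] at h1
    rw [arcPt_last] at h2
    refine ((pathDist_triangle _ (arcPt 0) _).trans (add_le_add h1
      ((pathDist_triangle _ (-capPt 0) _).trans (add_le_add h2 h3)))).trans (le_of_eq ?_)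
    rw [← ENNReal.ofReal_add (by positivity) (by positivity),
      ← ENNReal.ofReal_add (by positivity) (by positivity), halfLen]
    push_cast
    congr 1; ring
  · have := ofReal_le_walkLength w
    rw [(pot_capPt (by norm_num)).1, (pot_capPt (by norm_num)).2] at this
    simpa using this

/-! ### Numerical values -/

lemma mul_le_sin {x : ℝ} (h0 : 0 ≤ x) (h1 : x ≤ 1) : x * (1 - x ^ 2 / 6) ≤ Real.sin x := by
  have h := taylor_seven_le_sin h0
  have h2 : x ^ 7 ≤ x ^ 5 := pow_le_pow_of_le_one h0 h1 (by norm_num)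
  have h3 : 0 ≤ x ^ 5 := by positivity
  linarith [show x * (1 - x ^ 2 / 6) = x - x ^ 3 / 6 by ring]

/-- Replacing arcs by chords costs a relative error of at most `x² / 6` at the half-angle `x`: below
`4 · 10⁻⁷` on the caps and `3.8 · 10⁻⁶` on the middle arcs. -/
lemma halfLen_gt : 1.5846 * 2.399929 < halfLen := by
  have hd : del / 2 * (1 - 0.0000004) ≤ Real.sin (del / 2) := by
    have h0 := del_pos
    have h1 := del_lt
    refine le_trans (mul_le_mul_of_nonneg_left ?_ (by linarith))
      (mul_le_sin (by linarith) (by linarith))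
    have := pow_le_pow_left₀ (by linarith) (show del / 2 ≤ 0.0015 by linarith) 2
    norm_num at this ⊢
    linarith
  have he : eps / 2 * (1 - 0.0000038) ≤ Real.sin (eps / 2) := by
    have h0 := eps_pos
    have h1 := eps_lt
    refine le_trans (mul_le_mul_of_nonneg_left ?_ (by linarith))
      (mul_le_sin (by linarith) (by linarith))
    have := pow_le_pow_left₀ (by linarith) (show eps / 2 ≤ 0.004706 by linarith) 2
    norm_num at this ⊢
    linarith
  rw [halfLen, capLen, arcLen, rad]
  rw [del] at hd
  rw [eps] at he
  rw [del, eps]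
  linarith [psi_gt, chi_lt, Real.pi_gt_d20]

lemma halfLen_lt : halfLen < 1.5847 * 2.39985 := by
  have h1 := capLen_le
  have h2 := arcLen_le
  rw [del] at h1
  rw [eps, rad] at h2
  rw [halfLen]
  linarith [psi_lt, chi_gt, Real.pi_lt_d20]

lemma cos_capAngle_bounds : 0.61345 < Real.cos (capAngle 703) ∧
    Real.cos (capAngle 703) < 0.613462 := by
  have e : capAngle 703 = 623 / 783 * psi := by rw [capAngle, del]; push_cast; ring
  have h1 : 0.9103595 ≤ capAngle 703 := by rw [e]; linarith [psi_gt]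
  have h2 : capAngle 703 ≤ 0.9103597 := by rw [e]; linarith [psi_lt]
  have h3 := Real.pi_gt_three
  constructor
  · refine lt_of_lt_of_le ?_ (Real.cos_le_cos_of_nonneg_of_le_pi (by linarith) (by linarith) h2)
    exact lt_of_lt_of_le (by norm_num) (taylor_six_le_cos (by norm_num))
  · refine lt_of_le_of_lt (Real.cos_le_cos_of_nonneg_of_le_pi (by norm_num) (by linarith) h1) ?_
    exact lt_of_le_of_lt (cos_le_taylor_eight (by norm_num)) (by norm_num)

lemma dist_bounds : 2.39985 < dist (capPt 703) (-capPt 703) ∧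
    dist (capPt 703) (-capPt 703) < 2.399929 := by
  have h : dist (capPt 703) (-capPt 703) ^ 2 = 4.3364 + 2.32 * Real.cos (capAngle 703) := by
    rw [dist_sq_plane]
    simp only [capPt, PiLp.neg_apply, unitPt_zero, unitPt_one]
    linear_combination 4 * Real.sin_sq_add_cos_sq (capAngle 703)
  have := cos_capAngle_bounds
  constructor
  · refine lt_of_pow_lt_pow_left₀ 2 dist_nonneg ?_
    rw [h]; linarith
  · refine lt_of_pow_lt_pow_left₀ 2 (by norm_num) ?_
    rw [h]; linarith

lemma pairDilation_bounds :
    ENNReal.ofReal 1.5846 < pairDilation (edgeGraph triangulation) (capPt 703) (-capPt 703) ∧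
    pairDilation (edgeGraph triangulation) (capPt 703) (-capPt 703) < ENNReal.ofReal 1.5847 := by
  have h := dist_bounds
  have h0 : 0 < dist (capPt 703) (-capPt 703) := by linarith [h.1]
  have h1 := halfLen_gt
  have h2 := halfLen_lt
  have h3 : 0 < halfLen / dist (capPt 703) (-capPt 703) := div_pos (by linarith) h0
  rw [pairDilation, pathDist_eq_halfLen, edist_dist, ← ENNReal.ofReal_div_of_pos h0,
    ENNReal.ofReal_lt_ofReal_iff h3, ENNReal.ofReal_lt_ofReal_iff (by norm_num), lt_div_iff₀ h0,
    div_lt_iff₀ h0]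
  constructor <;> linarith [h.1, h.2]

/-! ### The three circles -/

lemma dist_rightCentre_sq (x : Plane) : dist x (rightCentre 0.58) ^ 2 = pwRight x + 1 := by
  rw [dist_sq_plane, pwRight, pw]; ring

lemma leftCentre_eq : leftCentre 0.58 = -rightCentre 0.58 :=
  plane_ext (by simp [leftCentre, rightCentre]) (by simp [leftCentre, rightCentre])

lemma dist_leftCentre (x : Plane) : dist x (leftCentre 0.58) = dist (-x) (rightCentre 0.58) := by
  rw [leftCentre_eq, ← dist_neg_neg, neg_neg]

lemma dist_zero_sq (x : Plane) : dist x 0 ^ 2 = pwMid x + rad ^ 2 := by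
  rw [dist_sq_plane, pwMid, pw]; ring

lemma mem_sphere_right {x : Plane} : x ∈ Metric.sphere (rightCentre 0.58) 1 ↔ pwRight x = 0 := by
  rw [Metric.mem_sphere, ← sq_eq_sq₀ dist_nonneg zero_le_one, dist_rightCentre_sq]
  constructor <;> intro h <;> linarith

lemma mem_sphere_left {x : Plane} : x ∈ Metric.sphere (leftCentre 0.58) 1 ↔ pwRight (-x) = 0 := by
  rw [← mem_sphere_right, Metric.mem_sphere, Metric.mem_sphere, dist_leftCentre]

lemma mem_sphere_mid {x : Plane} : x ∈ Metric.sphere (0 : Plane) 1.1507 ↔ pwMid x = 0 := by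
  rw [Metric.mem_sphere, show (1.1507 : ℝ) = rad by norm_num [rad],
    ← sq_eq_sq₀ dist_nonneg rad_pos.le, dist_zero_sq]
  constructor <;> intro h <;> linarith

lemma notMem_ball_right {x : Plane} (h : 0 ≤ pwRight x) :
    x ∉ Metric.ball (rightCentre 0.58) 1 := by
  rw [Metric.mem_ball, not_lt, ← sq_le_sq₀ zero_le_one dist_nonneg, dist_rightCentre_sq]
  linarith

lemma notMem_ball_left {x : Plane} (h : 0 ≤ pwRight (-x)) :
    x ∉ Metric.ball (leftCentre 0.58) 1 := by
  have := notMem_ball_right h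
  rwa [Metric.mem_ball, ← dist_leftCentre] at this

lemma notMem_ball_mid {x : Plane} (h : 0 ≤ pwMid x) : x ∉ Metric.ball (0 : Plane) 1.1507 := by
  rw [Metric.mem_ball, not_lt, show (1.1507 : ℝ) = rad by norm_num [rad],
    ← sq_le_sq₀ rad_pos.le dist_nonneg, dist_zero_sq]
  linarith

lemma OnOutline.mem_outline {x : Plane} (h : OnOutline x) : x ∈ outline 0.58 1.1507 := by
  have hs : IsSite x := Or.inl h
  refine ⟨?_, ?_⟩
  · rw [Set.mem_union, Set.mem_union, mem_sphere_right, mem_sphere_left, mem_sphere_mid]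
    rcases h with (⟨i, hi, rfl⟩ | ⟨j, hj, rfl⟩) | (⟨i, hi, hx⟩ | ⟨j, hj, hx⟩)
    · exact Or.inl (Or.inl (pwRight_unitPt _))
    · exact Or.inr (pwMid_midPt _)
    · rw [hx]; exact Or.inl (Or.inr (pwRight_unitPt _))
    · rw [← pwMid_neg, hx]; exact Or.inr (pwMid_midPt _)
  · rintro ((h | h) | h)
    · exact notMem_ball_right (pwRight_nonneg hs) h
    · exact notMem_ball_left (pwRight_nonneg hs.neg) h
    · exact notMem_ball_mid (pwMid_nonneg hs) h

lemma IsBase.inscribed {u v w : Plane} (h : IsBase u v w) : IsShield w ∨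
    ({u, v, w} : Set Plane) ⊆ Metric.sphere (rightCentre 0.58) 1 ∨
      ({u, v, w} : Set Plane) ⊆ Metric.sphere (leftCentre 0.58) 1 ∨
      ({u, v, w} : Set Plane) ⊆ Metric.sphere 0 1.1507 := by
  simp only [Set.insert_subset_iff, Set.singleton_subset_iff, mem_sphere_right, mem_sphere_left,
    mem_sphere_mid]
  rcases h with (h | h) | h
  · rcases h with ⟨j, -, -, rfl, rfl, rfl⟩ | ⟨j, -, rfl, rfl, rfl⟩
    · exact Or.inr (Or.inl ⟨pwRight_unitPt _, pwRight_unitPt _, pwRight_unitPt _⟩)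
    · exact Or.inr (Or.inr (Or.inr ⟨pwMid_midPt _, pwMid_midPt _, pwMid_capPt_zero⟩))
  · rcases h with ⟨j, -, -, hu, hv, hw⟩ | ⟨j, -, hu, hv, hw⟩
    · rw [hu, hv, hw]
      exact Or.inr (Or.inr (Or.inl ⟨pwRight_unitPt _, pwRight_unitPt _, pwRight_unitPt _⟩))
    · rw [← pwMid_neg u, ← pwMid_neg v, ← pwMid_neg w, hu, hv, hw]
      exact Or.inr (Or.inr (Or.inr ⟨pwMid_midPt _, pwMid_midPt _, pwMid_capPt_zero⟩))
  · exact Or.inl h.2.1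

/-! ### The shield points -/

/-- The set of shield points. -/
noncomputable def shields : Finset Plane :=
  open Classical in {shieldPt, mirror shieldPt, -shieldPt, -mirror shieldPt}

lemma mem_shields {x : Plane} : x ∈ shields ↔ IsShield x := by
  simp [shields, IsShield]

lemma card_shields : shields.card = 4 := by
  have h0 : 0 < shieldPt 0 := by rw [shieldPt_zero, cos_psi]; norm_num
  have h1 : 0 < shieldPt 1 := by rw [shieldPt_one]; linarith [sin_psi_gt]
  have hx : ∀ x y : Plane, x 0 ≠ y 0 → x ≠ y := fun x y h e => h (by rw [e])
  have hy : ∀ x y : Plane, x 1 ≠ y 1 → x ≠ y := fun x y h e => h (by rw [e])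
  classical
  have n1 : shieldPt ≠ mirror shieldPt := hy _ _ (by simp only [mirror_one]; linarith)
  have n2 : shieldPt ≠ -shieldPt := hy _ _ (by simp only [PiLp.neg_apply]; linarith)
  have n3 : shieldPt ≠ -mirror shieldPt :=
    hx _ _ (by simp only [PiLp.neg_apply, mirror_zero]; linarith)
  have n4 : mirror shieldPt ≠ -shieldPt :=
    hx _ _ (by simp only [PiLp.neg_apply, mirror_zero]; linarith)
  have n5 : mirror shieldPt ≠ -mirror shieldPt :=
    hx _ _ (by simp only [PiLp.neg_apply, mirror_zero]; linarith)
  have n6 : -shieldPt ≠ -mirror shieldPt := fun h => n1 (neg_injective h)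
  rw [shields]
  convert Finset.card_eq_succ.2
    ⟨shieldPt, {mirror shieldPt, -shieldPt, -mirror shieldPt}, ?_, rfl, ?_⟩
  · simp [n1, n2, n3]
  · exact Finset.card_eq_three.2 ⟨_, _, _, n4, n5, n6, rfl⟩

/-- The point `x` is separated by a line from the open triangle `s c 0`. -/
def IsSeparated (s c x : Plane) : Prop := ∃ a b d : ℝ, (a ≠ 0 ∨ b ≠ 0) ∧
  0 ≤ a * s 0 + b * s 1 + d ∧ 0 ≤ a * c 0 + b * c 1 + d ∧ 0 ≤ d ∧ a * x 0 + b * x 1 + d ≤ 0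

lemma IsSeparated.notMem_interior {s c x : Plane} (h : IsSeparated s c x) :
    x ∉ interior (convexHull ℝ {s, c, (0 : Plane)}) := by
  obtain ⟨a, b, d, hab, hs, hc, h0, hx⟩ := h
  intro hi
  refine absurd (affine_pos_of_mem_interior (A := convexHull ℝ {s, c, (0 : Plane)}) hab ?_ hi)
    (not_lt.2 hx)
  refine fun y hy => affine_nonneg_of_mem_convexHull ?_ hy
  rintro y (rfl | rfl | rfl)
  · exact hs
  · exact hc
  · simpa using h0

lemma IsSeparated.neg {s c x : Plane} (h : IsSeparated s c (-x)) : IsSeparated (-s) (-c) x := by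
  obtain ⟨a, b, d, hab, hs, hc, h0, hx⟩ := h
  simp only [PiLp.neg_apply] at hx
  refine ⟨-a, -b, d, by simpa using hab, ?_, ?_, h0, ?_⟩ <;> simp only [PiLp.neg_apply] <;>
  linarith

lemma IsSeparated.map_mirror {s c x : Plane} (h : IsSeparated s c (mirror x)) :
    IsSeparated (mirror s) (mirror c) x := by
  obtain ⟨a, b, d, hab, hs, hc, h0, hx⟩ := h
  simp only [mirror_zero, mirror_one] at hx
  refine ⟨a, -b, d, by simpa using hab, ?_, ?_, h0, ?_⟩ <;> simp only [mirror_zero, mirror_one] <;>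
  linarith

/-- The separating line is the one through the origin and the shield. Its direction is only slightly
past the corner, and one step `eps` along the middle arc already clears it; this is the gap in the
sites. -/
lemma isSeparated_arcPt {j : ℕ} (hj : j ≤ 140) (hj0 : j ≠ 0) :
    IsSeparated shieldPt (rightCentre 0.58) (arcPt j) := by
  have h1 : 0 < shieldPt 1 := by rw [shieldPt_one]; linarith [sin_psi_gt]
  refine ⟨shieldPt 1, -shieldPt 0, 0, Or.inl h1.ne', by linarith, ?_, le_rfl, ?_⟩
  · have e0 : rightCentre 0.58 0 = 0.58 / 2 := rfl
    have e1 : rightCentre 0.58 1 = 0 := rfl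
    rw [e0, e1]; linarith
  · have h0 : shieldPt 0 = rad * Real.cos chi + 0.03 * Real.cos psi := by
      rw [rad_cos_chi, shieldPt_zero]; ring
    have h1 : shieldPt 1 = rad * Real.sin chi + 0.03 * Real.sin psi := by
      rw [rad_sin_chi, shieldPt_one]; ring
    have e : shieldPt 1 * arcPt j 0 + -shieldPt 0 * arcPt j 1 + 0 =
        rad * (0.03 * Real.sin (psi - arcAngle j) - rad * Real.sin (arcAngle j - chi)) := by
      rw [h0, h1, arcPt, midPt_zero, midPt_one, Real.sin_sub, Real.sin_sub]; ring
    rw [e]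
    have a1 := arcAngle_strictMono.monotone (Nat.one_le_iff_ne_zero.2 hj0)
    have a2 := arcAngle_le hj
    have a3 : arcAngle 1 = chi + eps := by simp [arcAngle]
    have p := Real.pi_gt_d2
    have p' := Real.pi_lt_d2
    have b1 : Real.sin 0.0094 ≤ Real.sin (arcAngle j - chi) :=
      Real.sin_le_sin_of_le_of_le_pi_div_two (by linarith) (by linarith [chi_gt])
        (by linarith [eps_gt])
    have b2 : Real.sin (psi - arcAngle j) ≤ Real.sin 0.24 :=
      Real.sin_le_sin_of_le_of_le_pi_div_two (by linarith [psi_gt, chi_gt]) (by linarith)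
        (by linarith [psi_lt, chi_gt, eps_pos])
    have b3 := mul_le_sin (x := 0.0094) (by norm_num) (by norm_num)
    have b4 := Real.sin_le (x := 0.24) (by norm_num)
    norm_num at b3
    refine mul_nonpos_of_nonneg_of_nonpos rad_pos.le ?_
    rw [show rad = 1.1507 by norm_num [rad]]
    linarith

/-- Cap points are cut off by the line through the centre and the shield, upper arc points by the
line through the origin and the shield, and the remaining sites, apart from the shield itself, by a
coordinate axis. -/
lemma isSeparated_shieldPt {x : Plane} (h : IsSite x) :
    IsSeparated shieldPt (rightCentre 0.58) x := by
  have s0 : 0 ≤ shieldPt 0 := by rw [shieldPt_zero, cos_psi]; norm_num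
  have s1 : 0 ≤ shieldPt 1 := by rw [shieldPt_one]; linarith [sin_psi_gt]
  have e0 : rightCentre 0.58 0 = 0.29 := by rw [rightCentre]; norm_num
  have e1 : rightCentre 0.58 1 = 0 := rfl
  have hx : ∀ x : Plane, x 0 ≤ 0 → IsSeparated shieldPt (rightCentre 0.58) x := fun x h =>
    ⟨1, 0, 0, Or.inl one_ne_zero, by linarith, by rw [e0]; norm_num, le_rfl, by linarith⟩
  have hy : ∀ x : Plane, x 1 ≤ 0 → IsSeparated shieldPt (rightCentre 0.58) x := fun x h =>
    ⟨0, 1, 0, Or.inr one_ne_zero, by linarith, by rw [e1]; norm_num, le_rfl, by linarith⟩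
  have hl : ∀ x : Plane, -Real.sin psi * (x 0 - 0.29) + Real.cos psi * x 1 ≤ 0 →
      IsSeparated shieldPt (rightCentre 0.58) x := fun x h => by
    have := sin_psi_gt
    refine ⟨-Real.sin psi, Real.cos psi, 0.29 * Real.sin psi, Or.inl (by linarith), ?_, ?_,
      by linarith, by linarith⟩
    · rw [shieldPt_zero, shieldPt_one]; exact le_of_eq (by ring)
    · rw [e0, e1]; exact le_of_eq (by ring)
  have hcap : ∀ i ≤ 783, IsSeparated shieldPt (rightCentre 0.58) (capPt i) := fun i hi => by
    refine hl _ ?_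
    have h1 := abs_le.1 (abs_capAngle_le hi)
    have h2 := Real.sin_nonneg_of_nonneg_of_le_pi (x := psi - capAngle i) (by linarith)
      (by linarith [psi_lt, Real.pi_gt_three])
    rw [Real.sin_sub] at h2
    rw [capPt, unitPt_zero, unitPt_one]
    linarith
  refine IsSite.cases hcap ?_ ?_ ?_ ?_ ?_ ?_ ?_ h
  · intro j hj
    rcases eq_or_ne j 0 with rfl | h
    · rw [← capPt_last]; exact hcap _ le_rfl
    · exact isSeparated_arcPt hj h
  · intro i hi
    refine hx _ ?_
    rw [PiLp.neg_apply]
    linarith [(capPt_abscissa hi).1]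
  · intro j hj
    refine hy _ ?_
    have h1 := arcAngle_ge j
    have h2 := arcAngle_le hj
    have h3 := chi_gt
    have : 0 ≤ arcPt j 1 :=
      mul_nonneg rad_pos.le (Real.sin_nonneg_of_nonneg_of_le_pi (by linarith) (by linarith))
    rw [PiLp.neg_apply]; linarith
  · refine hl _ ?_
    rw [shieldPt_zero, shieldPt_one]; exact le_of_eq (by ring)
  · exact hy _ (by rw [mirror_one]; linarith)
  · exact hy _ (by rw [PiLp.neg_apply]; linarith)
  · exact hx _ (by rw [PiLp.neg_apply, mirror_zero]; linarith)

/-- The point `q` of the circle with centre `c` is shielded. -/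
def HasShield (c q : Plane) : Prop := ∃ s, IsShield s ∧
  (∃ τ : ℝ, 1 < τ ∧ s = AffineMap.lineMap c q τ) ∧ ∀ x, IsSite x → IsSeparated s c x

lemma HasShield.neg {c q : Plane} (h : HasShield c q) : HasShield (-c) (-q) := by
  obtain ⟨s, hs, ⟨τ, hτ, e⟩, hx⟩ := h
  refine ⟨-s, hs.neg, ⟨τ, hτ, ?_⟩, fun x h => (hx _ h.neg).neg⟩
  rw [e, AffineMap.lineMap_apply_module, AffineMap.lineMap_apply_module]
  simp [add_comm]

lemma HasShield.map_mirror {c q : Plane} (h : HasShield c q) :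
    HasShield (mirror c) (mirror q) := by
  obtain ⟨s, hs, ⟨τ, hτ, e⟩, hx⟩ := h
  refine ⟨mirror s, hs.map_mirror, ⟨τ, hτ, ?_⟩, fun x h => (hx _ h.map_mirror).map_mirror⟩
  rw [e, AffineMap.lineMap_apply_module, AffineMap.lineMap_apply_module]
  refine plane_ext ?_ ?_ <;> simp
  ring

lemma hasShield_unitPt : HasShield (rightCentre 0.58) (unitPt psi) := by
  refine ⟨shieldPt, Or.inl rfl, ⟨1.03, by norm_num, ?_⟩, fun x => isSeparated_shieldPt⟩
  rw [AffineMap.lineMap_apply_module]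
  have e0 : rightCentre 0.58 0 = 0.29 := by rw [rightCentre]; norm_num
  have e1 : rightCentre 0.58 1 = 0 := rfl
  refine plane_ext ?_ ?_
  · simp only [PiLp.add_apply, PiLp.smul_apply, smul_eq_mul, e0, unitPt_zero, shieldPt_zero]; ring
  · simp only [PiLp.add_apply, PiLp.smul_apply, smul_eq_mul, e1, unitPt_one, shieldPt_one]; ring

/-- Subtracting the circle equations fixes the abscissa of `q`, and the ordinate is then known up to
sign; the lower intersection is the mirror image of the upper one. -/
lemma hasShield_right {q : Plane} (h1 : pwRight q = 0) (h2 : pwMid q = 0) :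
    HasShield (rightCentre 0.58) q := by
  rw [pwRight_eq] at h1
  rw [pwMid_eq, rad] at h2
  have h0 : q 0 = 0.29 + Real.cos psi := by rw [cos_psi]; linarith
  have h3 : q 1 ^ 2 = Real.sin psi ^ 2 := by
    rw [h0] at h1
    linarith [Real.sin_sq_add_cos_sq psi]
  rcases sq_eq_sq_iff_eq_or_eq_neg.1 h3 with h | h
  · rw [show q = unitPt psi from plane_ext h0 h]; exact hasShield_unitPt
  · have := hasShield_unitPt.map_mirror
    have e : mirror (rightCentre 0.58) = rightCentre 0.58 :=
      plane_ext (by simp) (by simp [rightCentre])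
    rwa [e, show mirror (unitPt psi) = q from plane_ext h0.symm h.symm] at this

lemma isShieldedConfiguration : IsShieldedConfiguration 0.58 1.1507 sites shields where
  shields_subset x hx := mem_sites.2 (Or.inr (mem_shields.1 hx))
  card_shields := card_shields
  mem_outline x hx hs := by
    rcases mem_sites.1 hx with h | h
    · exact h.mem_outline
    · exact absurd (mem_shields.2 h) hs
  shield c hc q hq := by
    have key : HasShield c q := by
      rcases hc with rfl | rfl
      · exact hasShield_right (mem_sphere_right.1 hq.1) (mem_sphere_mid.1 hq.2)
      · have := hasShield_right (mem_sphere_left.1 hq.1)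
          (by rw [pwMid_neg]; exact mem_sphere_mid.1 hq.2)
        rw [leftCentre_eq, ← neg_neg q]
        exact this.neg
    obtain ⟨s, hs, hτ, hx⟩ := key
    exact ⟨s, mem_shields.2 hs, hτ, fun x h => (hx x (mem_sites.1 h)).notMem_interior⟩

lemma completedByFans : CompletedByFans 0.58 1.1507 shields triangulation := by
  intro t ht h3
  obtain ⟨u, v, w, h, rfl⟩ := delaunayCells.exists_eq_of_card ht h3
  obtain ⟨a, b, c, hb, e⟩ := h.exists_base
  have e' : ((({u, v, w} : Finset Plane)) : Set Plane) = {a, b, c} := by rw [← e]; simp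
  rw [e']
  refine hb.inscribed.imp_left fun hs => ⟨c, mem_shields.2 hs, ?_⟩
  rw [← Finset.mem_coe, e']
  simp

/-! ### The convex hull -/

/-- The upper right corner lies in the triangle formed by its shield, the upper left corner `-capPt
0` and the lower right corner `capPt 0`. -/
lemma not_convexIndependent_sites : ¬ ConvexIndependent ℝ ((↑) : sites → Plane) := by
  intro h
  have h := convexIndependent_set_iff_notMem_convexHull_sdiff.1
    (show ConvexIndependent ℝ (Subtype.val : ↥(sites : Set Plane) → Plane) from h) (capPt 783)
    (mem_sites.2 (Or.inl (onOutline_capPt le_rfl)))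
  have e0 : capPt 783 0 = 40821049 / 58000000 := by
    rw [capPt_last, arcPt, arcAngle_zero, midPt_zero, rad_mul_cos_chi]
  have e1 : capPt 783 1 = Real.sin psi := by rw [capPt, capAngle_last, unitPt_one]
  have f0 := capPt_zero_abscissa
  have f1 : capPt 0 1 = -Real.sin psi := by rw [capPt, capAngle_zero, unitPt_one, Real.sin_neg]
  have hb := sin_psi_gt
  refine h (convexHull_mono (s := {shieldPt, -capPt 0, capPt 0}) ?_ ?_)
  · rintro x (rfl | rfl | rfl)
    · refine ⟨mem_sites.2 (Or.inr (Or.inl rfl)), fun h => ?_⟩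
      have : shieldPt 1 = capPt 783 1 := by rw [h]
      rw [shieldPt_one, e1] at this
      linarith
    · refine ⟨mem_sites.2 (Or.inl (onOutline_capPt (Nat.zero_le _)).neg), fun h => ?_⟩
      have : -capPt 0 0 = capPt 783 0 := by rw [← h, PiLp.neg_apply]
      rw [f0, e0] at this
      linarith
    · refine ⟨mem_sites.2 (Or.inl (onOutline_capPt (Nat.zero_le _))), fun h => ?_⟩
      have : capPt 0 1 = capPt 783 1 := by rw [h]
      rw [f1, e1] at this
      linarith
  · refine mem_triangle_of_crs_nonneg ?_ ?_ ?_ ?_ <;>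
    simp only [crs, PiLp.neg_apply, e0, e1, f0, f1, shieldPt_zero, shieldPt_one, cos_psi] <;>
    linarith

lemma pairDilation_le_dilation {P : Finset Plane} {G : SimpleGraph Plane} {u v : Plane}
    (hu : u ∈ P) (hv : v ∈ P) (huv : u ≠ v) : pairDilation G u v ≤ dilation P G :=
  le_iSup₂_of_le u hu (le_iSup₂_of_le v hv (le_iSup_of_le huv le_rfl))

theorem theorem2 :
    ∃ (P S : Finset Plane) (K : Geometry.SimplicialComplex ℝ Plane),
      IsDelaunay P K ∧
      ENNReal.ofReal 1.5846 < dilation P (edgeGraph K) ∧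
      ¬ ConvexIndependent ℝ ((↑) : P → Plane) ∧
      IsShieldedConfiguration 0.58 1.1507 P S ∧
      CompletedByFans 0.58 1.1507 S K ∧
      ∃ p ∈ P, ∃ p' ∈ P,
        p ∈ Metric.sphere (rightCentre 0.58) 1 ∧ p' ∈ Metric.sphere (leftCentre 0.58) 1 ∧
        |dist p p' - 2.4| ≤ 0.001 ∧
        ENNReal.ofReal 1.5846 < pairDilation (edgeGraph K) p p' ∧
        pairDilation (edgeGraph K) p p' < ENNReal.ofReal 1.5847 := by
  have h := dist_bounds
  have hp : capPt 703 ∈ sites := mem_sites.2 (Or.inl (onOutline_capPt (by norm_num)))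
  have hp' : -capPt 703 ∈ sites := mem_sites.2 (Or.inl (onOutline_capPt (by norm_num)).neg)
  have hne : capPt 703 ≠ -capPt 703 := dist_pos.1 (by linarith [h.1])
  refine ⟨sites, shields, triangulation, delaunayCells.isDelaunay,
    pairDilation_bounds.1.trans_le (pairDilation_le_dilation hp hp' hne),
    not_convexIndependent_sites, isShieldedConfiguration, completedByFans, capPt 703, hp,
    -capPt 703, hp', mem_sphere_right.2 (pwRight_unitPt _), mem_sphere_left.2 ?_, ?_,
    pairDilation_bounds⟩
  · rw [neg_neg]; exact pwRight_unitPt _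
  · rw [abs_le]; constructor <;> linarith [h.1, h.2]
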